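/- For a kernel $K\ge 0$ on $\mathbb R^2$ and measurable $A,B\subset\mathbb R^2$ put $L_K(A,B)=\int_A\int_B K(x-\bar x)\,d\bar x\,dx$, and for measurable $E$ and open $\Omega$ let $$P_{K,\Omega}(E)=L_K(E\cap\Omega,E^c\cap\Omega)+L_K(E\cap\Omega,E^c\setminus\Omega)+L_K(E\setminus\Omega,E^c\cap\Omega).$$ $E$ is a *stable set* for $P_{K,\Omega}$ if $P_{K,\Omega}(E)<\infty$ and for every vector field $X=X(x,t)\in C^2_c(\Omega\times(-1,1);\mathbb R^2)$ and every $\epsilon>0$ there is $t_0>0$ such that, with $F_t=\Psi_t(E)$, where $\Psi_t$ is the integral flow of $X$ ($\Psi_0=\mathrm{id}$, $\partial_t\Psi_t(x)=X(\Psi_t(x),t)$), $$0\le P_{K,\Omega}(F_t\cup E)-P_{K,\Omega}(E)+\epsilon t^2,\qquad 0\le P_{K,\Omega}(F_t\cap E)-P_{K,\Omega}(E)+\epsilon t^2\qquad\text{for all } t\in(-t_0,t_0).$$ For $s\in(0,1)$ and $\lambda>0$, the class $\mathcal L_2(s,\lambda,\Lambda)$ consists of the even kernels $K$ on $\mathbb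 R^2$, of class $C^2$ off the origin, such that for all $z\ne0$ and all unit vectors $e$ $$\frac{\lambda}{|z|^{2+s}}\le K(z)\le\frac{\Lambda}{|z|^{2+s}},\qquad \max\{|z|\,|\partial_eK(z)|,\ |z|^2|\partial_{ee}K(z)|\}\le\frac{\Lambda}{|z|^{2+s}}.$$ $B_r$ is the open disc of radius $r$ centred at $0$, and $\mathrm{Per}_\Omega(E)=\sup\{\int_{E\cap\Omega}\mathrm{div}\,\phi : \phi\in C^1_c(\Omega;\mathbb R^2),\ |\phi|\le1\}$ is the classical perimeter of $E$ in $\Omega$. **Theorem.** (a) There is a universal constant $C_0$ such that for all $s\in(0,1)$, $\lambda>0$ and $\Lambda$ there is a constant $C>0$, depending only on $s,\lambda,\Lambda$, with the following property. Let $K\in\mathcal L_2(s,\lambda,\Lambda)$, let $R\ge4$, let $E\subset\mathbb R^2$ be a stable set for $P_{K,B_R}$, and put $\varepsilon=CR^{-s/2}$. Then, after a rotation (that is, after replacing $E$ by its image under one suitable rotation about the origin), $E$ satisfies * (F1) for some $t\in[-1,1]$, $|(E\,\triangle\,\{x_2\le t\})\cap B_1|\le\varepsilon$; * (F2) there are a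 measurable set $\mathcal B\subset[-1,1]$ with $|\mathcal B|\le\varepsilon$ and a measurable $g:[-1,1]\to[-1,1]$ such that, up to a Lebesgue null set, $(E\cap B_1)\setminus(\mathcal B\times\mathbb R)=\{(y,x_2)\in B_1: y\in[-1,1]\setminus\mathcal B,\ x_2\le g(y)\}$; * (F3) with $F^\varepsilon=\{(x_1,x_2/\varepsilon):(x_1,x_2)\in F\}$, $\mathrm{Per}_{B_1^\varepsilon}(E^\varepsilon)\le C_0(1+\varepsilon)$ (in particular, the bound is the universal constant $2C_0$ as soon as $\varepsilon\le1$). In particular $|(E\,\triangle\,\mathfrak h)\cap B_1|\le CR^{-s/2}$ for some half-plane $\mathfrak h$. (b) For every $s\in(0,1)$ there is a constant $C>0$, depending only on $s$, such that if $R\ge2$ and $E$ is a stable set in $B_R$ for the fractional $s$-perimeter, that is, for $P_{K,B_R}$ with $K(z)=|z|^{-2-s}$, then $|(E\,\triangle\,\mathfrak h)\cap B_1|\le CR^{-s/2}$ for some half-plane $\mathfrak h$; moreover, after a rotation, there are a measurable set $\mathcal B\subset(-1,1)$ with $|\mathcal B|\le CR^{-s/2}$ and a measurable $g:(-1,1)\to(-1,1)$,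 with oscillation at most $CR^{-s/2}$ on $(-1,1)\setminus\mathcal B$, such that, up to a Lebesgue null set, $(E\cap B_1)\setminus(\mathcal B\times\mathbb R)=\{(y,x_2)\in B_1: y\in(-1,1)\setminus\mathcal B,\ x_2\le g(y)\}$. -/

import Mathlib

open MeasureTheory Set Metric
open scoped ENNReal

noncomputable section

namespace NonlocalPerimeter

/-- The Euclidean space `ℝⁿ`. -/
abbrev Eu (n : ℕ) : Type := EuclideanSpace ℝ (Fin n)

/-- The interaction `L_K(A, B) = ∫_A ∫_B K(x - y) dy dx`, with values in `[0, ∞]`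
(it is used for nonnegative kernels and for disjoint `A`, `B`). -/
def interaction {n : ℕ} (K : Eu n → ℝ) (A B : Set (Eu n)) : ℝ≥0∞ :=
  ∫⁻ x in A, ∫⁻ y in B, ENNReal.ofReal (K (x - y))

/-- The `K`-perimeter of `E` inside `Ω`. -/
def perK {n : ℕ} (K : Eu n → ℝ) (Ω E : Set (Eu n)) : ℝ≥0∞ :=
  interaction K (E ∩ Ω) (Eᶜ ∩ Ω) + interaction K (E ∩ Ω) (Eᶜ \ Ω)
    + interaction K (E \ Ω) (Eᶜ ∩ Ω)

/-- `Ψ` is the integral flow, for times `t ∈ (-1, 1)`, of the time dependent vector field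
`X = X(x, t)`: `Ψ_0 = id` and `∂_t Ψ_t(x) = X(Ψ_t(x), t)`. -/
def IsIntegralFlow {n : ℕ} (X : Eu n × ℝ → Eu n) (Ψ : ℝ → Eu n → Eu n) : Prop :=
  ∀ x : Eu n, Ψ 0 x = x ∧
    ∀ t ∈ Ioo (-1 : ℝ) 1, HasDerivAt (fun τ : ℝ => Ψ τ x) (X (Ψ t x, t)) t

/-- `E` is a stable set for the functional `perK K Ω`. Since `perK K Ω E` is finite, the
inequalities `0 ≤ P(F) - P(E) + ε t²` are written without subtraction in `[0, ∞]`. -/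
def IsStableSet {n : ℕ} (K : Eu n → ℝ) (Ω E : Set (Eu n)) : Prop :=
  perK K Ω E < ∞ ∧
  ∀ X : Eu n × ℝ → Eu n, ContDiff ℝ 2 X → HasCompactSupport X →
    tsupport X ⊆ Ω ×ˢ Ioo (-1 : ℝ) 1 →
    ∀ Ψ : ℝ → Eu n → Eu n, IsIntegralFlow X Ψ →
      ∀ ε : ℝ, 0 < ε → ∃ t₀ : ℝ, 0 < t₀ ∧ ∀ t ∈ Ioo (-t₀) t₀,
        perK K Ω E ≤ perK K Ω (Ψ t '' E ∪ E) + ENNReal.ofReal (ε * t ^ 2) ∧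
        perK K Ω E ≤ perK K Ω (Ψ t '' E ∩ E) + ENNReal.ofReal (ε * t ^ 2)

/-- The class `𝓛₂(s, lam, Lam)` of kernels on `ℝⁿ`: even, `C²` away from the origin, comparable
to `|z|^{-n-s}`, with the corresponding bounds for the pure first and second derivatives
`∂_e K`, `∂_{ee} K` in every unit direction `e`. The value `K 0` is irrelevant. -/
structure KernelL2 {n : ℕ} (s lam Lam : ℝ) (K : Eu n → ℝ) : Prop where
  even : ∀ z, K (-z) = K z
  smooth : ContDiffOn ℝ 2 K {0}ᶜ
  lower : ∀ z, z ≠ 0 → lam / ‖z‖ ^ ((n : ℝ) + s) ≤ K z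
  upper : ∀ z, z ≠ 0 → K z ≤ Lam / ‖z‖ ^ ((n : ℝ) + s)
  deriv_bound : ∀ z, z ≠ 0 → ∀ e : Eu n, ‖e‖ = 1 →
    max (‖z‖ * |fderiv ℝ K z e|) (‖z‖ ^ 2 * |fderiv ℝ (fun w => fderiv ℝ K w e) z e|)
      ≤ Lam / ‖z‖ ^ ((n : ℝ) + s)

/-- The kernel `|z|^{-n-s}` of the fractional `s`-perimeter in `ℝⁿ`. -/
def fracKernel (n : ℕ) (s : ℝ) (z : Eu n) : ℝ := 1 / ‖z‖ ^ ((n : ℝ) + s)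

/-- The divergence of a vector field on `ℝⁿ`. -/
def divergence {n : ℕ} (φ : Eu n → Eu n) (x : Eu n) : ℝ :=
  ∑ i : Fin n, (fderiv ℝ φ x (EuclideanSpace.single i 1)) i

/-- The classical perimeter of `E` in the open set `Ω`: the total variation in `Ω` of the
characteristic function of `E`, i.e. the supremum of `∫_{E ∩ Ω} div φ` over all
`φ ∈ C¹_c(Ω; ℝⁿ)` with `|φ| ≤ 1`. It is `∞` if `E` does not have finite perimeter in `Ω`. -/
def classicalPer {n : ℕ} (Ω E : Set (Eu n)) : ℝ≥0∞ :=
  ⨆ φ : {φ : Eu n → Eu n // ContDiff ℝ 1 φ ∧ HasCompactSupport φ ∧ tsupport φ ⊆ Ω ∧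
      ∀ x, ‖φ x‖ ≤ 1},
    ENNReal.ofReal (∫ x in E ∩ Ω, divergence φ.1 x)

/-- A rotation of the plane: a linear isometry of determinant one. -/
def IsRotation (U : Eu 2 ≃ₗᵢ[ℝ] Eu 2) : Prop :=
  LinearMap.det (U.toLinearEquiv : Eu 2 →ₗ[ℝ] Eu 2) = 1

/-- The dilation of a planar set by the factor `1/ε` in the vertical direction:
`F^ε = {(x₁, x₂/ε) : (x₁, x₂) ∈ F}`. -/
def vertDilate (ε : ℝ) (F : Set (Eu 2)) : Set (Eu 2) :=
  (fun x : Eu 2 => (!₂[x 0, x 1 / ε] : Eu 2)) '' F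

/-- `E` is `ε`-close in measure, in the unit disc, to a half-plane `{x₂ ≤ t}`, `t ∈ [-1, 1]`. -/
def FlatL1 (ε : ℝ) (E : Set (Eu 2)) : Prop :=
  ∃ t ∈ Icc (-1 : ℝ) 1,
    volume (symmDiff E {x : Eu 2 | x 1 ≤ t} ∩ ball 0 1) ≤ ENNReal.ofReal ε

/-- In the unit disc and outside the vertical strips over the set `bad`, the set `E` agrees, up
to a Lebesgue null set, with the subgraph `{x₂ ≤ g(x₁)}`. -/
def IsSubgraphOff (E : Set (Eu 2)) (bad : Set ℝ) (g : ℝ → ℝ) : Prop :=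
  ((E ∩ ball 0 1) \ {x : Eu 2 | x 0 ∈ bad} : Set (Eu 2)) =ᵐ[volume]
    ({x : Eu 2 | x ∈ ball (0 : Eu 2) 1 ∧ x 0 ∉ bad ∧ x 1 ≤ g (x 0)} : Set (Eu 2))

/-- In the unit disc, `E` is the subgraph of a measurable function with values in `[-1, 1]`
after removing the vertical strips over a set of measure at most `ε`. -/
def FlatGraph (ε : ℝ) (E : Set (Eu 2)) : Prop :=
  ∃ (bad : Set ℝ) (g : ℝ → ℝ), bad ⊆ Icc (-1) 1 ∧ MeasurableSet bad ∧
    volume bad ≤ ENNReal.ofReal ε ∧ Measurable g ∧ (∀ y ∈ Icc (-1 : ℝ) 1, g y ∈ Icc (-1 : ℝ) 1) ∧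
    IsSubgraphOff E bad g

/-- As `FlatGraph`, with a function from `(-1, 1)` to `(-1, 1)` whose oscillation off the bad
set is also at most `ε`. -/
def FlatGraphOsc (ε : ℝ) (E : Set (Eu 2)) : Prop :=
  ∃ (bad : Set ℝ) (g : ℝ → ℝ), bad ⊆ Ioo (-1) 1 ∧ MeasurableSet bad ∧
    volume bad ≤ ENNReal.ofReal ε ∧ Measurable g ∧ (∀ y ∈ Ioo (-1 : ℝ) 1, g y ∈ Ioo (-1 : ℝ) 1) ∧
    (∀ y ∈ Ioo (-1 : ℝ) 1 \ bad, ∀ y' ∈ Ioo (-1 : ℝ) 1 \ bad, |g y - g y'| ≤ ε) ∧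
    IsSubgraphOff E bad g

/-- The classical perimeter of the vertical dilation `E^ε` in `B₁^ε` is at most `M`. -/
def FlatPer (M ε : ℝ) (E : Set (Eu 2)) : Prop :=
  classicalPer (vertDilate ε (ball 0 1)) (vertDilate ε E) ≤ ENNReal.ofReal M

/-- `E` is `ε`-close in measure, in the unit disc, to some half-plane. -/
def NearHalfPlane (ε : ℝ) (E : Set (Eu 2)) : Prop :=
  ∃ (ν : Eu 2) (c : ℝ), ‖ν‖ = 1 ∧
    volume (symmDiff E {x : Eu 2 | inner ℝ ν x ≤ c} ∩ ball 0 1) ≤ ENNReal.ofReal ε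

end NonlocalPerimeter

end

namespace NonlocalPerimeter

open Filter Topology
open scoped ContDiff

/-! A stable set gains nothing to second order from being mixed with its own displacements. Let F be
the image of E under x ↦ x - tφ(x)v, with φ a cutoff equal to 1 near B_r and supported in B_ρ, and
let P be the K-perimeter in B_R. Submodularity (`perK_submodular`) says that P(F ∪ E) + P(F ∩ E)
plus the interaction of F \ E with E \ F is at most P(F) + P(E), while stability bounds each of the
first two terms below by P(E) - εt². Adding the same estimate for the opposite displacement bounds
the interaction by a symmetric second difference of P. First-order terms cancel there, so it is at
most a multiple of t²/(ρ-r)² times the perimeter in B_ρ (`second_variation_le`). Since K is bounded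
below on B_r - B_r, the volume entering E and the volume leaving E under translation by tv have
product at most (Wt)², where W² is of order r^(2+s) P_{B_ρ}(E)/(ρ-r)² (`stable_in_mul_out_le`).

The two volumes differ only by O(rt), because a translated disc differs from itself by thin
crescents. The product bound is therefore a bound on the total variation of E. Conversely, the
nonlocal perimeter is interpolated between variation and area (`perK_le_of_hasVar`). As W is only a
square root of the perimeter, this loop is sublinear: one turn gives `hasVar_step`, and iterating
over nested radii gives variation O(R) in a disc of radius comparable to R (`exists_hasVar_bound`).
There the perimeter is O(R^(2-s)), and a cutoff spread over a length of order R then gives W =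
O(R^(-s/2)) at unit scale (`exists_smallProduct_bound`).

In the plane the linear functional v ↦ ∫_E ∂_v η has a nonzero kernel. In such a direction entering
and leaving balance up to o(t), so both are O(Wt). In the orthogonal direction at least one of them
is, and a rotation makes it the entering one. On a line, a crossing costs a full unit of variation,
so variation below 1 means no crossing. Slicing then shows that off few vertical strips E is a
subgraph, and that off few levels the horizontal slices are trivial, which bounds the oscillation of
the graph (`exists_graph_of_small_variation`). Finally, the horizontal variation is O(ε), so it
survives division by ε, and the vertical variation is at most a universal constant plus O(ε). This
bounds the perimeter of the dilated set. -/

/-! ### Cutoffs, displacements and the flows that realise them -/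

theorem exists_deriv_smoothTransition_bound :
    ∃ C : ℝ, 0 < C ∧ ∀ x : ℝ, |deriv Real.smoothTransition x| ≤ C := by
  have hcont : Continuous (deriv Real.smoothTransition) :=
    (Real.smoothTransition.contDiff (n := 1)).continuous_deriv le_rfl
  have hsupp : HasCompactSupport (deriv Real.smoothTransition) := by
    refine HasCompactSupport.of_support_subset_isCompact (isCompact_Icc (a := (0:ℝ)) (b := 1)) ?_
    intro x hx
    by_contra hxm
    apply hx
    rw [mem_Icc, not_and_or, not_le, not_le] at hxm
    rcases hxm with h | h
    · have : Real.smoothTransition =ᶠ[𝓝 x] fun _ => 0 := by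
        filter_upwards [gt_mem_nhds h] with y hy
        exact Real.smoothTransition.zero_of_nonpos hy.le
      rw [this.deriv_eq]; simp
    · have : Real.smoothTransition =ᶠ[𝓝 x] fun _ => 1 := by
        filter_upwards [lt_mem_nhds h] with y hy
        exact Real.smoothTransition.one_of_one_le hy.le
      rw [this.deriv_eq]; simp
  obtain ⟨C, hC⟩ := hcont.bounded_above_of_compact_support hsupp
  exact ⟨max C 1, by positivity, fun x => (hC x).trans (le_max_left _ _)⟩

/-- Smooth radial cutoff functions with the natural gradient bound. -/
theorem exists_cutoff (n : ℕ) : ∃ C : ℝ, 0 < C ∧ ∀ r ρ : ℝ, 0 < r → r < ρ →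
    ∃ φ : Eu n → ℝ, ContDiff ℝ ∞ φ ∧ HasCompactSupport φ ∧ tsupport φ ⊆ ball 0 ρ ∧
      (∀ x, 0 ≤ φ x ∧ φ x ≤ 1) ∧ (∀ x ∈ ball (0 : Eu n) r, φ x = 1) ∧
      ∀ x, ‖fderiv ℝ φ x‖ ≤ C / (ρ - r) := by
  obtain ⟨C, hC0, hC⟩ := exists_deriv_smoothTransition_bound
  refine ⟨4 * C, by positivity, fun r ρ hr hρ => ?_⟩
  -- Stopping at the midpoint puts the closed support inside the open ball. The gradient is at most
  -- C · 2q/((q-r)(q+r)) ≤ 2C/(q-r), which is 4C/(ρ-r).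
  set q := (r + ρ) / 2 with hq
  have hrq : r < q := by rw [hq]; linarith
  have hqρ : q < ρ := by rw [hq]; linarith
  have hq0 : 0 < q := by linarith
  have hd : 0 < q ^ 2 - r ^ 2 := by nlinarith
  set φ : Eu n → ℝ := fun x => Real.smoothTransition ((q ^ 2 - ‖x‖ ^ 2) / (q ^ 2 - r ^ 2)) with hφ
  have hout : ∀ x, q ≤ ‖x‖ → φ x = 0 := by
    intro x hx
    apply Real.smoothTransition.zero_of_nonpos
    apply div_nonpos_of_nonpos_of_nonneg _ hd.le
    nlinarith [norm_nonneg x]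
  have hsub : Function.support φ ⊆ closedBall 0 q := by
    intro x hx
    rw [mem_closedBall_zero_iff]
    by_contra h
    exact hx (hout x (by linarith))
  have hts : tsupport φ ⊆ closedBall 0 q := closure_minimal hsub isClosed_closedBall
  have hinner : ∀ x : Eu n, HasFDerivAt (fun x : Eu n => (q ^ 2 - ‖x‖ ^ 2) / (q ^ 2 - r ^ 2))
      ((q ^ 2 - r ^ 2)⁻¹ • (-((2 : ℝ) • (innerSL ℝ x : Eu n →L[ℝ] ℝ)))) x := by
    intro x
    have h1 : HasFDerivAt (fun x : Eu n => ‖x‖ ^ 2) ((2 : ℝ) • (innerSL ℝ x : Eu n →L[ℝ] ℝ)) x := by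
      have := (hasStrictFDerivAt_norm_sq x).hasFDerivAt
      rw [← Nat.cast_smul_eq_nsmul ℝ] at this
      exact_mod_cast this
    have h2 := (h1.const_sub (q ^ 2)).const_smul ((q ^ 2 - r ^ 2)⁻¹)
    refine h2.congr_of_eventuallyEq (Eventually.of_forall fun y => ?_)
    simp [div_eq_inv_mul]
  refine ⟨φ, ?_, ?_, ?_, ?_, ?_, ?_⟩
  · apply Real.smoothTransition.contDiff.comp
    exact (contDiff_const.sub (contDiff_norm_sq ℝ)).div_const _
  · exact HasCompactSupport.of_support_subset_isCompact (isCompact_closedBall 0 q) hsub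
  · exact hts.trans (closedBall_subset_ball hqρ)
  · exact fun x => ⟨Real.smoothTransition.nonneg _, Real.smoothTransition.le_one _⟩
  · intro x hx
    rw [mem_ball_zero_iff] at hx
    apply Real.smoothTransition.one_of_one_le
    rw [le_div_iff₀ hd]
    nlinarith [norm_nonneg x]
  · intro x
    have hdf : HasFDerivAt φ (deriv Real.smoothTransition ((q ^ 2 - ‖x‖ ^ 2) / (q ^ 2 - r ^ 2)) •
        ((q ^ 2 - r ^ 2)⁻¹ • (-((2 : ℝ) • (innerSL ℝ x : Eu n →L[ℝ] ℝ))))) x := by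
      have h3 : HasDerivAt Real.smoothTransition
          (deriv Real.smoothTransition ((q ^ 2 - ‖x‖ ^ 2) / (q ^ 2 - r ^ 2)))
          ((q ^ 2 - ‖x‖ ^ 2) / (q ^ 2 - r ^ 2)) :=
        ((Real.smoothTransition.contDiff (n := 1)).differentiable (by simp)).differentiableAt.hasDerivAt
      exact h3.comp_hasFDerivAt x (hinner x)
    rcases le_or_gt ‖x‖ q with hx | hx
    · rw [hdf.fderiv, norm_smul, norm_smul, norm_neg, norm_smul,
        innerSL_apply_norm, Real.norm_eq_abs, Real.norm_eq_abs, Real.norm_eq_abs, abs_inv,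
        abs_of_pos hd]
      have e : (q ^ 2 - r ^ 2) = (q - r) * (q + r) := by ring
      have hqr : 0 < q - r := by linarith
      have h5 : (q ^ 2 - r ^ 2)⁻¹ * (|(2 : ℝ)| * ‖x‖) ≤ 4 / (ρ - r) := by
        rw [e, inv_mul_eq_div, div_le_div_iff₀ (by positivity) (by linarith)]
        have : ρ - r = 2 * (q - r) := by rw [hq]; ring
        rw [this]
        norm_num
        nlinarith [norm_nonneg x, mul_pos hqr hr, mul_nonneg hqr.le (sub_nonneg.2 hx)]
      calc _ ≤ C * (4 / (ρ - r)) := mul_le_mul (hC _) h5 (by positivity) hC0.le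
        _ = _ := by ring
    · have : φ =ᶠ[𝓝 x] fun _ => 0 := by
        filter_upwards [(isOpen_lt continuous_const continuous_norm).mem_nhds hx] with y hy
        exact hout y (le_of_lt hy)
      rw [this.fderiv_eq]
      simp
      have : 0 < ρ - r := by linarith
      positivity

theorem lipschitz_of_fderiv_bound {n : ℕ} {φ : Eu n → ℝ} (hφ : ContDiff ℝ ∞ φ) {L : ℝ}
    (hL : ∀ x, ‖fderiv ℝ φ x‖ ≤ L) (x y : Eu n) : |φ x - φ y| ≤ L * ‖x - y‖ := by
  have := Convex.norm_image_sub_le_of_norm_fderiv_le (𝕜 := ℝ) (f := φ) (s := univ) (x := y) (y := x)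
    (fun z _ => (hφ.differentiable (by simp)).differentiableAt) (fun z _ => hL z) convex_univ
    (mem_univ _) (mem_univ _)
  simpa using this

theorem two_le_infty : (2 : WithTop ℕ∞) ≤ ((⊤ : ℕ∞) : WithTop ℕ∞) := by
  have : ((2 : ℕ∞) : WithTop ℕ∞) ≤ ((⊤ : ℕ∞) : WithTop ℕ∞) := WithTop.coe_le_coe.2 le_top
  exact this

/-- The displacement `x ↦ x + a φ(x) v`. -/
def displace {n : ℕ} (φ : Eu n → ℝ) (v : Eu n) (a : ℝ) (x : Eu n) : Eu n := x + (a * φ x) • v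

/-- The displacement is the identity plus a map of Lipschitz constant at most 1/2, so the
quantitative inverse function theorem applies globally. -/
theorem displace_approximatesLinearOn {n : ℕ} {φ : Eu n → ℝ} {L : ℝ}
    (hL : ∀ x y, |φ x - φ y| ≤ L * ‖x - y‖) {v : Eu n} {a : ℝ} (ha : |a| * (L * ‖v‖) ≤ 1 / 2) :
    ApproximatesLinearOn (displace φ v a) (ContinuousLinearEquiv.refl ℝ (Eu n) : Eu n →L[ℝ] Eu n)
      univ (1 / 2 : NNReal) := by
  intro x _ y _
  have : displace φ v a x - displace φ v a y -
      (ContinuousLinearEquiv.refl ℝ (Eu n) : Eu n →L[ℝ] Eu n) (x - y) =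
      (a * (φ x - φ y)) • v := by
    simp only [displace, ContinuousLinearEquiv.coe_coe, ContinuousLinearEquiv.refl_apply]
    rw [mul_sub, sub_smul]; abel
  rw [this, norm_smul, Real.norm_eq_abs, abs_mul]
  have h1 := hL x y
  calc |a| * |φ x - φ y| * ‖v‖ ≤ |a| * (L * ‖x - y‖) * ‖v‖ := by gcongr
    _ = (|a| * (L * ‖v‖)) * ‖x - y‖ := by ring
    _ ≤ 1 / 2 * ‖x - y‖ := by gcongr
    _ = _ := by norm_num

theorem displace_bijective {n : ℕ} {φ : Eu n → ℝ} {L : ℝ}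
    (hL : ∀ x y, |φ x - φ y| ≤ L * ‖x - y‖) {v : Eu n} {a : ℝ} (ha : |a| * (L * ‖v‖) ≤ 1 / 2) :
    Function.Bijective (displace φ v a) := by
  have h := displace_approximatesLinearOn hL ha
  have hc : Subsingleton (Eu n) ∨ (1 / 2 : NNReal) <
      ‖((ContinuousLinearEquiv.refl ℝ (Eu n)).symm : Eu n →L[ℝ] Eu n)‖₊⁻¹ := by
    rcases subsingleton_or_nontrivial (Eu n) with h | h
    · exact Or.inl h
    · right
      have : ‖((ContinuousLinearEquiv.refl ℝ (Eu n)).symm : Eu n →L[ℝ] Eu n)‖₊ = 1 := by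
        apply NNReal.eq
        simp
      rw [this, inv_one]
      exact NNReal.half_lt_self one_ne_zero
  exact ⟨injOn_univ.1 (h.injOn hc), h.surjective hc⟩

/-- A smooth family of displacements is a diffeomorphism of space-time. -/
theorem exists_displace_homeomorph {n : ℕ} {φ : Eu n → ℝ} {θ : ℝ → ℝ} {v : Eu n} {L : ℝ}
    (hφ : ContDiff ℝ ∞ φ) (hθ : ContDiff ℝ ∞ θ) (hL : ∀ x, ‖fderiv ℝ φ x‖ ≤ L)
    (hθL : ∀ t, |θ t| * (L * ‖v‖) ≤ 1 / 2) :
    ∃ e : Eu n × ℝ ≃ₜ Eu n × ℝ, (∀ x t, e (x, t) = (displace φ v (θ t) x, t)) ∧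
      ContDiff ℝ 2 e.symm := by
  have hLip := lipschitz_of_fderiv_bound hφ hL
  set Φ : Eu n × ℝ → Eu n × ℝ := fun p => (p.1 + (θ p.2 * φ p.1) • v, p.2) with hΦ
  have hΦs : ContDiff ℝ ∞ Φ := by
    have h1 : ContDiff ℝ ∞ fun p : Eu n × ℝ => φ p.1 := hφ.comp contDiff_fst
    have h2 : ContDiff ℝ ∞ fun p : Eu n × ℝ => θ p.2 := hθ.comp contDiff_snd
    exact (contDiff_fst.add ((h2.mul h1).smul contDiff_const)).prodMk contDiff_snd
  have hbij : Function.Bijective Φ := by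
    constructor
    · rintro ⟨x, t⟩ ⟨y, u⟩ h
      obtain ⟨h1, rfl⟩ := Prod.mk.inj h
      rw [(displace_bijective hLip (hθL t)).1 (a₁ := x) (a₂ := y) h1]
    · rintro ⟨y, t⟩
      obtain ⟨x, hx⟩ := (displace_bijective hLip (hθL t)).2 y
      exact ⟨(x, t), Prod.ext hx rfl⟩
  have hder : ∀ p : Eu n × ℝ, HasFDerivAt Φ (((ContinuousLinearMap.fst ℝ (Eu n) ℝ) +
      ((θ p.2 • ((fderiv ℝ φ p.1).comp (ContinuousLinearMap.fst ℝ (Eu n) ℝ)) +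
        φ p.1 • ((fderiv ℝ θ p.2).comp (ContinuousLinearMap.snd ℝ (Eu n) ℝ))).smulRight v)).prod
      (ContinuousLinearMap.snd ℝ (Eu n) ℝ)) p := by
    intro p
    have h1 : HasFDerivAt (fun p : Eu n × ℝ => φ p.1)
        ((fderiv ℝ φ p.1).comp (ContinuousLinearMap.fst ℝ (Eu n) ℝ)) p :=
      HasFDerivAt.comp p ((hφ.differentiable (by simp)).differentiableAt.hasFDerivAt) hasFDerivAt_fst
    have h2 : HasFDerivAt (fun p : Eu n × ℝ => θ p.2)
        ((fderiv ℝ θ p.2).comp (ContinuousLinearMap.snd ℝ (Eu n) ℝ)) p :=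
      HasFDerivAt.comp p ((hθ.differentiable (by simp)).differentiableAt.hasFDerivAt) hasFDerivAt_snd
    exact (hasFDerivAt_fst.add ((h2.mul h1).smul_const v)).prodMk hasFDerivAt_snd
  have hequiv : ∀ p : Eu n × ℝ, ∃ A : (Eu n × ℝ) ≃L[ℝ] (Eu n × ℝ),
      HasFDerivAt Φ (A : Eu n × ℝ →L[ℝ] Eu n × ℝ) p := by
    intro p
    have hp := hder p
    set A := (((ContinuousLinearMap.fst ℝ (Eu n) ℝ) +
      ((θ p.2 • ((fderiv ℝ φ p.1).comp (ContinuousLinearMap.fst ℝ (Eu n) ℝ)) +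
        φ p.1 • ((fderiv ℝ θ p.2).comp (ContinuousLinearMap.snd ℝ (Eu n) ℝ))).smulRight v)).prod
      (ContinuousLinearMap.snd ℝ (Eu n) ℝ)) with hA
    -- A kernel vector has zero time component, and its space component h satisfies ‖h‖ ≤ ‖h‖/2.
    have hinj : Function.Injective (A : Eu n × ℝ →ₗ[ℝ] Eu n × ℝ) := by
      rw [injective_iff_map_eq_zero]
      rintro ⟨h, τ⟩ h0
      have h2 : τ = 0 := congrArg Prod.snd h0
      subst h2
      have h1 : h + (θ p.2 * fderiv ℝ φ p.1 h) • v = 0 := by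
        have := congrArg Prod.fst h0
        simpa [hA] using this
      have h3 : ‖h‖ ≤ 1 / 2 * ‖h‖ := by
        have e : h = -((θ p.2 * fderiv ℝ φ p.1 h) • v) := eq_neg_of_add_eq_zero_left h1
        have h4 : ‖h‖ = |θ p.2| * ‖fderiv ℝ φ p.1 h‖ * ‖v‖ := by
          conv_lhs => rw [e]
          rw [norm_neg, norm_smul, norm_mul, Real.norm_eq_abs (θ p.2)]
        have h5 : ‖fderiv ℝ φ p.1 h‖ ≤ L * ‖h‖ :=
          (ContinuousLinearMap.le_opNorm _ _).trans (by gcongr; exact hL _)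
        calc ‖h‖ = |θ p.2| * ‖fderiv ℝ φ p.1 h‖ * ‖v‖ := h4
          _ ≤ |θ p.2| * (L * ‖h‖) * ‖v‖ := by gcongr
          _ = |θ p.2| * (L * ‖v‖) * ‖h‖ := by ring
          _ ≤ 1 / 2 * ‖h‖ := by gcongr; exact hθL _
      have : h = 0 := by
        rw [← norm_eq_zero]; linarith [norm_nonneg h]
      rw [this]; rfl
    refine ⟨(LinearEquiv.ofInjectiveEndo (A : Eu n × ℝ →ₗ[ℝ] Eu n × ℝ) hinj).toContinuousLinearEquiv,
      ?_⟩
    exact hp.congr_fderiv (ContinuousLinearMap.ext fun q => rfl)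
  choose A hAd using hequiv
  have hopen : IsOpenMap Φ := isOpenMap_of_hasStrictFDerivAt_equiv (f' := A) fun p =>
    hΦs.contDiffAt.hasStrictFDerivAt' (hAd p) (by simp)
  refine ⟨(Equiv.ofBijective Φ hbij).toHomeomorphOfContinuousOpen hΦs.continuous hopen,
    fun x t => rfl, ?_⟩
  exact Homeomorph.contDiff_symm _ (f₀' := A) hAd (hΦs.of_le two_le_infty)

/-- For small times every field of displacements supported in `Ω` is realised by the flow of an
admissible time dependent vector field. -/
theorem exists_flow_displace {n : ℕ} {φ : Eu n → ℝ} {Ω : Set (Eu n)} {L : ℝ}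
    (hφ : ContDiff ℝ ∞ φ) (hL : ∀ x, ‖fderiv ℝ φ x‖ ≤ L) (hsupp : HasCompactSupport φ)
    (hΩ : tsupport φ ⊆ Ω) (v : Eu n) :
    ∃ (X : Eu n × ℝ → Eu n) (Ψ : ℝ → Eu n → Eu n), ContDiff ℝ 2 X ∧ HasCompactSupport X ∧
      tsupport X ⊆ Ω ×ˢ Ioo (-1 : ℝ) 1 ∧ IsIntegralFlow X Ψ ∧
      ∃ δ : ℝ, 0 < δ ∧ ∀ t ∈ Ioo (-δ) δ, Ψ t = displace φ v t := by
  have hL0 : 0 ≤ L := (norm_nonneg _).trans (hL 0)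
  have hLip := lipschitz_of_fderiv_bound hφ hL
  -- The summand 1 forces δ ≤ 1/2, so the time support stays inside (-1, 1) even when L‖v‖ is tiny.
  set δ : ℝ := 1 / (2 * (L * ‖v‖ + 1)) with hδ
  have hden : 0 < L * ‖v‖ + 1 := by positivity
  have hδ0 : 0 < δ := by positivity
  have hδ1 : δ < 1 := by
    rw [hδ, div_lt_one (by positivity)]
    nlinarith [mul_nonneg hL0 (norm_nonneg v)]
  have hδL : δ * (L * ‖v‖) ≤ 1 / 2 := by
    rw [hδ, div_mul_eq_mul_div, div_le_div_iff₀ (by positivity) (by norm_num)]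
    linarith
  let β : ContDiffBump (0 : ℝ) := ⟨δ / 2, δ, by positivity, by linarith⟩
  -- θ(t) = t near 0, but θ is cut off so that the field has compact support in time as well.
  set θ : ℝ → ℝ := fun t => t * β t with hθ
  have hθs : ContDiff ℝ ∞ θ := contDiff_id.mul β.contDiff
  have hθsupp : tsupport θ ⊆ closedBall 0 δ := by
    have : tsupport (fun t => t * β t) ⊆ tsupport β := tsupport_mul_subset_right
    exact this.trans β.tsupport_eq.subset
  have hθb : ∀ t, |θ t| ≤ δ := by
    intro t
    by_cases ht : |t| ≤ δ
    · rw [hθ, abs_mul]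
      have h1 : |β t| ≤ 1 := by rw [abs_of_nonneg β.nonneg]; exact β.le_one
      calc |t| * |β t| ≤ δ * 1 := by gcongr
        _ = δ := mul_one _
    · have : θ t = 0 := by
        apply image_eq_zero_of_notMem_tsupport
        intro h
        have := hθsupp h
        rw [mem_closedBall_zero_iff, Real.norm_eq_abs] at this
        exact ht this
      rw [this, abs_zero]; exact hδ0.le
  have hθL : ∀ t, |θ t| * (L * ‖v‖) ≤ 1 / 2 := fun t =>
    (mul_le_mul_of_nonneg_right (hθb t) (by positivity)).trans hδL
  obtain ⟨e, he, hes⟩ := exists_displace_homeomorph hφ hθs hL hθL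
  have hdθ : ContDiff ℝ ∞ (deriv θ) := by
    have := (contDiff_infty_iff_deriv (𝕜 := ℝ) (f := θ)).1 hθs
    exact this.2
  -- The velocity of the trajectory t ↦ x + θ(t)φ(x)v, written at its current position. Its
  -- regularity is that of the inverse of the space-time map `e`.
  set X : Eu n × ℝ → Eu n := fun p => (deriv θ p.2 * φ (e.symm p).1) • v with hX
  have hXsupp : Function.support X ⊆ tsupport φ ×ˢ closedBall (0 : ℝ) δ := by
    rintro ⟨y, t⟩ hyt
    rw [Function.mem_support] at hyt
    have h1 : deriv θ t ≠ 0 := fun h => hyt (by simp [hX, h])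
    have h2 : φ (e.symm (y, t)).1 ≠ 0 := fun h => hyt (by simp [hX, h])
    have h4 : e.symm (y, t) = ((e.symm (y, t)).1, t) := by
      have : (e.symm (y, t)).2 = t := by
        have h5 := he (e.symm (y, t)).1 (e.symm (y, t)).2
        rw [Prod.mk.eta, e.apply_symm_apply] at h5
        exact (congrArg Prod.snd h5).symm
      exact Prod.ext rfl this
    have h6 : displace φ v (θ t) (e.symm (y, t)).1 = y := by
      have h5 := he (e.symm (y, t)).1 t
      rw [← h4, e.apply_symm_apply] at h5
      exact (congrArg Prod.fst h5).symm
    refine ⟨?_, ?_⟩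
    · by_contra hy
      have hy0 : φ y = 0 := image_eq_zero_of_notMem_tsupport hy
      have h7 : displace φ v (θ t) y = y := by simp [displace, hy0]
      have h8 := (displace_bijective hLip (hθL t)).1 (h6.trans h7.symm)
      rw [h8] at h2
      exact h2 hy0
    · by_contra ht
      apply h1
      have : tsupport (deriv θ) ⊆ tsupport θ := closure_minimal (support_deriv_subset)
        (isClosed_tsupport θ)
      exact image_eq_zero_of_notMem_tsupport fun h => ht (hθsupp (this h))
  have hcomp : IsCompact (tsupport φ ×ˢ closedBall (0 : ℝ) δ) :=
    hsupp.isCompact.prod (isCompact_closedBall _ _)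
  refine ⟨X, fun t x => displace φ v (θ t) x, ?_, ?_, ?_, ?_, δ / 2, by positivity, ?_⟩
  · have h1 : ContDiff ℝ 2 fun p : Eu n × ℝ => deriv θ p.2 :=
      (hdθ.of_le two_le_infty).comp contDiff_snd
    have h2 : ContDiff ℝ 2 fun p : Eu n × ℝ => φ (e.symm p).1 :=
      (hφ.of_le two_le_infty).comp (contDiff_fst.comp hes)
    exact (h1.mul h2).smul contDiff_const
  · exact HasCompactSupport.of_support_subset_isCompact hcomp hXsupp
  · refine (closure_minimal hXsupp hcomp.isClosed).trans (prod_mono hΩ ?_)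
    intro t ht
    rw [mem_closedBall_zero_iff, Real.norm_eq_abs, abs_le] at ht
    exact ⟨by linarith, by linarith⟩
  · intro x
    refine ⟨by simp [displace, hθ], fun t _ => ?_⟩
    have h1 : HasDerivAt θ (deriv θ t) t :=
      ((hθs.differentiable (by simp)).differentiableAt).hasDerivAt
    have h2 : e.symm (displace φ v (θ t) x, t) = (x, t) := by
      rw [← he x t, e.symm_apply_apply]
    simp only [hX, h2]
    exact ((h1.mul_const (φ x)).smul_const v).const_add x
  · intro t ht
    have : β t = 1 := by
      apply β.one_of_mem_closedBall
      rw [mem_closedBall_zero_iff, Real.norm_eq_abs, abs_le]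
      exact ⟨ht.1.le, ht.2.le⟩
    funext x
    simp [hθ, this]

/-! ### The perimeter as a measure of pairs, and submodularity -/

/-- The pairs of points counted by the `K`-perimeter of `E` in `Ω`. -/
def pairMask {n : ℕ} (Ω E : Set (Eu n)) : Set (Eu n × Eu n) :=
  {p | p.1 ∈ E ∧ p.2 ∉ E ∧ (p.1 ∈ Ω ∨ p.2 ∈ Ω)}

/-- The measure with density `K(x - y)` on pairs of points. -/
noncomputable def pairMeasure {n : ℕ} (K : Eu n → ℝ) : Measure (Eu n × Eu n) :=
  (volume.prod volume).withDensity fun p => ENNReal.ofReal (K (p.1 - p.2))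

theorem measurableSet_pairMask {n : ℕ} {Ω E : Set (Eu n)} (hΩ : MeasurableSet Ω)
    (hE : MeasurableSet E) : MeasurableSet (pairMask Ω E) :=
  (measurable_fst hE).inter ((measurable_snd hE.compl).inter
    ((measurable_fst hΩ).union (measurable_snd hΩ)))

theorem measurable_pairDensity {n : ℕ} {K : Eu n → ℝ} (hK : Measurable K) :
    Measurable fun p : Eu n × Eu n => ENNReal.ofReal (K (p.1 - p.2)) :=
  (hK.comp (measurable_fst.sub measurable_snd)).ennreal_ofReal

theorem interaction_eq {n : ℕ} {K : Eu n → ℝ} (hK : Measurable K) {A B : Set (Eu n)}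
    (hA : MeasurableSet A) (hB : MeasurableSet B) :
    interaction K A B = pairMeasure K (A ×ˢ B) := by
  rw [pairMeasure, withDensity_apply _ (hA.prod hB), ← Measure.prod_restrict,
    lintegral_prod _ (measurable_pairDensity hK).aemeasurable]
  rfl

theorem perK_eq {n : ℕ} {K : Eu n → ℝ} (hK : Measurable K) {Ω E : Set (Eu n)}
    (hΩ : MeasurableSet Ω) (hE : MeasurableSet E) :
    perK K Ω E = pairMeasure K (pairMask Ω E) := by
  rw [perK, interaction_eq hK (hE.inter hΩ) (hE.compl.inter hΩ),
    interaction_eq hK (hE.inter hΩ) (hE.compl.diff hΩ),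
    interaction_eq hK (hE.diff hΩ) (hE.compl.inter hΩ), ← measure_union, ← measure_union]
  · congr 1
    ext ⟨x, y⟩
    simp only [pairMask, mem_union, mem_prod, mem_inter_iff, mem_compl_iff, Set.mem_sdiff, mem_ofPred_eq]
    tauto
  · rw [Set.disjoint_left]
    rintro ⟨x, y⟩ h h'
    simp only [mem_union, mem_prod, mem_inter_iff, mem_compl_iff, Set.mem_sdiff] at h h'
    tauto
  · exact (hE.diff hΩ).prod (hE.compl.inter hΩ)
  · rw [Set.disjoint_left]
    rintro ⟨x, y⟩ h h'
    simp only [mem_prod, mem_inter_iff, mem_compl_iff, Set.mem_sdiff] at h h'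
    tauto
  · exact (hE.inter hΩ).prod (hE.compl.diff hΩ)

/-- The inequality already holds between indicators of ordered pairs. A pair in (A \ E) × (E \ A) is
counted by A, but neither by the union nor by the intersection; this leftover is the term that
stability will make small. -/
theorem perK_submodular {n : ℕ} {K : Eu n → ℝ} (hK : Measurable K) {Ω A E : Set (Eu n)}
    (hΩ : MeasurableSet Ω) (hA : MeasurableSet A) (hE : MeasurableSet E) :
    perK K Ω (A ∪ E) + perK K Ω (A ∩ E) +
      pairMeasure K (((A \ E) ∩ Ω) ×ˢ ((E \ A) ∩ Ω)) ≤ perK K Ω A + perK K Ω E := by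
  rw [perK_eq hK hΩ (hA.union hE), perK_eq hK hΩ (hA.inter hE), perK_eq hK hΩ hA,
    perK_eq hK hΩ hE]
  have m1 := measurableSet_pairMask hΩ (hA.union hE)
  have m2 := measurableSet_pairMask hΩ (hA.inter hE)
  have m3 := measurableSet_pairMask hΩ hA
  have m4 := measurableSet_pairMask hΩ hE
  have m5 : MeasurableSet (((A \ E) ∩ Ω) ×ˢ ((E \ A) ∩ Ω)) :=
    ((hA.diff hE).inter hΩ).prod ((hE.diff hA).inter hΩ)
  rw [← lintegral_indicator_one m1, ← lintegral_indicator_one m2, ← lintegral_indicator_one m3,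
    ← lintegral_indicator_one m4, ← lintegral_indicator_one m5,
    ← lintegral_add_left (measurable_one.indicator m1),
    ← lintegral_add_right _ (measurable_one.indicator m5),
    ← lintegral_add_left (measurable_one.indicator m3)]
  refine lintegral_mono ?_
  rintro ⟨x, y⟩
  simp only [pairMask, mem_union, mem_inter_iff]
  by_cases h1 : x ∈ A <;> by_cases h2 : x ∈ E <;> by_cases h3 : y ∈ A <;> by_cases h4 : y ∈ E <;>
    by_cases h5 : x ∈ Ω <;> by_cases h6 : y ∈ Ω <;> simp [h1, h2, h3, h4, h5, h6]

theorem perK_congr {n : ℕ} {K : Eu n → ℝ} {Ω E F : Set (Eu n)}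
    (h : E =ᵐ[volume] F) : perK K Ω E = perK K Ω F := by
  have key : ∀ {A A' B B' : Set (Eu n)}, A =ᵐ[volume] A' → B =ᵐ[volume] B' →
      interaction K A B = interaction K A' B' := by
    intro A A' B B' hA hB
    unfold interaction
    rw [Measure.restrict_congr_set hA, Measure.restrict_congr_set hB]
  have hc : (Eᶜ : Set (Eu n)) =ᵐ[volume] (Fᶜ : Set (Eu n)) := h.compl
  have r : Ω =ᵐ[volume] Ω := ae_eq_refl _
  unfold perK
  rw [key (h.inter r) (hc.inter r), key (h.inter r) (hc.diff r), key (h.diff r) (hc.inter r)]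

/-! ### Change of variables under displacements -/

theorem hasFDerivAt_displace {n : ℕ} {φ : Eu n → ℝ} (hφ : ContDiff ℝ ∞ φ) (v : Eu n) (t : ℝ)
    (x : Eu n) : HasFDerivAt (displace φ v t)
      (ContinuousLinearMap.id ℝ (Eu n) + (t • fderiv ℝ φ x).smulRight v) x := by
  have h1 : HasFDerivAt φ (fderiv ℝ φ x) x :=
    ((hφ.differentiable (by simp)).differentiableAt).hasFDerivAt
  exact (hasFDerivAt_id x).add ((h1.const_mul t).smul_const v)

/-- All points move along the single direction v, so the derivative is a transvection and the
Jacobian is exactly affine in t. -/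
theorem det_displace {n : ℕ} (f : Eu n →L[ℝ] ℝ) (v : Eu n) (t : ℝ) :
    (ContinuousLinearMap.id ℝ (Eu n) + (t • f).smulRight v).det = 1 + t * f v := by
  have : ((ContinuousLinearMap.id ℝ (Eu n) + (t • f).smulRight v : Eu n →L[ℝ] Eu n) :
      Eu n →ₗ[ℝ] Eu n) = LinearMap.transvection ((t • f : Eu n →L[ℝ] ℝ) : Eu n →ₗ[ℝ] ℝ) v := by
    ext1 x; rfl
  rw [ContinuousLinearMap.det, this, LinearMap.transvection.det]
  simp

theorem lintegral_displace {n : ℕ} {φ : Eu n → ℝ} (hφ : ContDiff ℝ ∞ φ) (v : Eu n) (t : ℝ)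
    (hb : Function.Bijective (displace φ v t)) (f : Eu n → ℝ≥0∞) :
    ∫⁻ x, f x = ∫⁻ x, ENNReal.ofReal |1 + t * fderiv ℝ φ x v| * f (displace φ v t x) := by
  have := lintegral_image_eq_lintegral_abs_det_fderiv_mul volume (s := univ) MeasurableSet.univ
    (f := displace φ v t) (fun x _ => (hasFDerivAt_displace hφ v t x).hasFDerivWithinAt)
    (injOn_univ.2 hb.1) f
  rw [image_univ, hb.2.range_eq, Measure.restrict_univ] at this
  rw [this]
  simp_rw [det_displace]

theorem continuous_displace {n : ℕ} {φ : Eu n → ℝ} (hφ : ContDiff ℝ ∞ φ) (v : Eu n) (t : ℝ) :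
    Continuous (displace φ v t) :=
  continuous_id.add ((continuous_const.mul hφ.continuous).smul continuous_const)

theorem displace_mem_iff {n : ℕ} {φ : Eu n → ℝ} {v : Eu n} {t : ℝ} {Ω : Set (Eu n)}
    (hb : Function.Bijective (displace φ v t)) (hΩ : tsupport φ ⊆ Ω) (x : Eu n) :
    displace φ v t x ∈ Ω ↔ x ∈ Ω := by
  have hfix : ∀ y, y ∉ Ω → displace φ v t y = y := by
    intro y hy
    have : φ y = 0 := image_eq_zero_of_notMem_tsupport fun h => hy (hΩ h)
    simp [displace, this]
  constructor
  · intro h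
    by_contra hx
    rw [hfix x hx] at h
    exact hx h
  · intro h
    by_contra hx
    have h1 := hfix _ hx
    rw [hb.1 h1] at hx
    exact hx h

/-- Change of variables for the perimeter of a displaced set. -/
theorem perK_image_displace {n : ℕ} {K : Eu n → ℝ} (hK : Measurable K) {φ : Eu n → ℝ}
    (hφ : ContDiff ℝ ∞ φ) {v : Eu n} {t : ℝ} (hb : Function.Bijective (displace φ v t))
    {Ω E : Set (Eu n)} (hΩm : MeasurableSet Ω) (hE : MeasurableSet E) (hΩ : tsupport φ ⊆ Ω) :
    perK K Ω (displace φ v t '' E) =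
      ∫⁻ p in pairMask Ω E, ENNReal.ofReal (|1 + t * fderiv ℝ φ p.1 v| *
        |1 + t * fderiv ℝ φ p.2 v| * K (displace φ v t p.1 - displace φ v t p.2))
        ∂(volume.prod volume) := by
  have hcont := continuous_displace hφ v t
  have hF : MeasurableSet (displace φ v t '' E) :=
    hE.image_of_continuousOn_injOn hcont.continuousOn (injOn_of_injective hb.1)
  have hdφ : ∀ w : Eu n, Continuous fun x => fderiv ℝ φ x w := fun w =>
    (hφ.continuous_fderiv (by simp)).clm_apply continuous_const
  have hmF := measurableSet_pairMask hΩm hF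
  have hmE := measurableSet_pairMask hΩm hE
  rw [perK_eq hK hΩm hF, pairMeasure, withDensity_apply _ hmF, ← lintegral_indicator hmF,
    ← lintegral_indicator hmE, lintegral_prod _ ((measurable_pairDensity hK).indicator hmF).aemeasurable,
    lintegral_prod]
  · rw [lintegral_displace hφ v t hb]
    refine lintegral_congr fun x => ?_
    rw [lintegral_displace hφ v t hb, ← lintegral_const_mul']
    · refine lintegral_congr fun y => ?_
      have hiff : (displace φ v t x, displace φ v t y) ∈ pairMask Ω (displace φ v t '' E) ↔
          (x, y) ∈ pairMask Ω E := by
        simp only [pairMask, mem_ofPred_eq, displace_mem_iff hb hΩ, hb.1.mem_set_image]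
      by_cases h : (x, y) ∈ pairMask Ω E
      · rw [indicator_of_mem (hiff.2 h), indicator_of_mem h, mul_assoc,
          ENNReal.ofReal_mul (abs_nonneg _), ENNReal.ofReal_mul (abs_nonneg _)]
      · rw [indicator_of_notMem (fun h' => h (hiff.1 h')), indicator_of_notMem h]
        simp
    · exact ENNReal.ofReal_ne_top
  · refine (Measurable.indicator (Measurable.ennreal_ofReal ?_) hmE).aemeasurable
    refine Measurable.mul (Measurable.mul ?_ ?_) (hK.comp ?_)
    · exact ((continuous_const.add (continuous_const.mul ((hdφ v).comp continuous_fst))).abs).measurable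
    · exact ((continuous_const.add (continuous_const.mul ((hdφ v).comp continuous_snd))).abs).measurable
    · exact ((hcont.comp continuous_fst).sub (hcont.comp continuous_snd)).measurable

/-- Together with `perK_congr`, this lets the stability of a null measurable set be used on a
measurable representative: differentiable maps preserve null sets. -/
theorem image_displace_congr {n : ℕ} {φ : Eu n → ℝ} (hφ : ContDiff ℝ ∞ φ) {v : Eu n} {t : ℝ}
    (hb : Function.Bijective (displace φ v t)) {E F : Set (Eu n)} (h : E =ᵐ[volume] F) :
    displace φ v t '' E =ᵐ[volume] displace φ v t '' F := by
  have h0 : volume (symmDiff E F) = 0 := measure_symmDiff_eq_zero_iff.2 h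
  rw [← measure_symmDiff_eq_zero_iff, ← image_symmDiff hb.1]
  exact addHaar_image_eq_zero_of_differentiableOn_of_addHaar_eq_zero volume
    (fun x _ => (hasFDerivAt_displace hφ v t x).differentiableAt.differentiableWithinAt) h0

/-! ### Kernel estimates and the second variation -/

theorem KernelL2.measurable {n : ℕ} {s lam Lam : ℝ} {K : Eu n → ℝ} (hK : KernelL2 s lam Lam K) :
    Measurable K :=
  measurable_of_continuousOn_compl_singleton 0 hK.smooth.continuousOn

theorem KernelL2.pos {n : ℕ} {s lam Lam : ℝ} {K : Eu n → ℝ} (hK : KernelL2 s lam Lam K)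
    (hlam : 0 < lam) {z : Eu n} (hz : z ≠ 0) : 0 < K z :=
  lt_of_lt_of_le (div_pos hlam (Real.rpow_pos_of_pos (norm_pos_iff.2 hz) _)) (hK.lower z hz)

/-- Second symmetric difference bound from a bound on the second derivative. -/
theorem abs_symm_second_difference_le {f f' f'' : ℝ → ℝ} {c M₁ M₂ : ℝ} (hc : 0 ≤ c)
    (hf : ∀ τ ∈ Icc (-c) c, HasDerivAt f (f' τ) τ)
    (hf' : ∀ τ ∈ Icc (-c) c, HasDerivAt f' (f'' τ) τ)
    (h1 : ∀ τ ∈ Icc (-c) c, |f' τ| ≤ M₁) (h2 : ∀ τ ∈ Icc (-c) c, |f'' τ| ≤ M₂) :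
    |f c - f (-c)| ≤ 2 * c * M₁ ∧ |f c + f (-c) - 2 * f 0| ≤ 2 * c ^ 2 * M₂ := by
  have hcc : -c ≤ c := by linarith
  have hconv : Convex ℝ (Icc (-c) c) := convex_Icc _ _
  constructor
  · have := hconv.norm_image_sub_le_of_norm_hasDerivWithin_le
      (fun τ hτ => (hf τ hτ).hasDerivWithinAt) h1 (left_mem_Icc.2 hcc) (right_mem_Icc.2 hcc)
    rw [Real.norm_eq_abs, Real.norm_eq_abs, abs_of_nonneg (by linarith : (0:ℝ) ≤ c - -c)] at this
    linarith
  · have hneg : ∀ τ ∈ Icc 0 c, -τ ∈ Icc (-c) c := fun τ hτ => ⟨by linarith [hτ.2], by linarith [hτ.1]⟩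
    have hpos : ∀ τ ∈ Icc 0 c, τ ∈ Icc (-c) c := fun τ hτ => ⟨by linarith [hτ.1], hτ.2⟩
    have hd : ∀ τ ∈ Icc 0 c, HasDerivWithinAt (fun τ => f τ + f (-τ)) (f' τ - f' (-τ)) (Icc 0 c) τ := by
      intro τ hτ
      have a := (hf _ (hneg τ hτ)).scomp τ (hasDerivAt_neg τ)
      have b := (hf τ (hpos τ hτ)).add a
      refine (b.congr_deriv ?_).hasDerivWithinAt
      simp [sub_eq_add_neg]
    have hb : ∀ τ ∈ Icc 0 c, ‖f' τ - f' (-τ)‖ ≤ 2 * c * M₂ := by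
      intro τ hτ
      have := hconv.norm_image_sub_le_of_norm_hasDerivWithin_le
        (fun τ hτ => (hf' τ hτ).hasDerivWithinAt) h2 (hneg τ hτ) (hpos τ hτ)
      refine this.trans ?_
      have hM : 0 ≤ M₂ := (abs_nonneg _).trans (h2 τ (hpos τ hτ))
      rw [Real.norm_eq_abs, abs_of_nonneg (by linarith [hτ.1] : (0:ℝ) ≤ τ - -τ)]
      nlinarith [hτ.2]
    have := (convex_Icc 0 c).norm_image_sub_le_of_norm_hasDerivWithin_le hd hb
      (left_mem_Icc.2 hc) (right_mem_Icc.2 hc)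
    rw [Real.norm_eq_abs, Real.norm_eq_abs, sub_zero, abs_of_nonneg hc, neg_zero] at this
    have e : f c + f (-c) - 2 * f 0 = f c + f (-c) - (f 0 + f 0) := by ring
    rw [e]
    linarith

/-- The constant in the second variation inequality. -/
noncomputable def variationConst (n : ℕ) (s lam Lam : ℝ) : ℝ :=
  7 * (2 ^ ((n : ℝ) + s + 2) * Lam / lam) + 2

/-- On expanding, the terms linear in a and b multiply Kp - Km, so everything beyond 2Kz is of order
T². The three corrections are at most 2T²N, T²(2Kz + N) and 4T²N; their sum T²(2Kz + 7N) is the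
origin of `variationConst`. -/
theorem weighted_second_difference_algebra {Kp Km Kz N A T a b : ℝ} (hKz : 0 < Kz) (hN0 : 0 < N)
    (hT : T ≤ 1 / 2) (ha : |a| ≤ T) (hb : |b| ≤ T) (g1 : |Kp - Km| ≤ 2 * T * N)
    (g2 : |Kp + Km - 2 * Kz| ≤ 2 * T ^ 2 * N) (hNK : N ≤ A * Kz) :
    (1 + a) * (1 + b) * Kp + (1 - a) * (1 - b) * Km ≤ (2 + (7 * A + 2) * T ^ 2) * Kz := by
  have hT0 : 0 ≤ T := (abs_nonneg a).trans ha
  have hab : |a * b| ≤ T ^ 2 := by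
    rw [abs_mul, sq]; exact mul_le_mul ha hb (abs_nonneg _) hT0
  have hT2 : T ^ 2 ≤ 1 / 4 := by nlinarith
  have hsum : |Kp + Km| ≤ 2 * Kz + N := by
    have h1 := abs_add_le (Kp + Km - 2 * Kz) (2 * Kz)
    rw [sub_add_cancel, abs_of_pos (by positivity : 0 < 2 * Kz)] at h1
    nlinarith
  have t1 : a * b * (Kp + Km) ≤ T ^ 2 * (2 * Kz + N) := by
    refine (le_abs_self _).trans ?_
    rw [abs_mul]
    exact mul_le_mul hab hsum (abs_nonneg _) (by positivity)
  have t2 : (a + b) * (Kp - Km) ≤ (2 * T) * (2 * T * N) := by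
    refine (le_abs_self _).trans ?_
    rw [abs_mul]
    refine mul_le_mul ?_ g1 (abs_nonneg _) (by positivity)
    exact (abs_add_le a b).trans (by linarith)
  have t3 := (le_abs_self _).trans g2
  have e : (1 + a) * (1 + b) * Kp + (1 - a) * (1 - b) * Km =
      2 * Kz + (Kp + Km - 2 * Kz) + a * b * (Kp + Km) + (a + b) * (Kp - Km) := by ring
  rw [e]
  have := mul_le_mul_of_nonneg_left hNK (sq_nonneg T)
  nlinarith

theorem KernelL2.Lam_pos {n : ℕ} {s lam Lam : ℝ} {K : Eu n → ℝ} (hK : KernelL2 s lam Lam K)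
    (hlam : 0 < lam) {z : Eu n} (hz : z ≠ 0) : 0 < Lam := by
  have h1 := (hK.lower z hz).trans (hK.upper z hz)
  have h2 := (div_le_div_iff_of_pos_right (Real.rpow_pos_of_pos (norm_pos_iff.2 hz) _)).1 h1
  linarith

/-- Passing from w to z costs 2^(n+s) in the kernel bound and at most a further factor 4 in the
powers of ‖w‖ that weigh the derivatives. -/
theorem KernelL2.fderiv_bounds {n : ℕ} {s lam Lam : ℝ} {K : Eu n → ℝ}
    (hK : KernelL2 s lam Lam K) (hs : 0 < s) (hLam : 0 < Lam) {z v w : Eu n} (hz0 : 0 < ‖z‖)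
    (hv : ‖v‖ = 1) (hw : ‖z‖ / 2 ≤ ‖w‖) :
    |fderiv ℝ K w v| ≤ 2 ^ ((n : ℝ) + s + 2) * (Lam / ‖z‖ ^ ((n : ℝ) + s)) / ‖z‖ ∧
      |fderiv ℝ (fun w => fderiv ℝ K w v) w v| ≤
        2 ^ ((n : ℝ) + s + 2) * (Lam / ‖z‖ ^ ((n : ℝ) + s)) / ‖z‖ ^ 2 := by
  set p : ℝ := (n : ℝ) + s with hp
  have hp0 : 0 ≤ p := by positivity
  have hw0 : 0 < ‖w‖ := by linarith
  have hwne : w ≠ 0 := norm_pos_iff.1 hw0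
  have hB := hK.deriv_bound w hwne v hv
  have hzp : 0 < ‖z‖ ^ p := Real.rpow_pos_of_pos hz0 _
  have hwp : Lam / ‖w‖ ^ p ≤ 2 ^ p * (Lam / ‖z‖ ^ p) := by
    have h1 : (‖z‖ / 2) ^ p ≤ ‖w‖ ^ p := Real.rpow_le_rpow (by positivity) hw hp0
    rw [Real.div_rpow hz0.le (by norm_num)] at h1
    calc Lam / ‖w‖ ^ p ≤ Lam / (‖z‖ ^ p / 2 ^ p) :=
          div_le_div_of_nonneg_left hLam.le (by positivity) h1
      _ = _ := by field_simp
  have hN4 : (2 : ℝ) ^ (p + 2) * (Lam / ‖z‖ ^ p) = 4 * (2 ^ p * (Lam / ‖z‖ ^ p)) := by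
    rw [Real.rpow_add (by norm_num)]; norm_num; ring
  rw [hN4]
  have hB1 := ((le_max_left _ _).trans hB).trans hwp
  have hB2 := ((le_max_right _ _).trans hB).trans hwp
  have hQ0 : 0 < 2 ^ p * (Lam / ‖z‖ ^ p) := by positivity
  generalize 2 ^ p * (Lam / ‖z‖ ^ p) = Q at *
  generalize |fderiv ℝ (fun w => fderiv ℝ K w v) w v| = D at *
  have hD := abs_nonneg (fderiv ℝ K w v)
  generalize |fderiv ℝ K w v| = D' at *
  constructor
  · rw [le_div_iff₀ hz0]
    nlinarith
  · rw [le_div_iff₀ (by positivity)]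
    have h4 : ‖z‖ ^ 2 ≤ 4 * ‖w‖ ^ 2 := by nlinarith
    by_cases hDD : 0 ≤ D
    · nlinarith
    · nlinarith [sq_nonneg ‖z‖]

/-- Used with z = x - y, T = |t|L, a and b the values of t∂_vφ at x and y, and d = t(φ(x) - φ(y)).
Since T ≤ 1/2, the segment from z - dv to z + dv stays at distance at least ‖z‖/2 from the
singularity. The error is relative to K(z), so it integrates to a multiple of the perimeter itself.
-/
theorem KernelL2.weighted_second_difference {n : ℕ} {s lam Lam : ℝ} {K : Eu n → ℝ}
    (hK : KernelL2 s lam Lam K) (hs : 0 < s) (hlam : 0 < lam) {z v : Eu n} (hz : z ≠ 0)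
    (hv : ‖v‖ = 1) {T d a b : ℝ} (hT : T ≤ 1 / 2) (hd : |d| ≤ T * ‖z‖) (ha : |a| ≤ T)
    (hb : |b| ≤ T) :
    (1 + a) * (1 + b) * K (z + d • v) + (1 - a) * (1 - b) * K (z - d • v) ≤
      (2 + variationConst n s lam Lam * T ^ 2) * K z := by
  have hz0 : 0 < ‖z‖ := norm_pos_iff.2 hz
  have hT0 : 0 ≤ T := (abs_nonneg a).trans ha
  have hLam : 0 < Lam := hK.Lam_pos hlam hz
  have hKz : lam / ‖z‖ ^ ((n : ℝ) + s) ≤ K z := hK.lower z hz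
  have hKp : 0 < K z := hK.pos hlam hz
  have hd2 : |d| ≤ ‖z‖ / 2 := hd.trans (by nlinarith)
  have hpt : ∀ τ ∈ Icc (-|d|) |d|, ‖z‖ / 2 ≤ ‖z + τ • v‖ := by
    intro τ hτ
    have h1 : |τ| ≤ |d| := abs_le.2 hτ
    have h2 : ‖z‖ - ‖τ • v‖ ≤ ‖z + τ • v‖ := by
      have := norm_sub_norm_le z (-(τ • v))
      rwa [norm_neg, sub_neg_eq_add] at this
    rw [norm_smul, hv, mul_one, Real.norm_eq_abs] at h2
    linarith
  have hne : ∀ τ ∈ Icc (-|d|) |d|, z + τ • v ≠ 0 := by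
    intro τ hτ h
    have := hpt τ hτ
    rw [h, norm_zero] at this
    linarith
  have hline : ∀ τ : ℝ, HasDerivAt (fun τ : ℝ => z + τ • v) v τ := fun τ => by
    simpa using ((hasDerivAt_id τ).smul_const v).const_add z
  have hnhd : ∀ w : Eu n, w ≠ 0 → ({0}ᶜ : Set (Eu n)) ∈ 𝓝 w := fun w hw =>
    isOpen_compl_singleton.mem_nhds hw
  have hder1 : ∀ τ ∈ Icc (-|d|) |d|, HasDerivAt (fun τ => K (z + τ • v))
      (fderiv ℝ K (z + τ • v) v) τ := by
    intro τ hτ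
    have h1 := ((hK.smooth.contDiffAt (hnhd _ (hne τ hτ))).differentiableAt (by norm_num)).hasFDerivAt
    exact h1.comp_hasDerivAt τ (hline τ)
  have hder2 : ∀ τ ∈ Icc (-|d|) |d|, HasDerivAt (fun τ => fderiv ℝ K (z + τ • v) v)
      (fderiv ℝ (fun w => fderiv ℝ K w v) (z + τ • v) v) τ := by
    intro τ hτ
    have h0 : ContDiffAt ℝ 1 (fderiv ℝ K) (z + τ • v) :=
      (hK.smooth.contDiffAt (hnhd _ (hne τ hτ))).fderiv_right (by norm_num)
    have h1 : DifferentiableAt ℝ (fun w => fderiv ℝ K w v) (z + τ • v) :=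
      (h0.differentiableAt (by norm_num)).clm_apply (differentiableAt_const v)
    exact h1.hasFDerivAt.comp_hasDerivAt (f := fun τ : ℝ => z + τ • v) τ (hline τ)
  obtain ⟨g1, g2⟩ := abs_symm_second_difference_le (abs_nonneg d) hder1 hder2
    (fun τ hτ => (hK.fderiv_bounds hs hLam hz0 hv (hpt τ hτ)).1)
    (fun τ hτ => (hK.fderiv_bounds hs hLam hz0 hv (hpt τ hτ)).2)
  simp only [zero_smul, add_zero, neg_smul, ← sub_eq_add_neg, sq_abs] at g1 g2
  have hzp : 0 < ‖z‖ ^ ((n : ℝ) + s) := Real.rpow_pos_of_pos hz0 _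
  have hN0 : 0 < (2 : ℝ) ^ ((n : ℝ) + s + 2) * (Lam / ‖z‖ ^ ((n : ℝ) + s)) := by positivity
  have hNK : (2 : ℝ) ^ ((n : ℝ) + s + 2) * (Lam / ‖z‖ ^ ((n : ℝ) + s)) ≤
      2 ^ ((n : ℝ) + s + 2) * Lam / lam * K z := by
    calc (2 : ℝ) ^ ((n : ℝ) + s + 2) * (Lam / ‖z‖ ^ ((n : ℝ) + s))
        = 2 ^ ((n : ℝ) + s + 2) * Lam / lam * (lam / ‖z‖ ^ ((n : ℝ) + s)) := by field_simp
      _ ≤ _ := by gcongr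
  generalize (2 : ℝ) ^ ((n : ℝ) + s + 2) * (Lam / ‖z‖ ^ ((n : ℝ) + s)) = N at *
  refine weighted_second_difference_algebra hKp hN0 hT ha hb ?_ ?_ hNK
  · have e : |K (z + d • v) - K (z - d • v)| = |K (z + |d| • v) - K (z - |d| • v)| := by
      rcases abs_cases d with ⟨h, _⟩ | ⟨h, _⟩ <;> rw [h]
      rw [neg_smul, sub_neg_eq_add, ← sub_eq_add_neg, abs_sub_comm]
    rw [e]
    refine g1.trans ?_
    rw [mul_div_assoc', div_le_iff₀ hz0]
    nlinarith
  · have e : |K (z + d • v) + K (z - d • v) - 2 * K z| =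
        |K (z + |d| • v) + K (z - |d| • v) - 2 * K z| := by
      rcases abs_cases d with ⟨h, _⟩ | ⟨h, _⟩ <;> rw [h]
      rw [neg_smul, sub_neg_eq_add, ← sub_eq_add_neg, add_comm (K _)]
    rw [e]
    refine g2.trans ?_
    rw [mul_div_assoc', div_le_iff₀ (by positivity)]
    have hdd : d ^ 2 ≤ (T * ‖z‖) ^ 2 := by
      rw [← sq_abs]; exact pow_le_pow_left₀ (abs_nonneg _) hd 2
    nlinarith

/-- Points of `B_r` that enter `E` under the translation by `w`. -/
def inSet {n : ℕ} (E : Set (Eu n)) (w : Eu n) (r : ℝ) : Set (Eu n) :=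
  {x | x ∈ ball 0 r ∧ x ∉ E ∧ x + w ∈ E}

/-- Points of `B_r` that leave `E` under the translation by `w`. -/
def outSet {n : ℕ} (E : Set (Eu n)) (w : Eu n) (r : ℝ) : Set (Eu n) :=
  {x | x ∈ ball 0 r ∧ x ∈ E ∧ x + w ∉ E}

theorem measurableSet_inSet {n : ℕ} {E : Set (Eu n)} (hE : MeasurableSet E) (w : Eu n) (r : ℝ) :
    MeasurableSet (inSet E w r) :=
  measurableSet_ball.inter (hE.compl.inter ((measurable_id.add_const w) hE))

theorem measurableSet_outSet {n : ℕ} {E : Set (Eu n)} (hE : MeasurableSet E) (w : Eu n) (r : ℝ) :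
    MeasurableSet (outSet E w r) :=
  measurableSet_ball.inter (hE.inter ((measurable_id.add_const w) hE.compl))

theorem variationConst_nonneg {n : ℕ} {s lam Lam : ℝ} (hlam : 0 < lam) (hLam : 0 < Lam) :
    0 ≤ variationConst n s lam Lam := by
  unfold variationConst; positivity

/-- A pair with no point in B_ρ is not moved and contributes exactly twice its density. The error is
thus confined to the pairs counted by the perimeter in the smaller ball B_ρ. -/
theorem second_variation_integrand_le {n : ℕ} {s lam Lam : ℝ} {K : Eu n → ℝ}
    (hK : KernelL2 s lam Lam K) (hs : 0 < s) (hlam : 0 < lam) {φ : Eu n → ℝ} {L ρ R : ℝ}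
    (hφ : ContDiff ℝ ∞ φ) (hL : ∀ x, ‖fderiv ℝ φ x‖ ≤ L) (hsupp : tsupport φ ⊆ ball 0 ρ)
    {v : Eu n} (hv : ‖v‖ = 1) {t : ℝ} (ht : |t| * L ≤ 1 / 2) {E : Set (Eu n)}
    {p : Eu n × Eu n} (hp : p ∈ pairMask (ball 0 R) E) :
    ENNReal.ofReal (|1 + t * fderiv ℝ φ p.1 v| * |1 + t * fderiv ℝ φ p.2 v| *
        K (displace φ v t p.1 - displace φ v t p.2)) +
      ENNReal.ofReal (|1 + -t * fderiv ℝ φ p.1 v| * |1 + -t * fderiv ℝ φ p.2 v| *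
        K (displace φ v (-t) p.1 - displace φ v (-t) p.2)) ≤
      2 * ENNReal.ofReal (K (p.1 - p.2)) + (pairMask (ball 0 ρ) E).indicator (fun p =>
        ENNReal.ofReal (variationConst n s lam Lam * (|t| * L) ^ 2) *
          ENNReal.ofReal (K (p.1 - p.2))) p := by
  obtain ⟨x, y⟩ := p
  obtain ⟨h1, h2, h3⟩ := hp
  simp only at h1 h2 h3 ⊢
  have hxy : x ≠ y := fun h => h2 (h ▸ h1)
  have hz : x - y ≠ 0 := sub_ne_zero.2 hxy
  have hL0 : 0 ≤ L := (norm_nonneg _).trans (hL 0)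
  have hdb : ∀ x, |t * fderiv ℝ φ x v| ≤ |t| * L := by
    intro x
    rw [abs_mul]
    gcongr
    have := (fderiv ℝ φ x).le_opNorm v
    rw [hv, mul_one] at this
    exact this.trans (hL x)
  have hdisp : ∀ t : ℝ, displace φ v t x - displace φ v t y = (x - y) + (t * (φ x - φ y)) • v := by
    intro t
    simp only [displace]
    rw [mul_sub, sub_smul]; abel
  by_cases hm : (x, y) ∈ pairMask (ball 0 ρ) E
  · rw [indicator_of_mem hm, hdisp, hdisp]
    have habs : ∀ x, |1 + t * fderiv ℝ φ x v| = 1 + t * fderiv ℝ φ x v := fun x =>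
      abs_of_nonneg (by have := abs_le.1 ((hdb x).trans ht); linarith [this.1])
    have habs' : ∀ x, |1 + -t * fderiv ℝ φ x v| = 1 - t * fderiv ℝ φ x v := fun x => by
      rw [abs_of_nonneg]
      · ring
      · have := abs_le.1 ((hdb x).trans ht); linarith [this.2]
    rw [habs, habs, habs', habs']
    have hd : |t * (φ x - φ y)| ≤ (|t| * L) * ‖x - y‖ := by
      rw [abs_mul, mul_assoc]
      gcongr
      exact lipschitz_of_fderiv_bound hφ hL x y
    have main := hK.weighted_second_difference hs hlam hz hv ht hd (hdb x) (hdb y)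
    have e : (x - y) + (-t * (φ x - φ y)) • v = (x - y) - (t * (φ x - φ y)) • v := by
      rw [neg_mul, neg_smul, sub_eq_add_neg (x - y) ((t * (φ x - φ y)) • v)]
    rw [e]
    have hKnn : ∀ w : Eu n, w ≠ 0 → 0 ≤ K w := fun w hw => (hK.pos hlam hw).le
    have hbig : ∀ τ : ℝ, |τ| ≤ (|t| * L) * ‖x - y‖ → (x - y) + τ • v ≠ 0 := by
      intro τ hτ h0
      have : ‖x - y‖ = |τ| := by
        rw [eq_neg_of_add_eq_zero_left h0, norm_neg, norm_smul, hv, mul_one, Real.norm_eq_abs]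
      have hpos := norm_pos_iff.2 hz
      nlinarith
    have hw1 : 0 ≤ K ((x - y) + (t * (φ x - φ y)) • v) := hKnn _ (hbig _ hd)
    have hw2 : 0 ≤ K ((x - y) - (t * (φ x - φ y)) • v) := by
      rw [sub_eq_add_neg, ← neg_smul]
      exact hKnn _ (hbig _ (by rwa [abs_neg]))
    have b1 := abs_le.1 ((hdb x).trans ht)
    have b2 := abs_le.1 ((hdb y).trans ht)
    rw [← ENNReal.ofReal_add]
    · have hc : 0 ≤ variationConst n s lam Lam * (|t| * L) ^ 2 :=
        mul_nonneg (variationConst_nonneg hlam (hK.Lam_pos hlam hz)) (sq_nonneg _)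
      have htwo : 2 * ENNReal.ofReal (K (x - y)) = ENNReal.ofReal (2 * K (x - y)) := by
        rw [ENNReal.ofReal_mul (by norm_num)]; simp
      rw [← ENNReal.ofReal_mul hc, htwo, ← ENNReal.ofReal_add]
      · apply ENNReal.ofReal_le_ofReal
        rw [← add_mul]
        exact main
      · exact mul_nonneg (by norm_num) (hKnn _ hz)
      · exact mul_nonneg hc (hKnn _ hz)
    · exact mul_nonneg (mul_nonneg (by linarith [b1.1]) (by linarith [b2.1])) hw1
    · exact mul_nonneg (mul_nonneg (by linarith [b1.2]) (by linarith [b2.2])) hw2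
  · rw [indicator_of_notMem hm, add_zero]
    have hx : x ∉ ball (0 : Eu n) ρ := fun h => hm ⟨h1, h2, Or.inl h⟩
    have hy : y ∉ ball (0 : Eu n) ρ := fun h => hm ⟨h1, h2, Or.inr h⟩
    have hzero : ∀ x ∉ ball (0 : Eu n) ρ, φ x = 0 ∧ fderiv ℝ φ x = 0 := by
      intro x hx
      have hx' : x ∉ tsupport φ := fun h => hx (hsupp h)
      exact ⟨image_eq_zero_of_notMem_tsupport hx',
        image_eq_zero_of_notMem_tsupport fun h => hx' (tsupport_fderiv_subset ℝ h)⟩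
    simp only [displace, (hzero x hx).1, (hzero x hx).2, (hzero y hy).1, (hzero y hy).2]
    simp [two_mul]

/-- Second variation of the perimeter along displacements supported in `B_ρ`. -/
theorem second_variation_le {n : ℕ} {s lam Lam : ℝ} {K : Eu n → ℝ}
    (hK : KernelL2 s lam Lam K) (hs : 0 < s) (hlam : 0 < lam) {φ : Eu n → ℝ} {L ρ R : ℝ}
    (hφ : ContDiff ℝ ∞ φ) (hL : ∀ x, ‖fderiv ℝ φ x‖ ≤ L) (hsupp : tsupport φ ⊆ ball 0 ρ)
    (hρ : ρ ≤ R) {v : Eu n} (hv : ‖v‖ = 1) {t : ℝ} (ht : |t| * L ≤ 1 / 2) {E : Set (Eu n)}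
    (hE : MeasurableSet E) :
    perK K (ball 0 R) (displace φ v t '' E) + perK K (ball 0 R) (displace φ v (-t) '' E) ≤
      2 * perK K (ball 0 R) E +
        ENNReal.ofReal (variationConst n s lam Lam * (|t| * L) ^ 2) * perK K (ball 0 ρ) E := by
  have hLip := lipschitz_of_fderiv_bound hφ hL
  have hb : ∀ t : ℝ, |t| * L ≤ 1 / 2 → Function.Bijective (displace φ v t) := fun t ht =>
    displace_bijective hLip (by rwa [hv, mul_one])
  have ht' : |-t| * L ≤ 1 / 2 := by rwa [abs_neg]
  have hR : tsupport φ ⊆ ball 0 R := hsupp.trans (ball_subset_ball hρ)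
  have hKm := hK.measurable
  have mR := measurableSet_pairMask (measurableSet_ball (x := (0 : Eu n)) (ε := R)) hE
  have mρ := measurableSet_pairMask (measurableSet_ball (x := (0 : Eu n)) (ε := ρ)) hE
  rw [perK_image_displace hKm hφ (hb t ht) measurableSet_ball hE hR,
    perK_image_displace hKm hφ (hb (-t) ht') measurableSet_ball hE hR, ← lintegral_add_left,
    perK_eq hKm measurableSet_ball hE, perK_eq hKm measurableSet_ball hE, pairMeasure,
    withDensity_apply _ mR, withDensity_apply _ mρ]
  · refine (setLIntegral_mono' mR fun p hp =>
      second_variation_integrand_le hK hs hlam hφ hL hsupp hv ht hp).trans ?_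
    rw [lintegral_add_left ((measurable_pairDensity hKm).const_mul _),
      lintegral_const_mul _ (measurable_pairDensity hKm)]
    gcongr
    refine (setLIntegral_le_lintegral _ _).trans ?_
    rw [lintegral_indicator mρ, lintegral_const_mul _ (measurable_pairDensity hKm)]
  · have hdφ : Continuous fun x => fderiv ℝ φ x v :=
      (hφ.continuous_fderiv (by simp)).clm_apply continuous_const
    have hcont := continuous_displace hφ v t
    refine Measurable.ennreal_ofReal (Measurable.mul (Measurable.mul ?_ ?_) (hKm.comp ?_))
    · exact ((continuous_const.add (continuous_const.mul (hdφ.comp continuous_fst))).abs).measurable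
    · exact ((continuous_const.add (continuous_const.mul (hdφ.comp continuous_snd))).abs).measurable
    · exact ((hcont.comp continuous_fst).sub (hcont.comp continuous_snd)).measurable

/-! ### What stability gives: the product of entering and leaving volumes -/

theorem pairMeasure_prod_ge {n : ℕ} {s lam Lam : ℝ} {K : Eu n → ℝ}
    (hK : KernelL2 s lam Lam K) (hs : 0 < s) (hlam : 0 < lam) {r : ℝ}
    {A B : Set (Eu n)} (hA : MeasurableSet A) (hB : MeasurableSet B) (hAr : A ⊆ ball 0 r)
    (hBr : B ⊆ ball 0 r) (hAB : Disjoint A B) :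
    ENNReal.ofReal (lam / (2 * r) ^ ((n : ℝ) + s)) * (volume A * volume B) ≤
      pairMeasure K (A ×ˢ B) := by
  rw [pairMeasure, withDensity_apply _ (hA.prod hB), ← Measure.prod_prod, ← setLIntegral_const]
  refine setLIntegral_mono' (hA.prod hB) ?_
  rintro ⟨x, y⟩ ⟨hx, hy⟩
  apply ENNReal.ofReal_le_ofReal
  have hxy : x - y ≠ 0 := sub_ne_zero.2 fun h => Set.disjoint_left.1 hAB hx (h ▸ hy)
  refine le_trans ?_ (hK.lower _ hxy)
  have h0 := norm_pos_iff.2 hxy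
  apply div_le_div_of_nonneg_left hlam.le (Real.rpow_pos_of_pos h0 _)
  apply Real.rpow_le_rpow h0.le _ (by positivity)
  have h1 := mem_ball_zero_iff.1 (hAr hx)
  have h2 := mem_ball_zero_iff.1 (hBr hy)
  linarith [norm_sub_le x y]

/-- The main consequence of stability: almost no simultaneous entering and leaving under small
translations. -/
theorem stable_in_mul_out_le (n : ℕ) : ∃ C : ℝ, 0 < C ∧ ∀ {s lam Lam : ℝ} {K : Eu n → ℝ}
    {E E' : Set (Eu n)} {r ρ R ε : ℝ} {v : Eu n}, KernelL2 s lam Lam K → 0 < s → 0 < lam →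
    MeasurableSet E → E =ᵐ[volume] E' → IsStableSet K (ball 0 R) E' → 0 < r → r < ρ → ρ ≤ R →
    ‖v‖ = 1 → 0 < ε → ∀ᶠ t in 𝓝[>] (0 : ℝ),
      ENNReal.ofReal (lam / (2 * r) ^ ((n : ℝ) + s)) *
        (volume (inSet E (t • v) r) * volume (outSet E (t • v) r)) ≤
      ENNReal.ofReal (variationConst n s lam Lam * (C * t / (ρ - r)) ^ 2) * perK K (ball 0 ρ) E +
        ENNReal.ofReal (ε * t ^ 2) := by
  obtain ⟨C, hC, hcut⟩ := exists_cutoff n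
  refine ⟨2 * C, by positivity, ?_⟩
  intro s lam Lam K E E' r ρ R ε v hK hs hlam hE hEE' hst hr hρ hρR hv hε
  -- The cutoff equals 1 on the slightly larger ball B_{r1}, so that for small t the displacement is
  -- an exact translation on all points landing in B_r. Halving the transition layer is why the
  -- constant is 2C.
  set r1 := (r + ρ) / 2 with hr1
  have hrr1 : r < r1 := by rw [hr1]; linarith
  obtain ⟨φ, hφ, hφc, hφs, -, hφ1, hφL⟩ := hcut r1 ρ (by linarith) (by rw [hr1]; linarith)
  set L := C / (ρ - r1) with hLdef
  have hL0 : 0 < L := div_pos hC (by rw [hr1]; linarith)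
  have hLeq : ∀ t : ℝ, t * L = 2 * C * t / (ρ - r) := by
    intro t
    have h1 : ρ - r1 = (ρ - r) / 2 := by rw [hr1]; ring
    have : ρ - r ≠ 0 := by linarith
    rw [hLdef, h1]; field_simp
  have hR : tsupport φ ⊆ ball 0 R := hφs.trans (ball_subset_ball hρR)
  obtain ⟨X, Ψ, hX2, hXc, hXs, hflow, δ, hδ, hΨ⟩ := exists_flow_displace hφ hφL hφc hR v
  -- Stability is used four times: for union and intersection, at times t and -t.
  obtain ⟨t₀, ht₀, hstab⟩ := hst.2 X hX2 hXc hXs Ψ hflow (ε / 4) (by positivity)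
  have hLip := lipschitz_of_fderiv_bound hφ hφL
  have hP : perK K (ball 0 R) E ≠ ⊤ := by rw [perK_congr hEE']; exact hst.1.ne
  have hsmall : 0 < min (min δ t₀) (min (r1 - r) (1 / (2 * L))) := by
    refine lt_min (lt_min hδ ht₀) (lt_min (by linarith) (by positivity))
  filter_upwards [Ioo_mem_nhdsGT hsmall] with t ht
  obtain ⟨ht0, ht1⟩ := ht
  rw [lt_min_iff, lt_min_iff, lt_min_iff] at ht1
  obtain ⟨⟨h1, h2⟩, h3, h4⟩ := ht1
  have hKm := hK.measurable
  have htL : |t| * L ≤ 1 / 2 := by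
    rw [abs_of_pos ht0]
    rw [lt_div_iff₀ (by positivity)] at h4
    linarith
  have hb : ∀ τ : ℝ, |τ| * L ≤ 1 / 2 → Function.Bijective (displace φ v τ) := fun t ht =>
    displace_bijective hLip (by rwa [hv, mul_one])
  have htL' : |-t| * L ≤ 1 / 2 := by rwa [abs_neg]
  have mF : ∀ τ : ℝ, |τ| * L ≤ 1 / 2 → MeasurableSet (displace φ v τ '' E) := fun τ hτ =>
    hE.image_of_continuousOn_injOn (continuous_displace hφ v τ).continuousOn
      (injOn_of_injective (hb τ hτ).1)
  have hstE : ∀ τ ∈ Ioo (-t₀) t₀, τ ∈ Ioo (-δ) δ → |τ| * L ≤ 1 / 2 →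
      pairMeasure K (((displace φ v τ '' E \ E) ∩ ball 0 R) ×ˢ ((E \ displace φ v τ '' E) ∩ ball 0 R)) +
        perK K (ball 0 R) E ≤
      perK K (ball 0 R) (displace φ v τ '' E) + 2 * ENNReal.ofReal (ε / 4 * τ ^ 2) := by
    intro τ hτ hτδ hτL
    obtain ⟨s1, s2⟩ := hstab τ hτ
    rw [hΨ τ hτδ] at s1 s2
    have him := image_displace_congr hφ (hb τ hτL) hEE'
    rw [← perK_congr hEE', ← perK_congr (him.union hEE')] at s1
    rw [← perK_congr hEE', ← perK_congr (him.inter hEE')] at s2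
    have hsub := perK_submodular hKm (measurableSet_ball (x := (0 : Eu n)) (ε := R)) (mF τ hτL) hE
    set P := perK K (ball 0 R) E
    set m := pairMeasure K (((displace φ v τ '' E \ E) ∩ ball 0 R) ×ˢ
      ((E \ displace φ v τ '' E) ∩ ball 0 R))
    set e := ENNReal.ofReal (ε / 4 * τ ^ 2)
    refine (ENNReal.add_le_add_iff_right hP).1 ?_
    calc m + P + P ≤ m + (perK K (ball 0 R) (displace φ v τ '' E ∪ E) + e) +
          (perK K (ball 0 R) (displace φ v τ '' E ∩ E) + e) := by gcongr
      _ = (perK K (ball 0 R) (displace φ v τ '' E ∪ E) +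
          perK K (ball 0 R) (displace φ v τ '' E ∩ E) + m) + 2 * e := by ring
      _ ≤ (perK K (ball 0 R) (displace φ v τ '' E) + P) + 2 * e := by gcongr
      _ = _ := by ring
  -- The interaction term is kept at time -t and discarded at time t.
  have q1 := hstE (-t) ⟨by linarith, by linarith⟩ ⟨by linarith, by linarith⟩ htL'
  have q2 := hstE t ⟨by linarith, by linarith⟩ ⟨by linarith, by linarith⟩ htL
  have q3 := second_variation_le hK hs hlam hφ hφL hφs hρR hv htL hE
  have hshift : ∀ x ∈ ball (0 : Eu n) r, (x ∈ displace φ v (-t) '' E ↔ x + t • v ∈ E) := by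
    intro x hx
    have hxt : x + t • v ∈ ball (0 : Eu n) r1 := by
      rw [mem_ball_zero_iff] at hx ⊢
      have := norm_add_le x (t • v)
      rw [norm_smul, hv, mul_one, Real.norm_eq_abs, abs_of_pos ht0] at this
      linarith
    have hval : displace φ v (-t) (x + t • v) = x := by
      simp [displace, hφ1 _ hxt]
    constructor
    · rintro ⟨y, hy, hyx⟩
      rw [← hval] at hyx
      rwa [← (hb _ htL').1 hyx]
    · exact fun h => ⟨_, h, hval⟩
  have hrR : ball (0 : Eu n) r ⊆ ball 0 R := ball_subset_ball (by linarith)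
  have hsubset : (inSet E (t • v) r) ×ˢ (outSet E (t • v) r) ⊆
      ((displace φ v (-t) '' E \ E) ∩ ball 0 R) ×ˢ ((E \ displace φ v (-t) '' E) ∩ ball 0 R) := by
    rintro ⟨x, y⟩ ⟨⟨hx1, hx2, hx3⟩, ⟨hy1, hy2, hy3⟩⟩
    exact ⟨⟨⟨(hshift x hx1).2 hx3, hx2⟩, hrR hx1⟩, ⟨⟨hy2, fun h => hy3 ((hshift y hy1).1 h)⟩, hrR hy1⟩⟩
  have hlow := pairMeasure_prod_ge hK hs hlam (measurableSet_inSet hE (t • v) r)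
    (measurableSet_outSet hE (t • v) r) (fun x hx => hx.1) (fun x hx => hx.1)
    (Set.disjoint_left.2 fun x hx hx' => hx.2.1 hx'.2.1)
  refine (hlow.trans (measure_mono hsubset)).trans ?_
  rw [abs_of_pos ht0, hLeq] at q3
  rw [neg_sq] at q1
  set P := perK K (ball 0 R) E
  set m := pairMeasure K (((displace φ v (-t) '' E \ E) ∩ ball 0 R) ×ˢ
    ((E \ displace φ v (-t) '' E) ∩ ball 0 R))
  set e := ENNReal.ofReal (ε / 4 * t ^ 2)
  have he : ENNReal.ofReal (ε * t ^ 2) = 4 * e := by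
    rw [show (4 : ℝ≥0∞) = ENNReal.ofReal 4 by simp, ← ENNReal.ofReal_mul (by norm_num)]
    congr 1; ring
  rw [he]
  have hP2 : 2 * P ≠ ⊤ := ENNReal.mul_ne_top (by simp) hP
  refine (ENNReal.add_le_add_iff_right hP2).1 ?_
  calc m + 2 * P = (m + P) + P := by ring
    _ ≤ (perK K (ball 0 R) (displace φ v (-t) '' E) + 2 * e) +
        (perK K (ball 0 R) (displace φ v t '' E) + 2 * e) := by
        gcongr
        exact (le_add_self).trans q2
    _ = (perK K (ball 0 R) (displace φ v t '' E) + perK K (ball 0 R) (displace φ v (-t) '' E))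
        + 4 * e := by ring
    _ ≤ _ := by
        refine (add_le_add_left q3 (4 * e)).trans (le_of_eq ?_)
        ring

/-! ### Variation under translations and interpolation of the perimeter -/

/-- Points of `B_r` whose membership in `E` changes under the translation by `w`. -/
def diffSet {n : ℕ} (E : Set (Eu n)) (w : Eu n) (r : ℝ) : Set (Eu n) :=
  {x | x ∈ ball 0 r ∧ ¬(x ∈ E ↔ x + w ∈ E)}

theorem diffSet_eq_union {n : ℕ} (E : Set (Eu n)) (w : Eu n) (r : ℝ) :
    diffSet E w r = inSet E w r ∪ outSet E w r := by
  ext x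
  simp only [diffSet, inSet, outSet, mem_union, mem_ofPred_eq]
  tauto

theorem disjoint_inSet_outSet {n : ℕ} (E : Set (Eu n)) (w : Eu n) (r : ℝ) :
    Disjoint (inSet E w r) (outSet E w r) :=
  Set.disjoint_left.2 fun _ hx hx' => hx.2.1 hx'.2.1

theorem measurableSet_diffSet {n : ℕ} {E : Set (Eu n)} (hE : MeasurableSet E) (w : Eu n) (r : ℝ) :
    MeasurableSet (diffSet E w r) := by
  rw [diffSet_eq_union]
  exact (measurableSet_inSet hE w r).union (measurableSet_outSet hE w r)

theorem volume_diffSet {n : ℕ} {E : Set (Eu n)} (hE : MeasurableSet E) (w : Eu n) (r : ℝ) :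
    volume (diffSet E w r) = volume (inSet E w r) + volume (outSet E w r) := by
  rw [diffSet_eq_union, measure_union (disjoint_inSet_outSet E w r) (measurableSet_outSet hE w r)]

theorem diffSet_mono {n : ℕ} (E : Set (Eu n)) (w : Eu n) {r r' : ℝ} (h : r ≤ r') :
    diffSet E w r ⊆ diffSet E w r' := fun _ hx => ⟨ball_subset_ball h hx.1, hx.2⟩

/-- A change along w₁ + w₂ must occur on one of the two legs; the second leg starts at x + w₁, hence
the larger radius. -/
theorem volume_diffSet_add_le {n : ℕ} (E : Set (Eu n)) (w₁ w₂ : Eu n) (r : ℝ) :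
    volume (diffSet E (w₁ + w₂) r) ≤
      volume (diffSet E w₁ r) + volume (diffSet E w₂ (r + ‖w₁‖)) := by
  have hsub : diffSet E (w₁ + w₂) r ⊆
      diffSet E w₁ r ∪ (fun x => x + w₁) ⁻¹' diffSet E w₂ (r + ‖w₁‖) := by
    rintro x ⟨hx, h⟩
    by_cases h1 : x ∈ E ↔ x + w₁ ∈ E
    · right
      refine ⟨?_, ?_⟩
      · rw [mem_ball_zero_iff] at hx ⊢
        exact (norm_add_le _ _).trans_lt (by linarith)
      · rw [add_assoc, ← h1]; exact h
    · exact Or.inl ⟨hx, h1⟩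
  refine (measure_mono hsub).trans ((measure_union_le _ _).trans ?_)
  rw [measure_preimage_add_right]

theorem volume_diffSet_nsmul_le {n : ℕ} (E : Set (Eu n)) (w : Eu n) (r : ℝ) (k : ℕ) :
    volume (diffSet E ((k : ℝ) • w) r) ≤ k * volume (diffSet E w (r + k * ‖w‖)) := by
  induction k with
  | zero => simp [diffSet]
  | succ k ih =>
    have e : ((k + 1 : ℕ) : ℝ) • w = (k : ℝ) • w + w := by push_cast; rw [add_smul, one_smul]
    have hn : ‖(k : ℝ) • w‖ = k * ‖w‖ := by rw [norm_smul, Real.norm_natCast]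
    have hm : volume (diffSet E w (r + k * ‖w‖)) ≤
        volume (diffSet E w (r + (k + 1 : ℕ) * ‖w‖)) := by
      apply measure_mono
      apply diffSet_mono
      push_cast
      nlinarith [norm_nonneg w]
    rw [e]
    calc _ ≤ _ := volume_diffSet_add_le E _ _ r
      _ ≤ k * volume (diffSet E w (r + k * ‖w‖)) + volume (diffSet E w (r + k * ‖w‖)) := by
          rw [hn]; gcongr
      _ ≤ k * volume (diffSet E w (r + (k + 1 : ℕ) * ‖w‖)) +
          volume (diffSet E w (r + (k + 1 : ℕ) * ‖w‖)) := by gcongr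
      _ = _ := by push_cast; ring

/-- The variation of `E` in `B_r` is at most `M` in every direction. -/
def HasVar {n : ℕ} (E : Set (Eu n)) (r M : ℝ) : Prop :=
  ∀ v : Eu n, ‖v‖ = 1 → ∀ᶠ t in 𝓝[>] (0 : ℝ), volume (diffSet E (t • v) r) ≤ ENNReal.ofReal (M * t)

/-- An infinitesimal bound becomes a bound for finite translations with the same constant: z is cut
into k + 1 equal steps short enough for the hypothesis, and subadditivity adds them up. -/
theorem HasVar.volume_diffSet_le {n : ℕ} {E : Set (Eu n)} {r δ M : ℝ} (h : HasVar E (r + δ) M)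
    {z : Eu n} (hz : ‖z‖ ≤ δ) : volume (diffSet E z r) ≤ ENNReal.ofReal (M * ‖z‖) := by
  rcases eq_or_ne z 0 with rfl | hz0
  · simp [diffSet]
  have hpos : 0 < ‖z‖ := norm_pos_iff.2 hz0
  have hv : ‖(‖z‖⁻¹ • z)‖ = 1 := by
    rw [norm_smul, norm_inv, norm_norm, inv_mul_cancel₀ hpos.ne']
  have htend : Tendsto (fun k : ℕ => ‖z‖ / ((k : ℝ) + 1)) atTop (𝓝[>] 0) := by
    refine tendsto_nhdsWithin_iff.2 ⟨?_, Eventually.of_forall fun k => ?_⟩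
    · have := (tendsto_one_div_add_atTop_nhds_zero_nat (𝕜 := ℝ)).const_mul ‖z‖
      simpa [div_eq_mul_inv] using this
    · exact div_pos hpos (by positivity)
  obtain ⟨k, hk⟩ := (htend.eventually (h _ hv)).exists
  have hk1 : (0 : ℝ) < (k : ℝ) + 1 := by positivity
  have hw : (‖z‖ / ((k : ℝ) + 1)) • ‖z‖⁻¹ • z = ((k : ℝ) + 1)⁻¹ • z := by
    rw [smul_smul]; congr 1; field_simp
  rw [hw] at hk
  have h1 := volume_diffSet_nsmul_le E (((k : ℝ) + 1)⁻¹ • z) r (k + 1)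
  have e1 : ((k + 1 : ℕ) : ℝ) • ((k : ℝ) + 1)⁻¹ • z = z := by
    push_cast; rw [smul_smul, mul_inv_cancel₀ hk1.ne', one_smul]
  have e2 : ((k + 1 : ℕ) : ℝ) * ‖((k : ℝ) + 1)⁻¹ • z‖ = ‖z‖ := by
    have : ‖((k + 1 : ℕ) : ℝ) • ((k : ℝ) + 1)⁻¹ • z‖ = ‖z‖ := by rw [e1]
    rwa [norm_smul, Real.norm_natCast] at this
  rw [e1, e2] at h1
  refine h1.trans ?_
  calc ((k + 1 : ℕ) : ℝ≥0∞) * volume (diffSet E (((k : ℝ) + 1)⁻¹ • z) (r + ‖z‖))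
      ≤ ((k + 1 : ℕ) : ℝ≥0∞) * ENNReal.ofReal (M * (‖z‖ / (k + 1))) := by
        gcongr
        exact (measure_mono (diffSet_mono E _ (by linarith))).trans hk
    _ = ENNReal.ofReal (M * ‖z‖) := by
        rw [← ENNReal.ofReal_natCast, ← ENNReal.ofReal_mul (by positivity)]
        congr 1; push_cast; field_simp

/-- Evenness allows pairs whose outer point lies in the ball to be swapped, so the first point can
always be taken in the ball. The substitution y = x + z and Tonelli then collect the pairs by their
difference. -/
theorem perK_le_lintegral_diffSet {n : ℕ} {K : Eu n → ℝ} (hK : Measurable K)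
    (heven : ∀ z, K (-z) = K z) {E : Set (Eu n)} (hE : MeasurableSet E) (ρ : ℝ) :
    perK K (ball 0 ρ) E ≤ ∫⁻ z, ENNReal.ofReal (K z) * volume (diffSet E z ρ) := by
  set A : Set (Eu n × Eu n) := {p | p.1 ∈ ball 0 ρ ∧ p.1 ∈ E ∧ p.2 ∉ E} with hA
  set A' : Set (Eu n × Eu n) := {p | p.2 ∈ ball 0 ρ ∧ p.1 ∈ E ∧ p.2 ∉ E} with hA'
  set D : Set (Eu n × Eu n) := {p | p.1 ∈ ball 0 ρ ∧ ¬(p.1 ∈ E ↔ p.2 ∈ E)} with hD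
  have mA : MeasurableSet A := (measurable_fst measurableSet_ball).inter
    ((measurable_fst hE).inter (measurable_snd hE.compl))
  have mA' : MeasurableSet A' := (measurable_snd measurableSet_ball).inter
    ((measurable_fst hE).inter (measurable_snd hE.compl))
  have eD : D = A ∪ Prod.swap ⁻¹' A' := by
    ext ⟨x, y⟩
    simp only [hD, hA, hA', mem_union, mem_preimage, Prod.swap_prod_mk, mem_ofPred_eq]
    tauto
  have mA's : MeasurableSet (Prod.swap ⁻¹' A') := measurable_swap mA'
  have hswap : pairMeasure K (Prod.swap ⁻¹' A') = pairMeasure K A' := by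
    rw [pairMeasure, withDensity_apply _ mA's, withDensity_apply _ mA', ← lintegral_indicator mA's,
      ← lintegral_indicator mA', ← (Measure.measurePreserving_swap).lintegral_comp
        ((measurable_pairDensity hK).indicator mA')]
    refine lintegral_congr fun p => ?_
    by_cases hp : p.swap ∈ A'
    · rw [indicator_of_mem hp, indicator_of_mem (show p ∈ Prod.swap ⁻¹' A' from hp)]
      congr 1
      rw [← heven]; simp
    · rw [indicator_of_notMem hp, indicator_of_notMem (show p ∉ Prod.swap ⁻¹' A' from hp)]
  have hdisj : Disjoint A (Prod.swap ⁻¹' A') := by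
    rw [Set.disjoint_left]
    rintro ⟨x, y⟩ h1 h2
    exact h2.2.2 h1.2.1
  have mD : MeasurableSet D := by rw [eD]; exact mA.union mA's
  have h1 : perK K (ball 0 ρ) E ≤ pairMeasure K D := by
    rw [perK_eq hK measurableSet_ball hE, eD, measure_union hdisj mA's, hswap]
    refine (measure_mono ?_).trans (measure_union_le _ _)
    rintro ⟨x, y⟩ ⟨a, b, c⟩
    exact c.imp (fun h => ⟨h, a, b⟩) (fun h => ⟨h, a, b⟩)
  refine h1.trans (le_of_eq ?_)
  have hmeas := (measurable_pairDensity hK).indicator mD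
  rw [pairMeasure, withDensity_apply _ mD, ← lintegral_indicator mD, lintegral_prod _ hmeas.aemeasurable]
  have hT : Measurable fun p : Eu n × Eu n => (p.1, p.1 + p.2) :=
    measurable_fst.prodMk (measurable_fst.add measurable_snd)
  calc ∫⁻ x, ∫⁻ y, D.indicator (fun p => ENNReal.ofReal (K (p.1 - p.2))) (x, y)
      = ∫⁻ x, ∫⁻ z, D.indicator (fun p => ENNReal.ofReal (K (p.1 - p.2))) (x, x + z) := by
        refine lintegral_congr fun x => ?_
        rw [lintegral_add_left_eq_self
          (fun y => D.indicator (fun p => ENNReal.ofReal (K (p.1 - p.2))) (x, y)) x]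
    _ = ∫⁻ z, ∫⁻ x, D.indicator (fun p => ENNReal.ofReal (K (p.1 - p.2))) (x, x + z) :=
        lintegral_lintegral_swap (hmeas.comp hT).aemeasurable
    _ = ∫⁻ z, ENNReal.ofReal (K z) * volume (diffSet E z ρ) := by
        refine lintegral_congr fun z => ?_
        rw [← lintegral_indicator_one (measurableSet_diffSet hE z ρ),
          ← lintegral_const_mul _ (measurable_one.indicator (measurableSet_diffSet hE z ρ))]
        refine lintegral_congr fun x => ?_
        by_cases hx : x ∈ diffSet E z ρ
        · rw [indicator_of_mem (show (x, x + z) ∈ D from hx), indicator_of_mem hx]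
          simp [heven]
        · rw [indicator_of_notMem (show (x, x + z) ∉ D from hx), indicator_of_notMem hx]
          simp

theorem lintegral_fun_norm {f : ℝ → ℝ} (hf : ∀ y, 0 ≤ y → 0 ≤ f y)
    (hi : IntegrableOn (fun y => y * f y) (Ioi 0)) :
    ∫⁻ z : Eu 2, ENNReal.ofReal (f ‖z‖) =
      ENNReal.ofReal (2 * Real.pi * ∫ y in Ioi (0 : ℝ), y * f y) := by
  have hdim : Module.finrank ℝ (Eu 2) - 1 = 1 := by simp
  have h1 : Integrable (fun z : Eu 2 => f ‖z‖) := by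
    rw [integrable_fun_norm_addHaar, hdim]
    simpa using hi
  rw [← ofReal_integral_eq_lintegral_ofReal h1
    (Eventually.of_forall fun z => hf _ (norm_nonneg z)), integral_fun_norm_addHaar, hdim]
  congr 1
  have hv : (volume : Measure (Eu 2)).real (ball 0 1) = Real.pi := by
    rw [Measure.real, EuclideanSpace.volume_ball_fin_two]
    simp [Real.pi_pos.le]
  rw [hv]
  simp
  ring

theorem lintegral_norm_rpow_closedBall {s δ : ℝ} (hs1 : s < 1) (hδ : 0 < δ) :
    ∫⁻ z in closedBall (0 : Eu 2) δ, ENNReal.ofReal (‖z‖ / ‖z‖ ^ (2 + s)) ≤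
      ENNReal.ofReal (2 * Real.pi * (δ ^ (1 - s) / (1 - s))) := by
  have hcongr : ∀ y ∈ Ioi (0 : ℝ), y * (Iic δ).indicator (fun y => y / y ^ (2 + s)) y =
      (Ioc 0 δ).indicator (fun y => y ^ (-s)) y := by
    intro y hy
    have hy0 : 0 < y := hy
    by_cases h : y ≤ δ
    · rw [indicator_of_mem (show y ∈ Iic δ from h),
        indicator_of_mem (show y ∈ Ioc 0 δ from ⟨hy0, h⟩)]
      have : y ^ (2 + s) = y ^ 2 * y ^ s := by
        rw [Real.rpow_add hy0]; norm_num
      rw [this, Real.rpow_neg hy0.le]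
      have := Real.rpow_pos_of_pos hy0 s
      field_simp
    · rw [indicator_of_notMem (show y ∉ Iic δ from h),
        indicator_of_notMem (fun h' => h h'.2), mul_zero]
  have hint : IntegrableOn (fun y : ℝ => y ^ (-s)) (Ioc 0 δ) :=
    (intervalIntegrable_iff_integrableOn_Ioc_of_le hδ.le).1
      (intervalIntegral.intervalIntegrable_rpow' (by linarith))
  have hi : IntegrableOn (fun y => y * (Iic δ).indicator (fun y => y / y ^ (2 + s)) y) (Ioi 0) := by
    rw [integrableOn_congr_fun hcongr measurableSet_Ioi]
    exact ((integrable_indicator_iff measurableSet_Ioc).2 hint).integrableOn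
  have hval : ∫ y in Ioi (0 : ℝ), y * (Iic δ).indicator (fun y => y / y ^ (2 + s)) y =
      δ ^ (1 - s) / (1 - s) := by
    rw [setIntegral_congr_fun measurableSet_Ioi hcongr, setIntegral_indicator measurableSet_Ioc,
      inter_eq_self_of_subset_right Ioc_subset_Ioi_self, ← intervalIntegral.integral_of_le hδ.le,
      integral_rpow (Or.inl (by linarith)), Real.zero_rpow (by linarith)]
    rw [show -s + 1 = 1 - s by ring, sub_zero]
  rw [← hval, ← lintegral_fun_norm _ hi, ← lintegral_indicator measurableSet_closedBall]
  · refine lintegral_mono fun z => ?_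
    by_cases hz : z ∈ closedBall (0 : Eu 2) δ
    · rw [indicator_of_mem hz, indicator_of_mem (show ‖z‖ ∈ Iic δ from mem_closedBall_zero_iff.1 hz)]
    · rw [indicator_of_notMem hz]; exact zero_le
  · intro y hy
    by_cases h : y ∈ Iic δ
    · rw [indicator_of_mem h]; positivity
    · rw [indicator_of_notMem h]

theorem lintegral_norm_rpow_compl_closedBall {s δ : ℝ} (hs : 0 < s) (hδ : 0 < δ) :
    ∫⁻ z in (closedBall (0 : Eu 2) δ)ᶜ, ENNReal.ofReal (1 / ‖z‖ ^ (2 + s)) ≤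
      ENNReal.ofReal (2 * Real.pi * (δ ^ (-s) / s)) := by
  have hcongr : ∀ y ∈ Ioi (0 : ℝ), y * (Ioi δ).indicator (fun y => 1 / y ^ (2 + s)) y =
      (Ioi δ).indicator (fun y => y ^ (-(1 + s))) y := by
    intro y hy
    have hy0 : 0 < y := hy
    by_cases h : y ∈ Ioi δ
    · rw [indicator_of_mem h, indicator_of_mem h]
      have : y ^ (2 + s) = y * y ^ (1 + s) := by
        rw [← Real.rpow_one_add' hy0.le (by linarith)]; congr 1; ring
      rw [this, Real.rpow_neg hy0.le]
      have := Real.rpow_pos_of_pos hy0 (1 + s)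
      field_simp
    · rw [indicator_of_notMem h, indicator_of_notMem h, mul_zero]
  have hi : IntegrableOn (fun y => y * (Ioi δ).indicator (fun y => 1 / y ^ (2 + s)) y) (Ioi 0) := by
    rw [integrableOn_congr_fun hcongr measurableSet_Ioi]
    exact ((integrable_indicator_iff measurableSet_Ioi).2
      (integrableOn_Ioi_rpow_of_lt (by linarith) hδ)).integrableOn
  have hval : ∫ y in Ioi (0 : ℝ), y * (Ioi δ).indicator (fun y => 1 / y ^ (2 + s)) y =
      δ ^ (-s) / s := by
    rw [setIntegral_congr_fun measurableSet_Ioi hcongr, setIntegral_indicator measurableSet_Ioi,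
      inter_eq_self_of_subset_right (Ioi_subset_Ioi hδ.le),
      integral_Ioi_rpow_of_lt (by linarith) hδ, show -(1 + s) + 1 = -s by ring, neg_div_neg_eq]
  rw [← hval, ← lintegral_fun_norm _ hi, ← lintegral_indicator measurableSet_closedBall.compl]
  · refine lintegral_mono fun z => ?_
    by_cases hz : z ∈ (closedBall (0 : Eu 2) δ)ᶜ
    · rw [indicator_of_mem hz, indicator_of_mem (show ‖z‖ ∈ Ioi δ from
        lt_of_not_ge fun h => hz (mem_closedBall_zero_iff.2 h))]
    · rw [indicator_of_notMem hz]; exact zero_le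
  · intro y hy
    by_cases h : y ∈ Ioi δ
    · rw [indicator_of_mem h]; positivity
    · rw [indicator_of_notMem h]

/-- Interpolation: the nonlocal perimeter is controlled by the variation. -/
theorem perK_le_of_hasVar {s lam Lam : ℝ} {K : Eu 2 → ℝ} (hK : KernelL2 s lam Lam K) (hs : 0 < s)
    (hs1 : s < 1) (hLam : 0 < Lam) {E : Set (Eu 2)} (hE : MeasurableSet E) {ρ δ M : ℝ}
    (hρ : 0 < ρ) (hδ : 0 < δ) (hM : 0 ≤ M) (h : HasVar E (ρ + δ) M) :
    perK K (ball 0 ρ) E ≤ ENNReal.ofReal (Lam * (2 * Real.pi / (1 - s)) * (M * δ ^ (1 - s)) +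
      Lam * (2 * Real.pi ^ 2 / s) * (ρ ^ 2 * δ ^ (-s))) := by
  have hpi := Real.pi_pos
  have h1s : 0 < 1 - s := by linarith
  have hup : ∀ z : Eu 2, z ≠ 0 → K z ≤ Lam / ‖z‖ ^ (2 + s) := fun z hz => by
    simpa using hK.upper z hz
  refine (perK_le_lintegral_diffSet hK.measurable hK.even hE ρ).trans ?_
  -- Short differences are controlled by the variation, long ones by the area πρ². The first
  -- integral converges because s < 1, the second because s > 0.
  rw [← lintegral_add_compl _ (measurableSet_closedBall (x := (0 : Eu 2)) (ε := δ)),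
    ENNReal.ofReal_add (by positivity) (by positivity)]
  refine add_le_add ?_ ?_
  · calc ∫⁻ z in closedBall (0 : Eu 2) δ, ENNReal.ofReal (K z) * volume (diffSet E z ρ)
        ≤ ∫⁻ z in closedBall (0 : Eu 2) δ, ENNReal.ofReal (Lam * M) *
            ENNReal.ofReal (‖z‖ / ‖z‖ ^ (2 + s)) := by
          refine setLIntegral_mono' measurableSet_closedBall fun z hz => ?_
          rcases eq_or_ne z 0 with rfl | hz0
          · simp [diffSet]
          have := h.volume_diffSet_le (mem_closedBall_zero_iff.1 hz)
          calc _ ≤ ENNReal.ofReal (Lam / ‖z‖ ^ (2 + s)) * ENNReal.ofReal (M * ‖z‖) := by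
                gcongr; exact hup z hz0
            _ = _ := by
                rw [← ENNReal.ofReal_mul (by positivity), ← ENNReal.ofReal_mul (by positivity)]
                congr 1; ring
      _ ≤ ENNReal.ofReal (Lam * M) * ENNReal.ofReal (2 * Real.pi * (δ ^ (1 - s) / (1 - s))) := by
          rw [lintegral_const_mul' _ _ ENNReal.ofReal_ne_top]
          gcongr
          exact lintegral_norm_rpow_closedBall hs1 hδ
      _ = _ := by
          rw [← ENNReal.ofReal_mul (by positivity)]
          congr 1; ring
  · calc ∫⁻ z in (closedBall (0 : Eu 2) δ)ᶜ, ENNReal.ofReal (K z) * volume (diffSet E z ρ)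
        ≤ ∫⁻ z in (closedBall (0 : Eu 2) δ)ᶜ, ENNReal.ofReal (Lam * (Real.pi * ρ ^ 2)) *
            ENNReal.ofReal (1 / ‖z‖ ^ (2 + s)) := by
          refine setLIntegral_mono' measurableSet_closedBall.compl fun z hz => ?_
          have hz0 : z ≠ 0 := by
            rintro rfl
            exact hz (mem_closedBall_zero_iff.2 (by simpa using hδ.le))
          have hv : volume (diffSet E z ρ) ≤ ENNReal.ofReal (Real.pi * ρ ^ 2) := by
            refine (measure_mono (fun x hx => hx.1 : diffSet E z ρ ⊆ ball 0 ρ)).trans (le_of_eq ?_)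
            rw [EuclideanSpace.volume_ball_fin_two, ← ENNReal.ofReal_pow hρ.le,
              ← NNReal.coe_real_pi, ENNReal.ofReal_mul (by positivity), ENNReal.ofReal_coe_nnreal,
              mul_comm]
          calc _ ≤ ENNReal.ofReal (Lam / ‖z‖ ^ (2 + s)) * ENNReal.ofReal (Real.pi * ρ ^ 2) := by
                gcongr; exact hup z hz0
            _ = _ := by
                rw [← ENNReal.ofReal_mul (by positivity), ← ENNReal.ofReal_mul (by positivity)]
                congr 1; ring
      _ ≤ ENNReal.ofReal (Lam * (Real.pi * ρ ^ 2)) *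
          ENNReal.ofReal (2 * Real.pi * (δ ^ (-s) / s)) := by
          rw [lintegral_const_mul' _ _ ENNReal.ofReal_ne_top]
          gcongr
          exact lintegral_norm_rpow_compl_closedBall hs hδ
      _ = _ := by
          rw [← ENNReal.ofReal_mul (by positivity)]
          congr 1; ring

/-! ### From product bounds to variation bounds -/

theorem volume_real_ball_two {r : ℝ} (hr : 0 ≤ r) :
    (volume : Measure (Eu 2)).real (ball 0 r) = Real.pi * r ^ 2 := by
  rw [Measure.real, EuclideanSpace.volume_ball_fin_two]
  simp [hr, mul_comm, Real.pi_pos.le]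

theorem volume_real_translate_diff_le {w : Eu 2} {r : ℝ} (hr : 0 ≤ r) (hw : ‖w‖ ≤ r) :
    (volume : Measure (Eu 2)).real ((fun x => x + w) ⁻¹' ball 0 r \ ball 0 r) ≤
      3 * Real.pi * r * ‖w‖ := by
  have hsub : (fun x => x + w) ⁻¹' ball 0 r \ ball 0 r ⊆ ball (0 : Eu 2) (r + ‖w‖) \ ball 0 r := by
    rintro x ⟨h1, h2⟩
    refine ⟨?_, h2⟩
    have h1' : ‖x + w‖ < r := mem_ball_zero_iff.1 h1
    rw [mem_ball_zero_iff]
    have := norm_sub_le (x + w) w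
    rw [add_sub_cancel_right] at this
    linarith
  refine (measureReal_mono hsub 
    ((measure_mono Set.sdiff_subset).trans_lt measure_ball_lt_top).ne).trans ?_
  rw [measureReal_sdiff (ball_subset_ball (by linarith [norm_nonneg w])) measurableSet_ball,
    volume_real_ball_two (by positivity), volume_real_ball_two hr]
  have : Real.pi * (r + ‖w‖) ^ 2 - Real.pi * r ^ 2 = Real.pi * (‖w‖ * (2 * r + ‖w‖)) := by ring
  rw [this]
  have := Real.pi_pos
  have h2 : ‖w‖ * (2 * r + ‖w‖) ≤ ‖w‖ * (3 * r) := by gcongr; linarith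
  nlinarith

/-- Entering minus leaving volume is |B_r ∩ (E - w)| - |B_r ∩ E|. After a translation the first term
becomes |(B_r + w) ∩ E|, so the difference is carried by the two crescents between B_r and B_r + w.
-/
theorem abs_volume_inSet_sub_outSet_le {E : Set (Eu 2)} (hE : MeasurableSet E) {w : Eu 2} {r : ℝ}
    (hr : 0 ≤ r) (hw : ‖w‖ ≤ r) :
    |volume.real (inSet E w r) - volume.real (outSet E w r)| ≤ 3 * Real.pi * r * ‖w‖ := by
  have hfin : ∀ {A B : Set (Eu 2)} , volume (ball (0 : Eu 2) r ∩ A ∩ B) ≠ ⊤ := fun {A B} =>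
    ((measure_mono (inter_subset_left.trans inter_subset_left)).trans_lt measure_ball_lt_top).ne
  set T : Eu 2 → Eu 2 := fun x => x + w with hT
  have hTm : Measurable T := measurable_id.add_const w
  set F := T ⁻¹' E with hF
  have hFm : MeasurableSet F := hTm hE
  set B := ball (0 : Eu 2) r with hB
  have hBm : MeasurableSet B := measurableSet_ball
  have hBfin : volume B ≠ ⊤ := measure_ball_lt_top.ne
  have e1 : volume.real (B ∩ F) = volume.real (B ∩ F ∩ E) + volume.real (inSet E w r) := by
    rw [← measureReal_inter_add_sdiff (s := B ∩ F) hE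
      ((measure_mono inter_subset_left).trans_lt measure_ball_lt_top).ne]
    congr 2
    ext x; simp only [inSet, Set.mem_sdiff, mem_inter_iff, mem_ofPred_eq, hF, mem_preimage, hT]
    tauto
  have e2 : volume.real (B ∩ E) = volume.real (B ∩ F ∩ E) + volume.real (outSet E w r) := by
    rw [← measureReal_inter_add_sdiff (s := B ∩ E) hFm
      ((measure_mono inter_subset_left).trans_lt measure_ball_lt_top).ne]
    congr 2
    · ext x; simp only [mem_inter_iff]; tauto
    · ext x; simp only [outSet, Set.mem_sdiff, mem_inter_iff, mem_ofPred_eq, hF, mem_preimage, hT]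
      tauto
  set S : Eu 2 → Eu 2 := fun x => x + -w with hS
  have e3 : volume.real (B ∩ F) = volume.real (S ⁻¹' B ∩ E) := by
    have : B ∩ F = T ⁻¹' (S ⁻¹' B ∩ E) := by
      ext x; simp [hF, hT, hS]
    rw [this, Measure.real, Measure.real, hT, measure_preimage_add_right]
  have hSfin : volume (S ⁻¹' B) ≠ ⊤ := by
    rw [hS, measure_preimage_add_right]; exact hBfin
  have b1 : volume.real (S ⁻¹' B ∩ E) ≤ volume.real (B ∩ E) + volume.real (S ⁻¹' B \ B) := by
    refine (measureReal_mono ?_ ?_).trans (measureReal_union_le _ _)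
    · rintro x ⟨h1, h2⟩
      by_cases h : x ∈ B
      · exact Or.inl ⟨h, h2⟩
      · exact Or.inr ⟨h1, h⟩
    · exact (measure_union_lt_top ((measure_mono inter_subset_left).trans_lt hBfin.lt_top)
        ((measure_mono Set.sdiff_subset).trans_lt hSfin.lt_top)).ne
  have b2 : volume.real (B ∩ E) ≤ volume.real (S ⁻¹' B ∩ E) + volume.real (B \ S ⁻¹' B) := by
    refine (measureReal_mono ?_ ?_).trans (measureReal_union_le _ _)
    · rintro x ⟨h1, h2⟩
      by_cases h : x ∈ S ⁻¹' B
      · exact Or.inl ⟨h, h2⟩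
      · exact Or.inr ⟨h1, h⟩
    · exact (measure_union_lt_top ((measure_mono inter_subset_left).trans_lt hSfin.lt_top)
        ((measure_mono Set.sdiff_subset).trans_lt hBfin.lt_top)).ne
  have b3 : volume.real (S ⁻¹' B \ B) ≤ 3 * Real.pi * r * ‖w‖ := by
    have := volume_real_translate_diff_le (w := -w) hr (by rwa [norm_neg])
    rwa [norm_neg] at this
  have b4 : volume.real (B \ S ⁻¹' B) ≤ 3 * Real.pi * r * ‖w‖ := by
    have h1 : T ⁻¹' (B \ S ⁻¹' B) = T ⁻¹' B \ B := by
      ext x; simp [hT, hS]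
    have h2 : volume.real (B \ S ⁻¹' B) = volume.real (T ⁻¹' (B \ S ⁻¹' B)) := by
      rw [Measure.real, Measure.real, hT, measure_preimage_add_right]
    rw [h2, h1]
    exact volume_real_translate_diff_le hr hw
  rw [abs_le]
  constructor <;> linarith

theorem volume_inSet_ne_top {n : ℕ} (E : Set (Eu n)) (w : Eu n) (r : ℝ) :
    volume (inSet E w r) ≠ ⊤ :=
  ((measure_mono fun _ hx => hx.1).trans_lt measure_ball_lt_top).ne

theorem volume_outSet_ne_top {n : ℕ} (E : Set (Eu n)) (w : Eu n) (r : ℝ) :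
    volume (outSet E w r) ≠ ⊤ :=
  ((measure_mono fun _ hx => hx.1).trans_lt measure_ball_lt_top).ne

theorem volume_diffSet_ne_top {n : ℕ} (E : Set (Eu n)) (w : Eu n) (r : ℝ) :
    volume (diffSet E w r) ≠ ⊤ :=
  ((measure_mono fun _ hx => hx.1).trans_lt measure_ball_lt_top).ne

theorem volume_real_diffSet {n : ℕ} {E : Set (Eu n)} (hE : MeasurableSet E) (w : Eu n) (r : ℝ) :
    volume.real (diffSet E w r) = volume.real (inSet E w r) + volume.real (outSet E w r) := by
  rw [Measure.real, volume_diffSet hE, ENNReal.toReal_add (volume_inSet_ne_top _ _ _)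
    (volume_outSet_ne_top _ _ _)]
  rfl

/-- The entering and leaving volumes have a small product in every direction. -/
def SmallProduct {n : ℕ} (E : Set (Eu n)) (r W : ℝ) : Prop :=
  ∀ v : Eu n, ‖v‖ = 1 → ∀ᶠ t in 𝓝[>] (0 : ℝ),
    volume.real (inSet E (t • v) r) * volume.real (outSet E (t • v) r) ≤ (W * t) ^ 2

theorem min_le_of_mul_le_sq {a b c : ℝ} (hc : 0 ≤ c) (h : a * b ≤ c ^ 2) :
    a ≤ c ∨ b ≤ c := by
  by_contra! hh
  nlinarith [hh.1, hh.2]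

/-- One of the two volumes is at most Wt, and the other exceeds it by at most 3πrt. -/
theorem SmallProduct.diff_le {E : Set (Eu 2)} (hE : MeasurableSet E) {r W : ℝ} (hr : 0 < r)
    (hW : 0 ≤ W) (h : SmallProduct E r W) : HasVar E r (2 * W + 3 * Real.pi * r) := by
  intro v hv
  filter_upwards [h v hv, Ioo_mem_nhdsGT hr] with t ht ht0
  have hn : ‖t • v‖ = t := by rw [norm_smul, hv, mul_one, Real.norm_eq_abs, abs_of_pos ht0.1]
  have h1 := abs_volume_inSet_sub_outSet_le hE hr.le (w := t • v) (by rw [hn]; exact ht0.2.le)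
  rw [hn, abs_le] at h1
  have hWt : 0 ≤ W * t := mul_nonneg hW ht0.1.le
  rw [← ENNReal.ofReal_toReal (volume_diffSet_ne_top E (t • v) r)]
  apply ENNReal.ofReal_le_ofReal
  have h2 := volume_real_diffSet hE (t • v) r
  rw [Measure.real] at h2
  rw [h2]
  rcases min_le_of_mul_le_sq hWt ht with h3 | h3
  · nlinarith [h1.1]
  · nlinarith [h1.2]

theorem HasVar.mono {n : ℕ} {E : Set (Eu n)} {r r' M M' : ℝ} (h : HasVar E r M) (hr : r' ≤ r)
    (hM : M ≤ M') : HasVar E r' M' := by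
  intro v hv
  filter_upwards [h v hv, self_mem_nhdsWithin] with t ht ht0
  have ht0' : 0 < t := ht0
  exact (measure_mono (diffSet_mono E _ hr)).trans
    (ht.trans (ENNReal.ofReal_le_ofReal (by gcongr)))

/-- Reduces stability to one numerical inequality: W needs to be only of the order of the square
root of the perimeter bound Q. -/
theorem exists_smallProduct_of_perK_le : ∃ C : ℝ, 0 < C ∧ ∀ {s lam Lam : ℝ} {K : Eu 2 → ℝ}
    {E E' : Set (Eu 2)} {r ρ R ε Q W : ℝ}, KernelL2 s lam Lam K → 0 < s → 0 < lam → 0 < Lam →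
    MeasurableSet E → E =ᵐ[volume] E' → IsStableSet K (ball 0 R) E' → 0 < r → r < ρ → ρ ≤ R →
    0 < ε → 0 ≤ Q → perK K (ball 0 ρ) E ≤ ENNReal.ofReal Q →
    (2 * r) ^ (2 + s) * (variationConst 2 s lam Lam * C ^ 2 * Q / (ρ - r) ^ 2 + ε) ≤ lam * W ^ 2 →
    SmallProduct E r W := by
  obtain ⟨C, hC, hcore⟩ := stable_in_mul_out_le 2
  refine ⟨C, hC, ?_⟩
  intro s lam Lam K E E' r ρ R ε Q W hK hs hlam hLam hE hEE' hst hr hρ hρR hε hQ hP hW v hv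
  filter_upwards [hcore hK hs hlam hE hEE' hst hr hρ hρR hv hε, self_mem_nhdsWithin] with t ht ht0
  have hV := variationConst_nonneg (n := 2) (s := s) hlam hLam
  have ht1 := ht.trans (add_le_add_left (mul_le_mul_right hP _) _)
  rw [← ENNReal.ofReal_mul (by positivity), ← ENNReal.ofReal_add (by positivity) (by positivity),
    ← ENNReal.ofReal_toReal (volume_inSet_ne_top E (t • v) r),
    ← ENNReal.ofReal_toReal (volume_outSet_ne_top E (t • v) r),
    ← ENNReal.ofReal_mul (by positivity), ← ENNReal.ofReal_mul (by positivity),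
    ENNReal.ofReal_le_ofReal_iff (by positivity)] at ht1
  change lam / (2 * r) ^ (((2 : ℕ) : ℝ) + s) * (volume.real (inSet E (t • v) r) *
    volume.real (outSet E (t • v) r)) ≤ _ at ht1
  push_cast at ht1
  set I := volume.real (inSet E (t • v) r) * volume.real (outSet E (t • v) r)
  set p := (2 * r) ^ (2 + s) with hp
  have hp0 : 0 < p := Real.rpow_pos_of_pos (by positivity) _
  rw [div_mul_eq_mul_div, div_le_iff₀ hp0] at ht1
  have h2 : lam * I ≤ lam * (W * t) ^ 2 := by
    refine ht1.trans ?_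
    calc _ = p * (variationConst 2 s lam Lam * C ^ 2 * Q / (ρ - r) ^ 2 + ε) * t ^ 2 := by
          rw [div_pow]; ring
      _ ≤ lam * W ^ 2 * t ^ 2 := by gcongr
      _ = _ := by ring
  exact le_of_mul_le_mul_left h2 hlam

/-- The bound (R/g)^s ≤ R/g trades the exponent s for an integer one, so that only powers of the
ratio R/g remain in the iteration. -/
theorem rpow_two_mul_mul_rpow_neg_le {s r g R : ℝ} (hs : 0 < s) (hs1 : s < 1) (hr : 0 < r)
    (hrR : r ≤ R) (hg : 0 < g) (hgR : g ≤ R) :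
    (2 * r) ^ (2 + s) * g ^ (-s) ≤ 8 * R ^ 2 * (R / g) := by
  have hR : 0 < R := by linarith
  have h1 : (2 * r) ^ (2 + s) ≤ (2 * R) ^ (2 + s) :=
    Real.rpow_le_rpow (by positivity) (by linarith) (by linarith)
  have h2 : (2 * R) ^ (2 + s) = 2 ^ (2 + s) * (R ^ 2 * R ^ s) := by
    rw [Real.mul_rpow (by norm_num) hR.le, Real.rpow_add hR]
    norm_num
  have h3 : (2 : ℝ) ^ (2 + s) ≤ 8 := by
    calc (2 : ℝ) ^ (2 + s) ≤ 2 ^ (3 : ℝ) :=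
          Real.rpow_le_rpow_of_exponent_le (by norm_num) (by linarith)
      _ = 8 := by norm_num
  have h4 : R ^ s * g ^ (-s) = (R / g) ^ s := by
    rw [Real.rpow_neg hg.le, Real.div_rpow hR.le hg.le]; rfl
  have hq : 1 ≤ R / g := (one_le_div hg).2 hgR
  have h5 : (R / g) ^ s ≤ R / g := by
    calc (R / g) ^ s ≤ (R / g) ^ (1 : ℝ) := Real.rpow_le_rpow_of_exponent_le hq hs1.le
      _ = R / g := Real.rpow_one _
  have hG : 0 < g ^ (-s) := Real.rpow_pos_of_pos hg _
  have hRs : 0 < R ^ s := Real.rpow_pos_of_pos hR _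
  calc (2 * r) ^ (2 + s) * g ^ (-s) ≤ (2 ^ (2 + s) * (R ^ 2 * R ^ s)) * g ^ (-s) := by
        rw [← h2]; gcongr
    _ = 2 ^ (2 + s) * R ^ 2 * (R ^ s * g ^ (-s)) := by ring
    _ ≤ 8 * R ^ 2 * (R / g) := by rw [h4]; gcongr

/-- The new variation grows like the square root of the old one, so the old one can be absorbed with
a small factor. The factor 1/16 is chosen to beat the growth by 8 of (R/g)³ when the gap g is
halved. -/
theorem hasVar_step : ∀ s lam Lam : ℝ, 0 < s → s < 1 → 0 < lam → 0 < Lam → ∃ D : ℝ, 0 < D ∧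
    ∀ {K : Eu 2 → ℝ} {E E' : Set (Eu 2)} {r g R M : ℝ}, KernelL2 s lam Lam K →
    MeasurableSet E → E =ᵐ[volume] E' → IsStableSet K (ball 0 R) E' → 0 < r → 0 < g → g ≤ R →
    r + 2 * g ≤ R → 0 ≤ M → HasVar E (r + 2 * g) M →
    HasVar E r (M / 16 + D * (R / g) ^ 3 * R) := by
  obtain ⟨C, hC, hprod⟩ := exists_smallProduct_of_perK_le
  intro s lam Lam hs hs1 hlam hLam
  have hpi := Real.pi_pos
  have h1s : 0 < 1 - s := by linarith
  have hV := variationConst_nonneg (n := 2) (s := s) hlam hLam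
  obtain ⟨V, hVdef⟩ : ∃ V, V = variationConst 2 s lam Lam * C ^ 2 := ⟨_, rfl⟩
  obtain ⟨A1, hA1⟩ : ∃ A, A = Lam * (2 * Real.pi / (1 - s)) := ⟨_, rfl⟩
  obtain ⟨A2, hA2⟩ : ∃ A, A = Lam * (2 * Real.pi ^ 2 / s) := ⟨_, rfl⟩
  have hV0 : 0 ≤ V := by rw [hVdef]; positivity
  have hA10 : 0 ≤ A1 := by rw [hA1]; positivity
  have hA20 : 0 ≤ A2 := by rw [hA2]; positivity
  obtain ⟨B, hB⟩ : ∃ B, B = 8 * (V * (A1 + A2) + 1) := ⟨_, rfl⟩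
  have hB0 : 0 < B := by rw [hB]; positivity
  refine ⟨1 / 16 + 16 * B / lam + 3 * Real.pi, by positivity, ?_⟩
  intro K E E' r g R M hK hE hEE' hst hr hg hgR hrgR hM hvar
  have hR : 0 < R := by linarith
  have hrR : r ≤ R := by linarith
  have hP := perK_le_of_hasVar hK hs hs1 hLam hE (ρ := r + g) (δ := g) (by linarith) hg hM
    (by rwa [show r + g + g = r + 2 * g by ring])
  rw [← hA1, ← hA2] at hP
  obtain ⟨q, hq⟩ : ∃ q, q = R / g := ⟨_, rfl⟩
  have hq1 : 1 ≤ q := by rw [hq]; exact (one_le_div hg).2 hgR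
  have hq3 : 1 ≤ q ^ 3 := one_le_pow₀ hq1
  obtain ⟨G, hG⟩ : ∃ G, G = g ^ (-s) := ⟨_, rfl⟩
  have hG0 : 0 < G := by rw [hG]; exact Real.rpow_pos_of_pos hg _
  have hg1 : g ^ (1 - s) = g * G := by
    rw [hG, sub_eq_add_neg, Real.rpow_add hg, Real.rpow_one]
  have hpG := rpow_two_mul_mul_rpow_neg_le hs hs1 hr hrR hg hgR
  rw [← hG, ← hq] at hpG
  rw [hg1, ← hG] at hP
  -- The required inequality is B q³ R (M + R) ≤ lam W², and (x + y)² ≥ 4xy with these two summands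
  -- gives exactly that product. Doubling W later produces M/16.
  set W := (M + R) / 32 + 8 * B * q ^ 3 * R / lam with hW
  have hsmall : SmallProduct E r W := by
    -- The stability error is given the same scaling as the main term; it accounts for the summand 1
    -- in B.
    refine hprod (ρ := r + g) (ε := R ^ 2 * G / g ^ 2) hK hs hlam hLam hE hEE' hst hr (by linarith)
      (by linarith) (by positivity) (by positivity) hP ?_
    rw [← hVdef, add_sub_cancel_left]
    have hp0 : 0 < (2 * r) ^ (2 + s) := Real.rpow_pos_of_pos (by positivity) _
    generalize (2 * r) ^ (2 + s) = p at *
    have hrg : (r + g) ^ 2 ≤ R ^ 2 := by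
      apply pow_le_pow_left₀ <;> linarith
    calc p * (V * (A1 * (M * (g * G)) + A2 * ((r + g) ^ 2 * G)) / g ^ 2 + R ^ 2 * G / g ^ 2)
        = (p * G) * ((V * (A1 * (M * g) + A2 * (r + g) ^ 2) + R ^ 2) / g ^ 2) := by ring
      _ ≤ (8 * R ^ 2 * q) * ((V * (A1 * (M * R) + A2 * R ^ 2) + R ^ 2) / g ^ 2) := by gcongr
      _ = q ^ 3 * (8 * (V * (A1 * (M * R) + A2 * R ^ 2) + R ^ 2)) := by
          rw [hq]; field_simp
      _ ≤ q ^ 3 * (B * R * (M + R)) := by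
          apply mul_le_mul_of_nonneg_left _ (by positivity)
          rw [hB]
          have h1 : 0 ≤ V * A1 * (R * R) := by positivity
          have h2 : 0 ≤ V * A2 * (M * R) := by positivity
          have h3 : 0 ≤ M * R := by positivity
          nlinarith
      _ = lam * (4 * ((M + R) / 32) * (8 * B * q ^ 3 * R / lam)) := by field_simp; ring
      _ ≤ lam * W ^ 2 := by
          gcongr
          rw [hW]
          nlinarith [sq_nonneg ((M + R) / 32 - 8 * B * q ^ 3 * R / lam)]
  have hW0 : 0 ≤ W := by rw [hW]; positivity
  refine (hsmall.diff_le hE hr hW0).mono le_rfl ?_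
  rw [← hq, hW]
  have e : (1 / 16 + 16 * B / lam + 3 * Real.pi) * q ^ 3 * R =
      q ^ 3 * (R / 16 + 3 * Real.pi * R) + 16 * B * q ^ 3 * R / lam := by ring
  rw [e]
  have h1 : R / 16 + 3 * Real.pi * R ≤ q ^ 3 * (R / 16 + 3 * Real.pi * R) :=
    le_mul_of_one_le_left (by positivity) hq3
  have h2 : 3 * Real.pi * r ≤ 3 * Real.pi * R := by gcongr
  have e2 : 2 * ((M + R) / 32 + 8 * B * q ^ 3 * R / lam) + 3 * Real.pi * r =
      M / 16 + R / 16 + 16 * B * q ^ 3 * R / lam + 3 * Real.pi * r := by ring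
  rw [e2]
  linarith

/-- A purely qualitative bound from the finiteness of the perimeter. M depends on the set, but the
iteration needs some finite starting value, whose influence then disappears. -/
theorem exists_hasVar {s lam Lam : ℝ} {K : Eu 2 → ℝ} {E E' : Set (Eu 2)} {r R : ℝ}
    (hK : KernelL2 s lam Lam K) (hs : 0 < s) (hlam : 0 < lam) (hLam : 0 < Lam)
    (hE : MeasurableSet E) (hEE' : E =ᵐ[volume] E') (hst : IsStableSet K (ball 0 R) E')
    (hr : 0 < r) (hrR : r < R) : ∃ M : ℝ, 0 ≤ M ∧ HasVar E r M := by
  obtain ⟨C, hC, hprod⟩ := exists_smallProduct_of_perK_le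
  have hfin : perK K (ball 0 R) E ≠ ⊤ := by rw [perK_congr hEE']; exact hst.1.ne
  have hV := variationConst_nonneg (n := 2) (s := s) hlam hLam
  set Q := (perK K (ball 0 R) E).toReal with hQ
  set Z := (2 * r) ^ (2 + s) * (variationConst 2 s lam Lam * C ^ 2 * Q / (R - r) ^ 2 + 1) / lam
    with hZ
  have hZ0 : 0 ≤ Z := by
    have : 0 ≤ Q := ENNReal.toReal_nonneg
    positivity
  have hsmall : SmallProduct E r (Real.sqrt Z) := by
    refine hprod (ε := 1) (Q := Q) hK hs hlam hLam hE hEE' hst hr hrR le_rfl one_pos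
      ENNReal.toReal_nonneg (by rw [hQ, ENNReal.ofReal_toReal hfin]) ?_
    rw [Real.sq_sqrt hZ0, hZ]
    apply le_of_eq; field_simp
  refine ⟨_, ?_, hsmall.diff_le hE hr (Real.sqrt_nonneg _)⟩
  have := Real.pi_pos
  positivity

/-- The universal bound for the classical variation of stable sets. -/
theorem exists_hasVar_bound : ∀ s lam Lam : ℝ, 0 < s → s < 1 → 0 < lam → 0 < Lam → ∃ D : ℝ, 0 < D ∧
    ∀ {K : Eu 2 → ℝ} {E E' : Set (Eu 2)} {R : ℝ}, KernelL2 s lam Lam K →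
    MeasurableSet E → E =ᵐ[volume] E' → IsStableSet K (ball 0 R) E' → 0 < R →
    HasVar E (9 / 10 * R) (D * R) := by
  intro s lam Lam hs hs1 hlam hLam
  obtain ⟨D, hD, hstep⟩ := hasVar_step s lam Lam hs hs1 hlam hLam
  set D' := D * 80 ^ 3 with hD'
  have hD'0 : 0 < D' := by positivity
  refine ⟨1 + 2 * D', by positivity, ?_⟩
  intro K E E' R hK hE hEE' hst hR
  obtain ⟨M, hM, hvar⟩ := exists_hasVar (r := 19 / 20 * R) hK hs hlam hLam hE hEE' hst
    (by positivity) (by linarith)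
  -- The radii increase from 9R/10 to 19R/20, with gaps 2R/(80 · 2^k).
  set ρ : ℕ → ℝ := fun k => R * (19 / 20 - 1 / 20 * (1 / 2) ^ k) with hρ
  have hpow : ∀ k : ℕ, (0 : ℝ) < (1 / 2) ^ k ∧ ((1 : ℝ) / 2) ^ k ≤ 1 := fun k =>
    ⟨by positivity, pow_le_one₀ (by norm_num) (by norm_num)⟩
  -- The term 2D'8^k R is a fixed point of the recursion: 2D'8^(k+1)/16 + D'8^k = 2D'8^k. Only the a
  -- priori M is contracted, and it vanishes as N grows with k = 0.
  have claim : ∀ N k : ℕ, HasVar E (ρ k) (M * (1 / 16) ^ N + 2 * D' * 8 ^ k * R) := by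
    intro N
    induction N with
    | zero =>
      intro k
      refine hvar.mono ?_ ?_
      · simp only [hρ]
        nlinarith [(hpow k).1]
      · have : 0 ≤ 2 * D' * 8 ^ k * R := by positivity
        simpa using this
    | succ N ih =>
      intro k
      have hg : 0 < R / (80 * 2 ^ k) := by positivity
      have hgap : ρ k + 2 * (R / (80 * 2 ^ k)) = ρ (k + 1) := by
        simp only [hρ, pow_succ, one_div, inv_pow]
        field_simp
        ring
      have h2k : (1 : ℝ) ≤ 2 ^ k := one_le_pow₀ (by norm_num)
      have hρ0 : 0 < ρ k := by
        simp only [hρ]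
        nlinarith [(hpow k).2]
      have hρR : ρ (k + 1) ≤ R := by
        simp only [hρ]
        nlinarith [(hpow (k + 1)).1]
      have := hstep (M := M * (1 / 16) ^ N + 2 * D' * 8 ^ (k + 1) * R) hK hE hEE' hst hρ0 hg
        (div_le_self hR.le (by nlinarith)) (by rw [hgap]; exact hρR) (by positivity)
        (by rw [hgap]; exact ih (k + 1))
      refine this.mono le_rfl (le_of_eq ?_)
      have e : R / (R / (80 * 2 ^ k)) = 80 * 2 ^ k := by field_simp
      have e8 : ((2 : ℝ) ^ k) ^ 3 = 8 ^ k := by rw [← pow_mul, mul_comm, pow_mul]; norm_num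
      rw [e, mul_pow, e8, hD', pow_succ, pow_succ]
      ring
  have hlim : Tendsto (fun N : ℕ => M * (1 / 16 : ℝ) ^ N) atTop (𝓝 0) := by
    have := (tendsto_pow_atTop_nhds_zero_of_lt_one (r := (1 / 16 : ℝ)) (by norm_num)
      (by norm_num)).const_mul M
    simpa using this
  obtain ⟨N, hN⟩ := (hlim.eventually (gt_mem_nhds hR)).exists
  refine (claim N 0).mono ?_ ?_
  · simp only [hρ]; norm_num; linarith
  · rw [pow_zero]; linarith

/-- Quantitative stability: the product of entering and leaving volumes at unit scale. -/
theorem exists_smallProduct_bound : ∀ s lam Lam : ℝ, 0 < s → s < 1 → 0 < lam → 0 < Lam →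
    ∃ C : ℝ, 0 < C ∧ ∀ {K : Eu 2 → ℝ} {E E' : Set (Eu 2)} {R : ℝ}, KernelL2 s lam Lam K →
    MeasurableSet E → E =ᵐ[volume] E' → IsStableSet K (ball 0 R) E' → 2 ≤ R →
    SmallProduct E (3 / 2) (C * R ^ (-s / 2)) := by
  obtain ⟨C, hC, hprod⟩ := exists_smallProduct_of_perK_le
  intro s lam Lam hs hs1 hlam hLam
  obtain ⟨D, hD, hvar⟩ := exists_hasVar_bound s lam Lam hs hs1 hlam hLam
  have hpi := Real.pi_pos
  have h1s : 0 < 1 - s := by linarith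
  have hV := variationConst_nonneg (n := 2) (s := s) hlam hLam
  obtain ⟨V, hVdef⟩ : ∃ V, V = variationConst 2 s lam Lam * C ^ 2 := ⟨_, rfl⟩
  obtain ⟨A1, hA1⟩ : ∃ A, A = Lam * (2 * Real.pi / (1 - s)) := ⟨_, rfl⟩
  obtain ⟨A2, hA2⟩ : ∃ A, A = Lam * (2 * Real.pi ^ 2 / s) := ⟨_, rfl⟩
  have hV0 : 0 ≤ V := by rw [hVdef]; positivity
  have hA10 : 0 ≤ A1 := by rw [hA1]; positivity
  have hA20 : 0 ≤ A2 := by rw [hA2]; positivity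
  obtain ⟨c1, hc1⟩ : ∃ c : ℝ, c = (1 / 20 : ℝ) ^ (1 - s) := ⟨_, rfl⟩
  obtain ⟨c2, hc2⟩ : ∃ c : ℝ, c = (1 / 20 : ℝ) ^ (-s) := ⟨_, rfl⟩
  have hc10 : 0 ≤ c1 := by rw [hc1]; positivity
  have hc20 : 0 ≤ c2 := by rw [hc2]; positivity
  obtain ⟨Z, hZ⟩ : ∃ Z, Z = (2 * (3 / 2) : ℝ) ^ (2 + s) *
    (100 * V * (A1 * D * c1 + A2 * c2) + 1) / lam := ⟨_, rfl⟩
  have hZ0 : 0 < Z := by rw [hZ]; positivity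
  refine ⟨Real.sqrt Z, Real.sqrt_pos.2 hZ0, ?_⟩
  intro K E E' R hK hE hEE' hst hR2
  have hR : 0 < R := by linarith
  -- Variation O(R) interpolated at scale R gives perimeter O(R^(2-s)).
  have hP := perK_le_of_hasVar hK hs hs1 hLam hE (ρ := 17 / 20 * R) (δ := 1 / 20 * R)
    (M := D * R)
    (by positivity) (by positivity) (by positivity)
    (by rw [show 17 / 20 * R + 1 / 20 * R = 9 / 10 * R by ring]; exact hvar hK hE hEE' hst hR)
  rw [← hA1, ← hA2, Real.mul_rpow (by norm_num) hR.le, Real.mul_rpow (by norm_num) hR.le, ← hc1,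
    ← hc2] at hP
  obtain ⟨G, hG⟩ : ∃ G, G = R ^ (-s) := ⟨_, rfl⟩
  have hG0 : 0 < G := by rw [hG]; exact Real.rpow_pos_of_pos hR _
  have hg1 : R ^ (1 - s) = R * G := by
    rw [hG, sub_eq_add_neg, Real.rpow_add hR, Real.rpow_one]
  rw [hg1, ← hG] at hP
  refine hprod (ρ := 17 / 20 * R) (ε := G) hK hs hlam hLam hE hEE' hst (by norm_num) (by linarith)
    (by linarith) hG0 (by positivity) hP ?_
  have hGW : (Real.sqrt Z * R ^ (-s / 2)) ^ 2 = Z * G := by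
    rw [mul_pow, Real.sq_sqrt hZ0.le, ← Real.rpow_natCast, ← Real.rpow_mul hR.le, hG]
    congr 2; push_cast; ring
  rw [hGW, hZ, ← hVdef]
  have hp0 : 0 < (2 * (3 / 2) : ℝ) ^ (2 + s) := by positivity
  generalize (2 * (3 / 2) : ℝ) ^ (2 + s) = p at *
  -- Equality holds at R = 2. The cutoff layer has width of order R, so its gradient squared turns
  -- R^(2-s) into R^(-s).
  have hden : 1 / 10 * R ≤ 17 / 20 * R - 3 / 2 := by linarith
  have hden2 : (1 / 10 * R) ^ 2 ≤ (17 / 20 * R - 3 / 2) ^ 2 :=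
    pow_le_pow_left₀ (by positivity) hden 2
  have h17 : (17 / 20 * R) ^ 2 ≤ R ^ 2 := pow_le_pow_left₀ (by positivity) (by linarith) 2
  calc p * (V * (A1 * (D * R * (c1 * (R * G))) + A2 * ((17 / 20 * R) ^ 2 * (c2 * G))) /
        (17 / 20 * R - 3 / 2) ^ 2 + G)
      ≤ p * (V * (A1 * (D * R * (c1 * (R * G))) + A2 * (R ^ 2 * (c2 * G))) /
        (1 / 10 * R) ^ 2 + G) := by gcongr
    _ = lam * (p * (100 * V * (A1 * D * c1 + A2 * c2) + 1) / lam * G) := by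
        field_simp
        ring

/-! ### One-dimensional slices -/

/-- Points of `(-1, 1)` entering `S ⊆ ℝ` under the translation by `t`. -/
def enterSet (S : Set ℝ) (t : ℝ) : Set ℝ := {z | z ∈ Ioo (-1 : ℝ) 1 ∧ z ∉ S ∧ z + t ∈ S}

/-- Primitive of the characteristic function. -/
noncomputable def indPrimitive (S : Set ℝ) (x : ℝ) : ℝ := ∫ y in (0 : ℝ)..x, S.indicator 1 y

theorem intervalIntegrable_indicator_one {S : Set ℝ} (hS : MeasurableSet S) (a b : ℝ) :
    IntervalIntegrable (S.indicator (1 : ℝ → ℝ)) volume a b := by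
  refine IntervalIntegrable.mono_fun (g := S.indicator (1 : ℝ → ℝ)) (f := fun _ => (1 : ℝ))
    intervalIntegrable_const ((measurable_one.indicator hS).aestronglyMeasurable)
    (Eventually.of_forall fun x => ?_)
  by_cases hx : x ∈ S <;> simp [hx]

theorem ae_hasDerivAt_indPrimitive {S : Set ℝ} (hS : MeasurableSet S) :
    ∀ᵐ x, HasDerivAt (indPrimitive S) (S.indicator 1 x) x := by
  have hloc : LocallyIntegrable (S.indicator (1 : ℝ → ℝ)) volume := by
    have h1 : LocallyIntegrable (fun _ : ℝ => (1 : ℝ)) volume := locallyIntegrable_const 1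
    exact h1.indicator hS
  filter_upwards [LocallyIntegrable.ae_hasDerivAt_integral hloc] with x hx
  exact hx 0

/-- At a the density of S is 0 and at b it is 1. The integral over (a, b) of 1_S(z + t) - 1_S(z)
telescopes to the mass of S just after b minus that just after a, which is t + o(t), and only
entering points contribute positively to it. -/
theorem one_le_liminf_enterSet {S : Set ℝ} (hS : MeasurableSet S) {t : ℕ → ℝ} (ht0 : ∀ n, 0 < t n)
    (ht : Tendsto t atTop (𝓝 0)) {a b : ℝ} (hab : a < b) (ha1 : -1 < a) (hb1 : b < 1)
    (ha : HasDerivAt (indPrimitive S) 0 a) (hb : HasDerivAt (indPrimitive S) 1 b) :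
    1 ≤ liminf (fun n => volume (enterSet S (t n)) / ENNReal.ofReal (t n)) atTop := by
  have htne : Tendsto t atTop (𝓝[≠] 0) :=
    tendsto_nhdsWithin_iff.2 ⟨ht, Eventually.of_forall fun n => (ht0 n).ne'⟩
  have h1 := ((hasDerivAt_iff_tendsto_slope_zero.1 hb).comp htne).sub
    ((hasDerivAt_iff_tendsto_slope_zero.1 ha).comp htne)
  rw [sub_zero] at h1
  have h2 := ENNReal.tendsto_ofReal h1
  rw [ENNReal.ofReal_one] at h2
  rw [← h2.liminf_eq]
  refine liminf_le_liminf (Eventually.of_forall fun n => ?_)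
  simp only [Function.comp_apply, smul_eq_mul]
  rw [ENNReal.le_div_iff_mul_le (Or.inl (by simpa using ht0 n)) (Or.inl ENNReal.ofReal_ne_top),
    ← ENNReal.ofReal_mul' (ht0 n).le]
  have hii := intervalIntegrable_indicator_one hS
  have e : ((t n)⁻¹ * (indPrimitive S (b + t n) - indPrimitive S b) -
      (t n)⁻¹ * (indPrimitive S (a + t n) - indPrimitive S a)) * t n =
      ∫ z in a..b, (S.indicator (1 : ℝ → ℝ) (z + t n) - S.indicator 1 z) := by
    have hc : IntervalIntegrable (fun z => S.indicator (1 : ℝ → ℝ) (z + t n)) volume a b := by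
      have := (hii (a + t n) (b + t n)).comp_add_right (t n)
      simpa using this
    rw [intervalIntegral.integral_sub hc (hii a b),
      intervalIntegral.integral_comp_add_right (fun z => S.indicator (1 : ℝ → ℝ) z)]
    have h3 : ∫ z in (a + t n)..(b + t n), S.indicator (1 : ℝ → ℝ) z =
        indPrimitive S (b + t n) - indPrimitive S (a + t n) :=
      (intervalIntegral.integral_interval_sub_left (hii _ _) (hii _ _)).symm
    have h4 : ∫ z in a..b, S.indicator (1 : ℝ → ℝ) z = indPrimitive S b - indPrimitive S a :=
      (intervalIntegral.integral_interval_sub_left (hii _ _) (hii _ _)).symm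
    rw [h3, h4]
    have := (ht0 n).ne'
    field_simp
    ring
  rw [e, intervalIntegral.integral_of_le hab.le]
  have hmE : MeasurableSet {z : ℝ | z ∉ S ∧ z + t n ∈ S} := hS.compl.inter
    ((measurable_id.add_const (t n)) hS)
  refine (integral_le_measure (s := {z : ℝ | z ∉ S ∧ z + t n ∈ S}) ?_ ?_).trans ?_
  · intro z hz
    simp [hz.1, hz.2]
  · intro z hz
    by_cases h1 : z ∈ S
    · by_cases h2 : z + t n ∈ S <;> simp [h1, h2]
    · have h2 : z + t n ∉ S := fun h2 => hz ⟨h1, h2⟩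
      simp [h1, h2]
  · rw [Measure.restrict_apply hmE]
    refine measure_mono ?_
    rintro z ⟨⟨h1, h2⟩, hz⟩
    exact ⟨⟨by linarith [hz.1], by linarith [hz.2]⟩, h1, h2⟩

/-- If `S` is rarely entered, then on `(-1, 1)` it is a.e. an initial segment. -/
theorem ae_mem_iff_le_of_liminf_lt_one {S : Set ℝ} (hS : MeasurableSet S) {t : ℕ → ℝ}
    (ht0 : ∀ n, 0 < t n) (ht : Tendsto t atTop (𝓝 0))
    (h : liminf (fun n => volume (enterSet S (t n)) / ENNReal.ofReal (t n)) atTop < 1) :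
    ∀ᵐ z, z ∈ Ioo (-1 : ℝ) 1 → (z ∈ S ↔ z ≤ volume.real (Ioo (-1 : ℝ) 1 ∩ S) - 1) := by
  have hLeb := ae_hasDerivAt_indPrimitive hS
  have horder : ∀ a b : ℝ, HasDerivAt (indPrimitive S) (S.indicator 1 a) a →
      HasDerivAt (indPrimitive S) (S.indicator 1 b) b → -1 < a → b < 1 → a < b → b ∈ S → a ∈ S := by
    intro a b ha hb ha1 hb1 hab hbS
    by_contra haS
    rw [indicator_of_notMem haS] at ha
    rw [indicator_of_mem hbS] at hb
    exact absurd (one_le_liminf_enterSet hS ht0 ht hab ha1 hb1 ha hb) (not_le.2 h)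
  set g := volume.real (Ioo (-1 : ℝ) 1 ∩ S) - 1 with hg
  -- The threshold is fixed by the length of the segment; its endpoint is discarded because
  -- membership there is undetermined.
  have hne : ∀ᵐ z : ℝ, z ≠ g := by
    rw [ae_iff]; simp
  filter_upwards [hLeb, hne] with z hz hzg hz1
  constructor
  · intro hzS
    have hsub : (Ioo (-1) z : Set ℝ) ≤ᵐ[volume] (Ioo (-1 : ℝ) 1 ∩ S : Set ℝ) := by
      filter_upwards [hLeb] with a ha ha1
      exact ⟨⟨ha1.1, ha1.2.trans hz1.2⟩, horder a z ha hz ha1.1 hz1.2 ha1.2 hzS⟩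
    have hfin : volume (Ioo (-1 : ℝ) 1 ∩ S) ≠ ⊤ :=
      ((measure_mono inter_subset_left).trans_lt measure_Ioo_lt_top).ne
    have := ENNReal.toReal_mono hfin (measure_mono_ae hsub)
    rw [Real.volume_Ioo, ENNReal.toReal_ofReal (by linarith [hz1.1])] at this
    rw [hg, Measure.real]; linarith
  · intro hle
    by_contra hzS
    have hsub : (Ioo (-1 : ℝ) 1 ∩ S : Set ℝ) ≤ᵐ[volume] (Ioc (-1) z : Set ℝ) := by
      filter_upwards [hLeb] with b hb hb1
      refine ⟨hb1.1.1, ?_⟩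
      by_contra hzb
      exact hzS (horder z b hz hb hz1.1 hb1.1.2 (not_le.1 hzb) hb1.2)
    have := ENNReal.toReal_mono (by simp) (measure_mono_ae hsub)
    rw [Real.volume_Ioc, ENNReal.toReal_ofReal (by linarith [hz1.1])] at this
    have h3 : g ≤ z := by rw [hg, Measure.real]; linarith
    exact hzg (le_antisymm hle h3)

/-- If `S` is rarely entered or left, then it is a.e. trivial on `(-1, 1)`. -/
theorem ae_mem_or_ae_notMem_of_liminf_lt_one {S : Set ℝ} (hS : MeasurableSet S) {t : ℕ → ℝ}
    (ht0 : ∀ n, 0 < t n) (ht : Tendsto t atTop (𝓝 0))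
    (h : liminf (fun n => volume {z | z ∈ Ioo (-1 : ℝ) 1 ∧ ¬(z ∈ S ↔ z + t n ∈ S)} /
      ENNReal.ofReal (t n)) atTop < 1) :
    (∀ᵐ z, z ∈ Ioo (-1 : ℝ) 1 → z ∈ S) ∨ (∀ᵐ z, z ∈ Ioo (-1 : ℝ) 1 → z ∉ S) := by
  have h1 : liminf (fun n => volume (enterSet S (t n)) / ENNReal.ofReal (t n)) atTop < 1 := by
    refine lt_of_le_of_lt (liminf_le_liminf (Eventually.of_forall fun n => ?_)) h
    refine ENNReal.div_le_div_right (measure_mono ?_) _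
    rintro z ⟨a, b, c⟩
    exact ⟨a, fun hh => b (hh.2 c)⟩
  have h2 : liminf (fun n => volume (enterSet Sᶜ (t n)) / ENNReal.ofReal (t n)) atTop < 1 := by
    refine lt_of_le_of_lt (liminf_le_liminf (Eventually.of_forall fun n => ?_)) h
    refine ENNReal.div_le_div_right (measure_mono ?_) _
    rintro z ⟨a, b, c⟩
    exact ⟨a, fun hh => c (hh.1 (not_not.1 b))⟩
  have hLeb := ae_hasDerivAt_indPrimitive hS
  have hLeb' := ae_hasDerivAt_indPrimitive hS.compl
  by_contra hcon
  rw [not_or, not_eventually, not_eventually] at hcon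
  obtain ⟨a, ha, haL, haL'⟩ := (hcon.1.and_eventually (hLeb.and hLeb')).exists
  obtain ⟨b, hb, hbL, hbL'⟩ := (hcon.2.and_eventually (hLeb.and hLeb')).exists
  push Not at ha hb
  rw [indicator_of_notMem ha.2] at haL
  rw [indicator_of_mem (show a ∈ Sᶜ from ha.2)] at haL'
  rw [indicator_of_mem hb.2] at hbL
  rw [indicator_of_notMem (show b ∉ Sᶜ from fun h => h hb.2)] at hbL'
  rcases lt_trichotomy a b with hab | rfl | hab
  · exact absurd (one_le_liminf_enterSet hS ht0 ht hab ha.1.1 hb.1.2 haL hbL) (not_le.2 h1)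
  · exact ha.2 hb.2
  · exact absurd (one_le_liminf_enterSet hS.compl ht0 ht hab hb.1.1 ha.1.2 hbL' haL') (not_le.2 h2)

/-! ### Slicing in the plane -/

/-- Tonelli and Fatou bound the integral of the liminf by c, and Markov's inequality at level 1
bounds the set. Only a sequence of times is needed. -/
theorem measurableSet_and_volume_le_of_liminf_slice {A : ℕ → Set (ℝ × ℝ)}
    (hA : ∀ n, MeasurableSet (A n)) {t : ℕ → ℝ} (ht0 : ∀ n, 0 < t n) {c : ℝ}
    (h : ∀ n, volume (A n) ≤ ENNReal.ofReal (c * t n)) :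
    MeasurableSet {y : ℝ | 1 ≤ liminf (fun n => volume (Prod.mk y ⁻¹' A n) /
      ENNReal.ofReal (t n)) atTop} ∧
    volume {y : ℝ | 1 ≤ liminf (fun n => volume (Prod.mk y ⁻¹' A n) /
      ENNReal.ofReal (t n)) atTop} ≤ ENNReal.ofReal c := by
  have hm : ∀ n, Measurable fun y : ℝ => volume (Prod.mk y ⁻¹' A n) / ENNReal.ofReal (t n) :=
    fun n => (measurable_measure_prodMk_left (hA n)).div_const _
  have hml : Measurable fun y : ℝ => liminf (fun n => volume (Prod.mk y ⁻¹' A n) /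
      ENNReal.ofReal (t n)) atTop := Measurable.liminf hm
  refine ⟨measurableSet_le measurable_const hml, ?_⟩
  have h1 := mul_meas_ge_le_lintegral (μ := volume) hml 1
  rw [one_mul] at h1
  refine h1.trans ((lintegral_liminf_le hm).trans ?_)
  refine liminf_le_of_frequently_le' (Frequently.of_forall fun n => ?_)
  have hpos : ENNReal.ofReal (t n) ≠ 0 := by simpa using ht0 n
  simp_rw [div_eq_mul_inv]
  rw [lintegral_mul_const _ (measurable_measure_prodMk_left (hA n)), ← Measure.prod_apply (hA n),
    ← Measure.volume_eq_prod, ← div_eq_mul_inv]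
  rw [ENNReal.div_le_iff_le_mul (Or.inl hpos) (Or.inl ENNReal.ofReal_ne_top),
    ← ENNReal.ofReal_mul' (ht0 n).le]
  exact h n

/-- A planar set which is rarely entered upwards and rarely crossed horizontally is, in a square
and outside few vertical strips, the subgraph of an almost constant function. -/
theorem exists_graph_of_small_variation {S : Set (ℝ × ℝ)} (hS : MeasurableSet S) {t : ℕ → ℝ}
    (ht0 : ∀ n, 0 < t n) (ht : Tendsto t atTop (𝓝 0)) {W c : ℝ} (hc : 0 ≤ c)
    (hv : ∀ n, volume {p : ℝ × ℝ | p.1 ∈ Ioo (-1 : ℝ) 1 ∧ p.2 ∈ Ioo (-1 : ℝ) 1 ∧ p ∉ S ∧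
      (p.1, p.2 + t n) ∈ S} ≤ ENNReal.ofReal (W * t n))
    (hh : ∀ n, volume {p : ℝ × ℝ | p.1 ∈ Ioo (-1 : ℝ) 1 ∧ p.2 ∈ Ioo (-1 : ℝ) 1 ∧
      ¬(p ∈ S ↔ (p.1 + t n, p.2) ∈ S)} ≤ ENNReal.ofReal (c * t n)) :
    ∃ (bad : Set ℝ) (g : ℝ → ℝ), bad ⊆ Ioo (-1) 1 ∧ MeasurableSet bad ∧
      volume bad ≤ ENNReal.ofReal W ∧ Measurable g ∧ (∀ y, g y ∈ Icc (-1 : ℝ) 1) ∧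
      (∀ y ∈ Ioo (-1 : ℝ) 1 \ bad, ∀ y' ∈ Ioo (-1 : ℝ) 1 \ bad, |g y - g y'| ≤ c) ∧
      ∀ y ∈ Ioo (-1 : ℝ) 1 \ bad, ∀ᵐ z, z ∈ Ioo (-1 : ℝ) 1 → ((y, z) ∈ S ↔ z ≤ g y) := by
  set I : Set ℝ := Ioo (-1) 1 with hI
  have mI : MeasurableSet I := measurableSet_Ioo
  set A : ℕ → Set (ℝ × ℝ) := fun n => {p | p.1 ∈ I ∧ p.2 ∈ I ∧ p ∉ S ∧ (p.1, p.2 + t n) ∈ S} with hA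
  set B : ℕ → Set (ℝ × ℝ) := fun n => {p | p.1 ∈ I ∧ p.2 ∈ I ∧ ¬(p ∈ S ↔ (p.1 + t n, p.2) ∈ S)}
    with hB
  have mA : ∀ n, MeasurableSet (A n) := fun n => (measurable_fst mI).inter ((measurable_snd mI).inter
    (hS.compl.inter ((measurable_fst.prodMk (measurable_snd.add_const (t n))) hS)))
  have mB : ∀ n, MeasurableSet (B n) := by
    intro n
    have m1 : MeasurableSet {p : ℝ × ℝ | (p.1 + t n, p.2) ∈ S} :=
      ((measurable_fst.add_const (t n)).prodMk measurable_snd) hS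
    have e : B n = (Prod.fst ⁻¹' I ∩ Prod.snd ⁻¹' I) ∩
        ((S \ {p : ℝ × ℝ | (p.1 + t n, p.2) ∈ S}) ∪ ({p : ℝ × ℝ | (p.1 + t n, p.2) ∈ S} \ S)) := by
      ext p
      simp only [hB, mem_ofPred_eq, mem_inter_iff, mem_preimage, mem_union, Set.mem_sdiff]
      tauto
    rw [e]
    exact ((measurable_fst mI).inter (measurable_snd mI)).inter ((hS.diff m1).union (m1.diff hS))
  have mB' : ∀ n, MeasurableSet (Prod.swap ⁻¹' B n) := fun n => measurable_swap (mB n)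
  have hB' : ∀ n, volume (Prod.swap ⁻¹' B n) ≤ ENNReal.ofReal (c * t n) := by
    intro n
    rw [Measure.volume_eq_prod, (Measure.measurePreserving_swap (μ := (volume : Measure ℝ))
      (ν := (volume : Measure ℝ))).measure_preimage (mB n).nullMeasurableSet]
    exact hh n
  obtain ⟨mbad, vbad⟩ := measurableSet_and_volume_le_of_liminf_slice mA ht0 hv
  obtain ⟨mH, vH⟩ := measurableSet_and_volume_le_of_liminf_slice mB' ht0 hB'
  set bad1 := {y : ℝ | 1 ≤ liminf (fun n => volume (Prod.mk y ⁻¹' A n) /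
      ENNReal.ofReal (t n)) atTop} with hbad1
  set H := {y : ℝ | 1 ≤ liminf (fun n => volume (Prod.mk y ⁻¹' (Prod.swap ⁻¹' B n)) /
      ENNReal.ofReal (t n)) atTop} with hH
  set g : ℝ → ℝ := fun y => volume.real (I ∩ Prod.mk y ⁻¹' S) - 1 with hg
  have hslice : ∀ y, MeasurableSet (Prod.mk y ⁻¹' S) := fun y => measurable_prodMk_left hS
  have hslice' : ∀ z, MeasurableSet {y | (y, z) ∈ S} := fun z => measurable_prodMk_right hS
  have mIS : MeasurableSet (Prod.snd ⁻¹' I ∩ S : Set (ℝ × ℝ)) := (measurable_snd mI).inter hS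
  have mIS' : MeasurableSet (Prod.fst ⁻¹' I ∩ S : Set (ℝ × ℝ)) := (measurable_fst mI).inter hS
  have mg : Measurable g :=
    (measurable_measure_prodMk_left mIS).ennreal_toReal.sub_const 1
  have hgI : ∀ y, g y ∈ Icc (-1 : ℝ) 1 := by
    intro y
    have h1 : volume.real (I ∩ Prod.mk y ⁻¹' S) ≤ 2 := by
      have h2 : volume.real (I ∩ Prod.mk y ⁻¹' S) ≤ volume.real I :=
        measureReal_mono inter_subset_left measure_Ioo_lt_top.ne
      have h3 : volume.real I = 2 := by
        rw [hI, Real.volume_real_Ioo_of_le (by norm_num)]; norm_num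
      linarith
    have h0 : 0 ≤ volume.real (I ∩ Prod.mk y ⁻¹' S) := measureReal_nonneg
    exact ⟨by simp only [hg]; linarith, by simp only [hg]; linarith⟩
  have hgraph : ∀ y ∈ I \ bad1, ∀ᵐ z, z ∈ I → ((y, z) ∈ S ↔ z ≤ g y) := by
    intro y hy
    have hlt : liminf (fun n => volume (Prod.mk y ⁻¹' A n) / ENNReal.ofReal (t n)) atTop < 1 :=
      lt_of_not_ge fun h => hy.2 h
    refine ae_mem_iff_le_of_liminf_lt_one (hslice y) ht0 ht (lt_of_le_of_lt (le_of_eq ?_) hlt)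
    congr 1
    funext n
    congr 2
    ext z
    simp only [enterSet, hA, mem_ofPred_eq, mem_preimage]
    exact ⟨fun h => ⟨hy.1, h.1, h.2.1, h.2.2⟩, fun h => ⟨h.2.1, h.2.2.1, h.2.2.2⟩⟩
  -- Outside H each horizontal slice is a.e. full or a.e. empty; T records the levels where it is
  -- not null.
  set T : Set ℝ := {z | volume ({y | y ∈ I ∧ (y, z) ∈ S}) ≠ 0} with hT
  have mTm : Measurable fun z : ℝ => volume ({y | y ∈ I ∧ (y, z) ∈ S}) :=
    measurable_measure_prodMk_right mIS'
  have mT : MeasurableSet T := (measurableSet_eq_fun mTm measurable_const).compl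
  have hlevel : ∀ z ∈ I \ H, ∀ᵐ y, y ∈ I → ((y, z) ∈ S ↔ z ∈ T) := by
    intro z hz
    have hlt : liminf (fun n => volume (Prod.mk z ⁻¹' (Prod.swap ⁻¹' B n)) /
        ENNReal.ofReal (t n)) atTop < 1 := lt_of_not_ge fun h => hz.2 h
    have hor := ae_mem_or_ae_notMem_of_liminf_lt_one (hslice' z) ht0 ht
      (lt_of_le_of_lt (le_of_eq ?_) hlt)
    · rcases hor with h1 | h1
      · have hzT : z ∈ T := by
          intro h0
          have h2 : volume I ≤ volume ({y | y ∈ I ∧ (y, z) ∈ S}) := by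
            refine measure_mono_ae ?_
            filter_upwards [h1] with y hy hyI
            exact ⟨hyI, hy hyI⟩
          rw [h0, hI, Real.volume_Ioo] at h2
          norm_num at h2
        filter_upwards [h1] with y hy hyI
        exact ⟨fun _ => hzT, fun _ => hy hyI⟩
      · have hzT : z ∉ T := by
          intro h0
          apply h0
          rw [measure_eq_zero_iff_ae_notMem]
          filter_upwards [h1] with y hy hyI
          exact hy hyI.1 hyI.2
        filter_upwards [h1] with y hy hyI
        exact ⟨fun h => absurd h (hy hyI), fun h => absurd h hzT⟩
    · congr 1
      funext n
      congr 2
      ext y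
      simp only [hB, mem_ofPred_eq, mem_preimage, Prod.swap_prod_mk]
      exact ⟨fun h => ⟨h.1, hz.1, h.2⟩, fun h => ⟨h.1, h.2.2⟩⟩
  set N : Set (ℝ × ℝ) := {p | p.1 ∈ I ∧ p.2 ∈ I \ H ∧ ¬(p ∈ S ↔ p.2 ∈ T)} with hN
  have mN : MeasurableSet N := by
    have e : N = (Prod.fst ⁻¹' I ∩ Prod.snd ⁻¹' (I \ H)) ∩
        ((S \ Prod.snd ⁻¹' T) ∪ (Prod.snd ⁻¹' T \ S)) := by
      ext p
      simp only [hN, mem_ofPred_eq, mem_inter_iff, mem_preimage, mem_union, Set.mem_sdiff]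
      tauto
    rw [e]
    exact ((measurable_fst mI).inter (measurable_snd (mI.diff mH))).inter
      ((hS.diff (measurable_snd mT)).union ((measurable_snd mT).diff hS))
  have hN0 : volume N = 0 := by
    rw [Measure.volume_eq_prod, Measure.prod_apply_symm mN, lintegral_eq_zero_iff
      (measurable_measure_prodMk_right mN)]
    refine Eventually.of_forall fun z => ?_
    simp only [Pi.zero_apply]
    by_cases hz : z ∈ I \ H
    · rw [measure_eq_zero_iff_ae_notMem]
      filter_upwards [hlevel z hz] with y hy hyN
      exact hyN.2.2 (hy hyN.1)
    · have : (fun y => (y, z)) ⁻¹' N = ∅ := by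
        ext y; simp only [mem_preimage, mem_empty_iff_false, iff_false]
        exact fun h => hz h.2.1
      rw [this, measure_empty]
  have mNs : Measurable fun y : ℝ => volume (Prod.mk y ⁻¹' N) := measurable_measure_prodMk_left mN
  have hNs : ∀ᵐ y : ℝ, volume (Prod.mk y ⁻¹' N) = 0 := by
    have := hN0
    rw [Measure.volume_eq_prod, Measure.prod_apply mN, lintegral_eq_zero_iff mNs] at this
    exact this
  -- Triviality of levels holds for a.e. y at each z. Fubini turns it into a statement for a.e. z at
  -- each fixed y, at the price of this null set of strips.
  set bad2 : Set ℝ := {y | volume (Prod.mk y ⁻¹' N) ≠ 0} with hbad2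
  have mbad2 : MeasurableSet bad2 := (measurableSet_eq_fun mNs measurable_const).compl
  have vbad2 : volume bad2 = 0 := ae_iff.1 hNs
  refine ⟨I ∩ (bad1 ∪ bad2), g, inter_subset_left, mI.inter (mbad.union mbad2), ?_, mg, hgI, ?_, ?_⟩
  · refine (measure_mono inter_subset_right).trans ((measure_union_le _ _).trans ?_)
    rw [vbad2, add_zero]
    exact vbad
  · have hgood : ∀ y ∈ I \ (I ∩ (bad1 ∪ bad2)), y ∈ I \ bad1 ∧ volume (Prod.mk y ⁻¹' N) = 0 := by
      rintro y ⟨h1, h2⟩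
      refine ⟨⟨h1, fun h => h2 ⟨h1, Or.inl h⟩⟩, ?_⟩
      by_contra h
      exact h2 ⟨h1, Or.inr h⟩
    have hTg : ∀ y ∈ I \ (I ∩ (bad1 ∪ bad2)), ∀ᵐ z, z ∈ I \ H → (z ∈ T ↔ z ≤ g y) := by
      intro y hy
      obtain ⟨h1, h2⟩ := hgood y hy
      rw [measure_eq_zero_iff_ae_notMem] at h2
      filter_upwards [h2, hgraph y h1] with z hz1 hz2 hz
      rw [← hz2 hz.1]
      by_contra hcon
      exact hz1 ⟨h1.1, hz, fun h => hcon h.symm⟩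
    have key : ∀ y ∈ I \ (I ∩ (bad1 ∪ bad2)), ∀ y' ∈ I \ (I ∩ (bad1 ∪ bad2)), g y' - g y ≤ c := by
      intro y hy y' hy'
      -- A level between the two heights is in S over y' but not over y, so it cannot be a trivial
      -- level: the oscillation is bounded by |H|.
      have hsub : (Ioo (g y) (g y') : Set ℝ) ≤ᵐ[volume] H := by
        filter_upwards [hTg y hy, hTg y' hy'] with z h1 h2 hz
        by_contra hzH
        have hzI : z ∈ I := ⟨(hgI y).1.trans_lt hz.1, hz.2.trans_le (hgI y').2⟩
        exact absurd ((h1 ⟨hzI, hzH⟩).1 ((h2 ⟨hzI, hzH⟩).2 hz.2.le)) (not_le.2 hz.1)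
      have := (measure_mono_ae hsub).trans vH
      rw [Real.volume_Ioo] at this
      exact (ENNReal.ofReal_le_ofReal_iff hc).1 this
    intro y hy y' hy'
    rw [abs_le]
    exact ⟨by linarith [key y hy y' hy'], key y' hy' y hy⟩
  · intro y hy
    exact hgraph y ⟨hy.1, fun h => hy.2 ⟨hy.1, Or.inl h⟩⟩

/-! ### Integration by parts and the choice of the axes -/

/-- A discrete integration by parts: moving the translation from ψ to E leaves only the entering and
leaving points. -/
theorem setIntegral_translate_sub {n : ℕ} {E : Set (Eu n)} (hE : MeasurableSet E) {ψ : Eu n → ℝ}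
    (hψ : Integrable ψ) (w : Eu n) :
    ∫ x in E, (ψ (x - w) - ψ x) =
      (∫ x in {x | x + w ∈ E} \ E, ψ x) - ∫ x in E \ {x | x + w ∈ E}, ψ x := by
  have hF : MeasurableSet {x | x + w ∈ E} := (measurable_id.add_const w) hE
  have h1 : ∫ x in E, ψ (x - w) = ∫ x in {x | x + w ∈ E}, ψ x := by
    rw [← integral_indicator hE, ← integral_indicator hF,
      ← integral_add_right_eq_self (fun x => E.indicator (fun x => ψ (x - w)) x) w]
    refine integral_congr_ae (Eventually.of_forall fun x => ?_)
    by_cases hx : x + w ∈ E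
    · simp only [indicator_of_mem hx, indicator_of_mem (show x ∈ {x | x + w ∈ E} from hx),
        add_sub_cancel_right]
    · simp only [indicator_of_notMem hx, indicator_of_notMem (show x ∉ {x | x + w ∈ E} from hx)]
  rw [integral_sub (hψ.comp_sub_right w).integrableOn hψ.integrableOn, h1,
    ← integral_inter_add_sdiff hF (hψ.integrableOn (s := E)),
    ← integral_inter_add_sdiff hE (hψ.integrableOn (s := {x | x + w ∈ E})), inter_comm]
  ring

theorem tendsto_setIntegral_slope {n : ℕ} (E : Set (Eu n)) {ψ : Eu n → ℝ} (hψ : ContDiff ℝ 1 ψ)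
    (hc : HasCompactSupport ψ) (v : Eu n) :
    Tendsto (fun t : ℝ => t⁻¹ * ∫ x in E, (ψ (x - t • v) - ψ x)) (𝓝[>] 0)
      (𝓝 (-∫ x in E, fderiv ℝ ψ x v)) := by
  obtain ⟨L, hL⟩ := (hψ.continuous_fderiv one_ne_zero).bounded_above_of_compact_support (hc.fderiv ℝ)
  have hL0 : 0 ≤ L := (norm_nonneg _).trans (hL 0)
  obtain ⟨ρ, hρ⟩ := hc.isCompact.isBounded.subset_ball 0
  have hzero : ∀ x, ρ ≤ ‖x‖ → ψ x = 0 := by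
    intro x hx
    apply image_eq_zero_of_notMem_tsupport
    intro h
    have := mem_ball_zero_iff.1 (hρ h)
    linarith
  simp_rw [← integral_const_mul]
  rw [← integral_neg]
  refine tendsto_integral_filter_of_dominated_convergence
    ((ball (0 : Eu n) (ρ + ‖v‖)).indicator fun _ => L * ‖v‖) ?_ ?_ ?_ ?_
  · refine Eventually.of_forall fun t => ?_
    exact ((((hψ.continuous.comp (continuous_id.sub continuous_const)).sub
      hψ.continuous).const_mul _).aestronglyMeasurable)
  · filter_upwards [Ioo_mem_nhdsGT (zero_lt_one' ℝ)] with t ht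
    refine Eventually.of_forall fun x => ?_
    have hn : ‖t • v‖ = t * ‖v‖ := by rw [norm_smul, Real.norm_eq_abs, abs_of_pos ht.1]
    by_cases hx : x ∈ ball (0 : Eu n) (ρ + ‖v‖)
    · rw [indicator_of_mem hx, norm_mul, norm_inv, Real.norm_eq_abs t, abs_of_pos ht.1,
        inv_mul_le_iff₀ ht.1]
      have := convex_univ.norm_image_sub_le_of_norm_fderiv_le (𝕜 := ℝ) (f := ψ) (x := x)
        (y := x - t • v) (fun z _ => (hψ.differentiable one_ne_zero).differentiableAt)
        (fun z _ => hL z) (mem_univ _) (mem_univ _)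
      rw [sub_sub_cancel_left, norm_neg, hn] at this
      linarith
    · rw [indicator_of_notMem hx]
      have hx' : ρ + ‖v‖ ≤ ‖x‖ := by
        rw [mem_ball_zero_iff] at hx; linarith
      have h1 : ρ ≤ ‖x - t • v‖ := by
        have h2 := norm_sub_norm_le x (t • v)
        have h3 : t * ‖v‖ ≤ ‖v‖ := mul_le_of_le_one_left (norm_nonneg _) ht.2.le
        linarith
      rw [hzero _ h1, hzero x (by linarith [norm_nonneg v])]
      simp
  · exact ((integrable_indicator_iff measurableSet_ball).2
      (integrableOn_const (measure_ball_lt_top.ne))).integrableOn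
  · refine Eventually.of_forall fun x => ?_
    have hline : HasDerivAt (fun t : ℝ => ψ (x - t • v)) (fderiv ℝ ψ x (-v)) 0 := by
      have h1 : HasDerivAt (fun t : ℝ => x - t • v) (-v) 0 := by
        simpa using ((hasDerivAt_id (0 : ℝ)).smul_const v).const_sub x
      have h2 : HasFDerivAt ψ (fderiv ℝ ψ x) (x - (0 : ℝ) • v) := by
        rw [zero_smul, sub_zero]
        exact (hψ.differentiable one_ne_zero).differentiableAt.hasFDerivAt
      exact h2.comp_hasDerivAt (0 : ℝ) h1
    have h3 := hasDerivAt_iff_tendsto_slope_zero.1 hline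
    rw [map_neg] at h3
    simp only [zero_add, zero_smul, sub_zero, smul_eq_mul] at h3
    exact h3.mono_left (nhdsWithin_mono _ fun t ht => (ne_of_gt ht))

theorem volume_real_inter_ball_le_setIntegral {n : ℕ} {A : Set (Eu n)}
    {η : Eu n → ℝ} (hη : Integrable η) {r : ℝ} (h0 : ∀ x, 0 ≤ η x)
    (h1 : ∀ x ∈ ball (0 : Eu n) r, η x = 1) :
    volume.real (ball 0 r ∩ A) ≤ ∫ x in A, η x := by
  have e : volume.real (ball 0 r ∩ A) = ∫ x in A, (ball (0 : Eu n) r).indicator 1 x := by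
    rw [integral_indicator_one measurableSet_ball, Measure.real, Measure.real,
      Measure.restrict_apply measurableSet_ball]
  rw [e]
  refine setIntegral_mono ?_ hη.integrableOn fun x => ?_
  · exact ((integrable_indicator_iff measurableSet_ball).2
      (integrableOn_const (measure_ball_lt_top.ne))).integrableOn
  · by_cases hx : x ∈ ball (0 : Eu n) r
    · rw [indicator_of_mem hx, h1 x hx]; rfl
    · rw [indicator_of_notMem hx]; exact h0 x

theorem setIntegral_le_volume_real_inter_ball {n : ℕ} {A : Set (Eu n)}
    {η : Eu n → ℝ} (hη : Integrable η) {r : ℝ} (h0 : ∀ x, η x ≤ 1)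
    (h1 : ∀ x ∉ ball (0 : Eu n) r, η x = 0) :
    ∫ x in A, η x ≤ volume.real (ball 0 r ∩ A) := by
  have e : volume.real (ball 0 r ∩ A) = ∫ x in A, (ball (0 : Eu n) r).indicator 1 x := by
    rw [integral_indicator_one measurableSet_ball, Measure.real, Measure.real,
      Measure.restrict_apply measurableSet_ball]
  rw [e]
  refine setIntegral_mono hη.integrableOn ?_ fun x => ?_
  · exact ((integrable_indicator_iff measurableSet_ball).2
      (integrableOn_const (measure_ball_lt_top.ne))).integrableOn
  · by_cases hx : x ∈ ball (0 : Eu n) r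
    · rw [indicator_of_mem hx]; exact h0 x
    · rw [indicator_of_notMem hx, h1 x hx]

/-- There is a direction in which a set with small products has small total variation. -/
theorem SmallProduct.exists_direction {E : Set (Eu 2)} (hE : MeasurableSet E) {W : ℝ} (hW : 0 < W)
    (h : SmallProduct E (3 / 2) W) : ∃ v : Eu 2, ‖v‖ = 1 ∧
      ∀ᶠ t in 𝓝[>] (0 : ℝ), volume (diffSet E (t • v) (29 / 20)) ≤ ENNReal.ofReal (3 * W * t) := by
  obtain ⟨C, hC, hcut⟩ := exists_cutoff 2
  obtain ⟨η, hη, hηc, hηs, hη01, hη1, -⟩ := hcut (29 / 20) (3 / 2) (by norm_num) (by norm_num)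
  have hη0 : ∀ x ∉ ball (0 : Eu 2) (3 / 2), η x = 0 := fun x hx =>
    image_eq_zero_of_notMem_tsupport fun hx' => hx (hηs hx')
  have hηi : Integrable η := hη.continuous.integrable_of_hasCompactSupport hηc
  have hη1' : ContDiff ℝ 1 η := hη.of_le (by exact_mod_cast (le_top : (1 : WithTop ℕ) ≤ ⊤))
  have hdi : Integrable (fun x => fderiv ℝ η x) :=
    (hη1'.continuous_fderiv one_ne_zero).integrable_of_hasCompactSupport (hηc.fderiv ℝ)
  -- A linear functional on the plane has a nontrivial kernel. In this direction the weighted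
  -- entering and leaving volumes differ by o(t).
  obtain ⟨v, hv, hv0⟩ : ∃ v : Eu 2, ‖v‖ = 1 ∧ ∫ x in E, fderiv ℝ η x v = 0 := by
    set ℓ : Eu 2 →L[ℝ] ℝ := ∫ x in E, fderiv ℝ η x with hℓ
    have hker : LinearMap.ker (ℓ : Eu 2 →ₗ[ℝ] ℝ) ≠ ⊥ :=
      LinearMap.ker_ne_bot_of_finrank_lt (by simp)
    obtain ⟨u, hu, hu0⟩ := Submodule.exists_mem_ne_zero_of_ne_bot hker
    have hn : 0 < ‖u‖ := norm_pos_iff.2 hu0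
    refine ⟨‖u‖⁻¹ • u, by rw [norm_smul, norm_inv, norm_norm, inv_mul_cancel₀ hn.ne'], ?_⟩
    rw [← ContinuousLinearMap.integral_apply hdi.integrableOn]
    have : ℓ u = 0 := hu
    rw [← hℓ, map_smul, this, smul_zero]
  refine ⟨v, hv, ?_⟩
  have hlim := tendsto_setIntegral_slope E hη1' hηc v
  rw [hv0, neg_zero] at hlim
  filter_upwards [h v hv, self_mem_nhdsWithin,
    (tendsto_order.1 hlim).1 (-W) (by linarith), (tendsto_order.1 hlim).2 W hW] with t ht ht0 hl hu
  have ht0' : 0 < t := ht0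
  have hF : MeasurableSet {x | x + t • v ∈ E} := (measurable_id.add_const (t • v)) hE
  rw [setIntegral_translate_sub hE hηi] at hl hu
  have eIn : ∀ r, ball 0 r ∩ ({x | x + t • v ∈ E} \ E) = inSet E (t • v) r := by
    intro r; ext x; simp only [inSet, mem_inter_iff, Set.mem_sdiff, mem_ofPred_eq]; tauto
  have eOut : ∀ r, ball 0 r ∩ (E \ {x | x + t • v ∈ E}) = outSet E (t • v) r := by
    intro r; ext x; simp only [outSet, mem_inter_iff, Set.mem_sdiff, mem_ofPred_eq]
  have a1 := volume_real_inter_ball_le_setIntegral (A := {x | x + t • v ∈ E} \ E) hηi (fun x => (hη01 x).1) hη1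
  have a2 := volume_real_inter_ball_le_setIntegral (A := E \ {x | x + t • v ∈ E}) hηi (fun x => (hη01 x).1) hη1
  have b1 := setIntegral_le_volume_real_inter_ball (A := {x | x + t • v ∈ E} \ E) hηi
    (fun x => (hη01 x).2) hη0
  have b2 := setIntegral_le_volume_real_inter_ball (A := E \ {x | x + t • v ∈ E}) hηi
    (fun x => (hη01 x).2) hη0
  rw [eIn] at a1 b1
  rw [eOut] at a2 b2
  set J1 := ∫ x in {x | x + t • v ∈ E} \ E, η x
  set J2 := ∫ x in E \ {x | x + t • v ∈ E}, η x
  rw [lt_inv_mul_iff₀ ht0'] at hl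
  rw [inv_mul_lt_iff₀ ht0'] at hu
  rw [← ENNReal.ofReal_toReal (volume_diffSet_ne_top E (t • v) (29 / 20))]
  apply ENNReal.ofReal_le_ofReal
  have h2 := volume_real_diffSet hE (t • v) (29 / 20)
  rw [Measure.real] at h2
  rw [h2]
  -- One weighted volume is at most Wt, and the other is then at most 2Wt.
  rcases min_le_of_mul_le_sq (mul_nonneg hW.le ht0'.le) ht with h3 | h3 <;> linarith

theorem sq_add_sq_eq_one_of_norm_eq_one {v : Eu 2} (hv : ‖v‖ = 1) : v 0 ^ 2 + v 1 ^ 2 = 1 := by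
  have := EuclideanSpace.norm_sq_eq v
  rw [hv] at this
  simpa using this.symm

/-- The rotation of the plane carrying the unit vector `v` to the first basis vector. -/
theorem exists_rotation {v : Eu 2} (hv : ‖v‖ = 1) : ∃ U : Eu 2 ≃ₗᵢ[ℝ] Eu 2, IsRotation U ∧
    U.symm !₂[1, 0] = v ∧ U.symm !₂[0, 1] = !₂[-v 1, v 0] := by
  have h1 := sq_add_sq_eq_one_of_norm_eq_one hv
  let f : Eu 2 ≃ₗ[ℝ] Eu 2 :=
    { toFun := fun x => !₂[v 0 * x 0 + v 1 * x 1, -v 1 * x 0 + v 0 * x 1]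
      invFun := fun y => !₂[v 0 * y 0 - v 1 * y 1, v 1 * y 0 + v 0 * y 1]
      map_add' := fun x y => by ext i; fin_cases i <;> simp <;> ring
      map_smul' := fun c x => by ext i; fin_cases i <;> simp <;> ring
      left_inv := fun x => by
        ext i; fin_cases i <;> simp
        · linear_combination (x 0) * h1
        · linear_combination (x 1) * h1
      right_inv := fun x => by
        ext i; fin_cases i <;> simp
        · linear_combination (x 0) * h1
        · linear_combination (x 1) * h1 }
  have hnorm : ∀ x, ‖f x‖ = ‖x‖ := by
    intro x
    rw [← sq_eq_sq₀ (norm_nonneg _) (norm_nonneg _), EuclideanSpace.norm_sq_eq,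
      EuclideanSpace.norm_sq_eq]
    simp [f]
    linear_combination (x 0 ^ 2 + x 1 ^ 2) * h1
  refine ⟨⟨f, hnorm⟩, ?_, ?_, ?_⟩
  · change LinearMap.det (f : Eu 2 →ₗ[ℝ] Eu 2) = 1
    rw [← LinearMap.det_toMatrix (EuclideanSpace.basisFun (Fin 2) ℝ).toBasis, Matrix.det_fin_two]
    simp [LinearMap.toMatrix_apply, f]
    linear_combination h1
  · change f.symm _ = _
    ext i; fin_cases i <;> simp [f]
  · change f.symm _ = _
    ext i; fin_cases i <;> simp [f]

theorem inSet_image {n : ℕ} (U : Eu n ≃ₗᵢ[ℝ] Eu n) (E : Set (Eu n)) (w : Eu n) (r : ℝ) :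
    inSet (U '' E) w r = U.symm ⁻¹' inSet E (U.symm w) r := by
  have : U '' E = U.symm ⁻¹' E := U.toEquiv.image_eq_preimage_symm E
  rw [this]
  ext x
  simp only [inSet, mem_preimage, mem_ofPred_eq, map_add, mem_ball_zero_iff,
    LinearIsometryEquiv.norm_map]

theorem outSet_image {n : ℕ} (U : Eu n ≃ₗᵢ[ℝ] Eu n) (E : Set (Eu n)) (w : Eu n) (r : ℝ) :
    outSet (U '' E) w r = U.symm ⁻¹' outSet E (U.symm w) r := by
  have : U '' E = U.symm ⁻¹' E := U.toEquiv.image_eq_preimage_symm E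
  rw [this]
  ext x
  simp only [outSet, mem_preimage, mem_ofPred_eq, map_add, mem_ball_zero_iff,
    LinearIsometryEquiv.norm_map]

theorem measurableSet_image_isometry {n : ℕ} (U : Eu n ≃ₗᵢ[ℝ] Eu n) {E : Set (Eu n)}
    (hE : MeasurableSet E) : MeasurableSet (U '' E) := by
  rw [show U '' E = U.symm ⁻¹' E from U.toEquiv.image_eq_preimage_symm E]
  exact U.symm.continuous.measurable hE

theorem volume_inSet_image {n : ℕ} (U : Eu n ≃ₗᵢ[ℝ] Eu n) {E : Set (Eu n)} (hE : MeasurableSet E)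
    (w : Eu n) (r : ℝ) :
    volume (inSet (U '' E) w r) = volume (inSet E (U.symm w) r) := by
  rw [inSet_image, U.symm.measurePreserving.measure_preimage
    (measurableSet_inSet hE _ r).nullMeasurableSet]

theorem volume_outSet_image {n : ℕ} (U : Eu n ≃ₗᵢ[ℝ] Eu n) {E : Set (Eu n)} (hE : MeasurableSet E)
    (w : Eu n) (r : ℝ) :
    volume (outSet (U '' E) w r) = volume (outSet E (U.symm w) r) := by
  rw [outSet_image, U.symm.measurePreserving.measure_preimage
    (measurableSet_outSet hE _ r).nullMeasurableSet]

/-- Reversing the translation exchanges entering and leaving, with base points shifted by w. -/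
theorem volume_inSet_neg_le {n : ℕ} (E : Set (Eu n)) {w : Eu n} {r r' : ℝ} (h : r + ‖w‖ ≤ r') :
    volume (inSet E (-w) r) ≤ volume (outSet E w r') := by
  have hsub : inSet E (-w) r ⊆ (fun x => x + -w) ⁻¹' outSet E w r' := by
    rintro x ⟨h1, h2, h3⟩
    refine ⟨?_, h3, by simpa using h2⟩
    rw [mem_ball_zero_iff] at h1 ⊢
    have := norm_add_le x (-w)
    rw [norm_neg] at this
    linarith
  refine (measure_mono hsub).trans (le_of_eq ?_)
  rw [measure_preimage_add_right]

theorem volume_diffSet_neg_le {n : ℕ} (E : Set (Eu n)) {w : Eu n} {r r' : ℝ} (h : r + ‖w‖ ≤ r') :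
    volume (diffSet E (-w) r) ≤ volume (diffSet E w r') := by
  have hsub : diffSet E (-w) r ⊆ (fun x => x + -w) ⁻¹' diffSet E w r' := by
    rintro x ⟨h1, h2⟩
    refine ⟨?_, fun hh => h2 ?_⟩
    · rw [mem_ball_zero_iff] at h1 ⊢
      have := norm_add_le x (-w)
      rw [norm_neg] at this
      linarith
    · simp only [neg_add_cancel_right] at hh
      exact hh.symm
  refine (measure_mono hsub).trans (le_of_eq ?_)
  rw [measure_preimage_add_right]

/-- After a rotation, a set with small products has small horizontal variation and is rarely
entered vertically. -/
theorem SmallProduct.exists_rotation {E : Set (Eu 2)} (hE : MeasurableSet E) {W : ℝ} (hW : 0 < W)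
    (h : SmallProduct E (3 / 2) W) : ∃ U : Eu 2 ≃ₗᵢ[ℝ] Eu 2, IsRotation U ∧
      (∀ᶠ t in 𝓝[>] (0 : ℝ), volume (diffSet (U '' E) (t • (!₂[1, 0] : Eu 2)) (36 / 25)) ≤
        ENNReal.ofReal (3 * W * t)) ∧
      ∃ᶠ t in 𝓝[>] (0 : ℝ), volume (inSet (U '' E) (t • (!₂[0, 1] : Eu 2)) (36 / 25)) ≤
        ENNReal.ofReal (W * t) := by
  obtain ⟨v, hv, hdiff⟩ := h.exists_direction hE hW
  set w : Eu 2 := !₂[-v 1, v 0] with hw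
  have hwn : ‖w‖ = 1 := by
    rw [← sq_eq_sq₀ (norm_nonneg _) zero_le_one, EuclideanSpace.norm_sq_eq]
    have := sq_add_sq_eq_one_of_norm_eq_one hv
    simp [hw]; linarith
  have hsmall : ∀ᶠ t in 𝓝[>] (0 : ℝ), t ∈ Ioo (0 : ℝ) (1 / 100) :=
    Ioo_mem_nhdsGT (by norm_num)
  -- Which volume is small may depend on t, so one alternative is secured only along a sequence of
  -- times.
  have hor : ∃ᶠ t in 𝓝[>] (0 : ℝ), volume.real (inSet E (t • w) (3 / 2)) ≤ W * t ∨
      volume.real (outSet E (t • w) (3 / 2)) ≤ W * t := by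
    refine Eventually.frequently ?_
    filter_upwards [h w hwn, hsmall] with t ht ht0
    exact min_le_of_mul_le_sq (mul_nonneg hW.le ht0.1.le) ht
  have htr : ∀ {A : Set (Eu 2)} {a : ℝ}, volume A ≠ ⊤ → volume.real A ≤ a →
      volume A ≤ ENNReal.ofReal a := fun hA h => by
    rw [← ENNReal.ofReal_toReal hA]; exact ENNReal.ofReal_le_ofReal h
  rw [frequently_or_distrib] at hor
  rcases hor with hor | hor
  · obtain ⟨U, hU, hU1, hU2⟩ := NonlocalPerimeter.exists_rotation hv
    refine ⟨U, hU, ?_, ?_⟩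
    · filter_upwards [hdiff] with t ht
      rw [volume_diffSet (measurableSet_image_isometry U hE), volume_inSet_image U hE,
        volume_outSet_image U hE, map_smul, hU1, ← volume_diffSet hE]
      exact (measure_mono (diffSet_mono E _ (by norm_num))).trans ht
    · refine hor.mono fun t ht => ?_
      rw [volume_inSet_image U hE, map_smul, hU2]
      refine (measure_mono ?_).trans (htr (volume_inSet_ne_top _ _ _) ht)
      exact fun x hx => ⟨ball_subset_ball (by norm_num) hx.1, hx.2⟩
  -- Leaving is the small one here: a further half-turn reverses both axes and makes it entering.
  -- The radius drops from 29/20 to 36/25 to absorb shifts shorter than 1/100.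
  · obtain ⟨U, hU, hU1, hU2⟩ := NonlocalPerimeter.exists_rotation (v := -v) (by rwa [norm_neg])
    have hU2' : U.symm !₂[0, 1] = -w := by
      rw [hU2, hw]; ext i; fin_cases i <;> simp
    refine ⟨U, hU, ?_, ?_⟩
    · filter_upwards [hdiff, hsmall] with t ht ht0
      rw [volume_diffSet (measurableSet_image_isometry U hE), volume_inSet_image U hE,
        volume_outSet_image U hE, map_smul, hU1, ← volume_diffSet hE, smul_neg]
      refine (volume_diffSet_neg_le E ?_).trans ht
      rw [norm_smul, hv, mul_one, Real.norm_eq_abs, abs_of_pos ht0.1]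
      linarith [ht0.2]
    · refine (hor.and_eventually hsmall).mono fun t ht => ?_
      rw [volume_inSet_image U hE, map_smul, hU2', smul_neg]
      refine (volume_inSet_neg_le E ?_).trans (htr (volume_outSet_ne_top _ _ _) ht.1)
      rw [norm_smul, hwn, mul_one, Real.norm_eq_abs, abs_of_pos ht.2.1]
      linarith [ht.2.2]

/-! ### Flatness in the unit disc -/

theorem measurePreserving_vec2 : MeasurePreserving (fun p : ℝ × ℝ => (!₂[p.1, p.2] : Eu 2)) :=
  (PiLp.volume_preserving_toLp (Fin 2)).comp
    ((volume_preserving_finTwoArrow ℝ).symm MeasurableEquiv.finTwoArrow)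

theorem volume_eq_volume_prod {T : Set (Eu 2)} (hT : MeasurableSet T) :
    volume T = volume {p : ℝ × ℝ | (!₂[p.1, p.2] : Eu 2) ∈ T} :=
  (measurePreserving_vec2.measure_preimage hT.nullMeasurableSet).symm

theorem coord_mem_Ioo {x : Eu 2} (hx : x ∈ ball (0 : Eu 2) 1) (i : Fin 2) :
    x i ∈ Ioo (-1 : ℝ) 1 := by
  rw [mem_ball_zero_iff] at hx
  have := (PiLp.norm_apply_le x i).trans_lt hx
  rwa [Real.norm_eq_abs, abs_lt] at this

/-- 36/25 exceeds √2, so the whole square used for slicing is covered. -/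
theorem mem_ball_of_coord {x : Eu 2} (h0 : x 0 ∈ Ioo (-1 : ℝ) 1) (h1 : x 1 ∈ Ioo (-1 : ℝ) 1) :
    x ∈ ball (0 : Eu 2) (36 / 25) := by
  rw [mem_ball_zero_iff, ← sq_lt_sq₀ (norm_nonneg _) (by norm_num), EuclideanSpace.norm_sq_eq]
  simp only [Fin.sum_univ_two, Real.norm_eq_abs, sq_abs]
  nlinarith [h0.1, h0.2, h1.1, h1.2]

/-- The planar version of `exists_graph_of_small_variation`. -/
theorem exists_graph {S : Set (Eu 2)} (hS : MeasurableSet S) {W : ℝ} (hW : 0 < W)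
    (hh : ∀ᶠ t in 𝓝[>] (0 : ℝ), volume (diffSet S (t • (!₂[1, 0] : Eu 2)) (36 / 25)) ≤
      ENNReal.ofReal (3 * W * t))
    (hv : ∃ᶠ t in 𝓝[>] (0 : ℝ), volume (inSet S (t • (!₂[0, 1] : Eu 2)) (36 / 25)) ≤
      ENNReal.ofReal (W * t)) :
    ∃ (bad : Set ℝ) (g : ℝ → ℝ), bad ⊆ Ioo (-1) 1 ∧ MeasurableSet bad ∧
      volume bad ≤ ENNReal.ofReal W ∧ Measurable g ∧ (∀ y, g y ∈ Icc (-1 : ℝ) 1) ∧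
      (∀ y ∈ Ioo (-1 : ℝ) 1 \ bad, ∀ y' ∈ Ioo (-1 : ℝ) 1 \ bad, |g y - g y'| ≤ 3 * W) ∧
      volume {x : Eu 2 | (x 0 ∈ Ioo (-1 : ℝ) 1 \ bad ∧ x 1 ∈ Ioo (-1 : ℝ) 1) ∧
        ¬(x ∈ S ↔ x 1 ≤ g (x 0))} = 0 := by
  obtain ⟨t, ht, htp⟩ := exists_seq_forall_of_frequently
    (hv.and_eventually (hh.and (self_mem_nhdsWithin : ∀ᶠ t in 𝓝[>] (0 : ℝ), t ∈ Ioi (0 : ℝ))))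
  have hS' : MeasurableSet {p : ℝ × ℝ | (!₂[p.1, p.2] : Eu 2) ∈ S} :=
    measurePreserving_vec2.measurable hS
  have key : ∀ {T : Set (ℝ × ℝ)} {D : Set (Eu 2)}, MeasurableSet D →
      T ⊆ {p : ℝ × ℝ | (!₂[p.1, p.2] : Eu 2) ∈ D} → volume T ≤ volume D := fun hD h => by
    rw [volume_eq_volume_prod hD]; exact measure_mono h
  have hball : ∀ {p : ℝ × ℝ}, p.1 ∈ Ioo (-1 : ℝ) 1 → p.2 ∈ Ioo (-1 : ℝ) 1 →
      (!₂[p.1, p.2] : Eu 2) ∈ ball (0 : Eu 2) (36 / 25) := fun h0 h1 =>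
    mem_ball_of_coord (by simpa using h0) (by simpa using h1)
  have e0 : ∀ (p : ℝ × ℝ) (t : ℝ), (!₂[p.1, p.2] : Eu 2) + t • !₂[1, 0] = !₂[p.1 + t, p.2] := by
    intro p t; ext i; fin_cases i <;> simp
  have e1 : ∀ (p : ℝ × ℝ) (t : ℝ), (!₂[p.1, p.2] : Eu 2) + t • !₂[0, 1] = !₂[p.1, p.2 + t] := by
    intro p t; ext i; fin_cases i <;> simp
  obtain ⟨bad, g, h1, h2, h3, h4, h5, h6, h7⟩ := exists_graph_of_small_variation hS'
    (fun n => (htp n).2.2) (ht.mono_right nhdsWithin_le_nhds) (W := W) (c := 3 * W) (by positivity)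
    (fun n => (key (measurableSet_inSet hS _ _) fun p hp =>
      ⟨hball hp.1 hp.2.1, hp.2.2.1, by rw [e1]; exact hp.2.2.2⟩).trans (htp n).1)
    (fun n => (key (measurableSet_diffSet hS _ _) fun p hp =>
      ⟨hball hp.1 hp.2.1, by rw [e0]; exact hp.2.2⟩).trans (htp n).2.1)
  refine ⟨bad, g, h1, h2, h3, h4, h5, h6, ?_⟩
  have c0 : Measurable fun x : Eu 2 => x 0 := by fun_prop
  have c1 : Measurable fun x : Eu 2 => x 1 := by fun_prop
  have mG : MeasurableSet {x : Eu 2 | x 1 ≤ g (x 0)} := measurableSet_le c1 (h4.comp c0)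
  have mN : MeasurableSet {x : Eu 2 | (x 0 ∈ Ioo (-1 : ℝ) 1 \ bad ∧ x 1 ∈ Ioo (-1 : ℝ) 1) ∧
      ¬(x ∈ S ↔ x 1 ≤ g (x 0))} :=
    ((c0 (measurableSet_Ioo.diff h2)).inter (c1 measurableSet_Ioo)).inter
      ((MeasurableSet.iff hS mG).compl)
  rw [volume_eq_volume_prod mN, Measure.volume_eq_prod]
  refine (Measure.measure_prod_null (measurePreserving_vec2.measurable mN)).2 ?_
  refine Eventually.of_forall fun y => ?_
  by_cases hy : y ∈ Ioo (-1 : ℝ) 1 \ bad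
  · refine measure_mono_null ?_ (h7 y hy)
    intro z hz hz'
    exact hz.2 (hz' (by simpa using hz.1.2))
  · refine measure_mono_null (t := ∅) ?_ measure_empty
    intro z hz
    exact hy (by simpa using hz.1.1)

theorem volume_strip {a b : Set ℝ} (ha : MeasurableSet a) (hb : MeasurableSet b) :
    volume {x : Eu 2 | x 0 ∈ a ∧ x 1 ∈ b} = volume a * volume b := by
  have c0 : Measurable fun x : Eu 2 => x 0 := by fun_prop
  have c1 : Measurable fun x : Eu 2 => x 1 := by fun_prop
  refine (volume_eq_volume_prod ((c0 ha).inter (c1 hb))).trans ?_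
  rw [← Measure.prod_prod, ← Measure.volume_eq_prod]
  congr 1

theorem flatL1_of_small_variation {S : Set (Eu 2)} (hS : MeasurableSet S) {W : ℝ} (hW : 0 < W)
    (hh : ∀ᶠ t in 𝓝[>] (0 : ℝ), volume (diffSet S (t • (!₂[1, 0] : Eu 2)) (36 / 25)) ≤
      ENNReal.ofReal (3 * W * t))
    (hv : ∃ᶠ t in 𝓝[>] (0 : ℝ), volume (inSet S (t • (!₂[0, 1] : Eu 2)) (36 / 25)) ≤
      ENNReal.ofReal (W * t)) : FlatL1 (14 * W) S := by
  -- For W ≥ 1/2 the claim is trivial, as the disc has area π ≤ 7. Otherwise |bad| < 2, and a good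
  -- abscissa exists.
  rcases le_or_gt (1 / 2) W with hW2 | hW2
  · refine ⟨0, by norm_num, (measure_mono inter_subset_right).trans ?_⟩
    rw [EuclideanSpace.volume_ball_fin_two]
    simp only [ENNReal.ofReal_one, one_pow, one_mul]
    refine ENNReal.ofReal_le_ofReal ?_
    linarith [Real.pi_le_four]
  obtain ⟨bad, g, h1, h2, h3, h4, h5, h6, h7⟩ := exists_graph hS hW hh hv
  have hne : (Ioo (-1 : ℝ) 1 \ bad).Nonempty := by
    by_contra hcon
    rw [not_nonempty_iff_eq_empty, Set.sdiff_eq_empty] at hcon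
    have := (measure_mono hcon).trans h3
    rw [Real.volume_Ioo, ENNReal.ofReal_le_ofReal_iff hW.le] at this
    linarith
  obtain ⟨y₀, hy₀⟩ := hne
  refine ⟨g y₀, h5 y₀, ?_⟩
  -- A null set, the bad strips of area at most 2W, and a horizontal band of area 2 · 6W: this is
  -- where 14 comes from.
  have hsub : symmDiff S {x : Eu 2 | x 1 ≤ g y₀} ∩ ball 0 1 ⊆
      {x : Eu 2 | (x 0 ∈ Ioo (-1 : ℝ) 1 \ bad ∧ x 1 ∈ Ioo (-1 : ℝ) 1) ∧
        ¬(x ∈ S ↔ x 1 ≤ g (x 0))} ∪ ({x : Eu 2 | x 0 ∈ bad ∧ x 1 ∈ Ioo (-1 : ℝ) 1} ∪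
      {x : Eu 2 | x 0 ∈ Ioo (-1 : ℝ) 1 ∧ x 1 ∈ Icc (g y₀ - 3 * W) (g y₀ + 3 * W)}) := by
    rintro x ⟨hx, hxb⟩
    have hx0 := coord_mem_Ioo hxb 0
    have hx1 := coord_mem_Ioo hxb 1
    by_cases hb : x 0 ∈ bad
    · exact Or.inr (Or.inl ⟨hb, hx1⟩)
    by_cases hg : x ∈ S ↔ x 1 ≤ g (x 0)
    · refine Or.inr (Or.inr ⟨hx0, ?_⟩)
      have h := abs_le.1 (h6 (x 0) ⟨hx0, hb⟩ y₀ hy₀)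
      rcases hx with ⟨ha, hb'⟩ | ⟨ha, hb'⟩
      · have ha' := hg.1 ha
        have hb'' : g y₀ < x 1 := not_le.1 hb'
        constructor <;> linarith
      · have ha' : x 1 ≤ g y₀ := ha
        have hb'' := not_le.1 fun h => hb' (hg.2 h)
        constructor <;> linarith
    · exact Or.inl ⟨⟨⟨hx0, hb⟩, hx1⟩, hg⟩
  refine (measure_mono hsub).trans ((measure_union_le _ _).trans ?_)
  rw [h7, zero_add]
  refine (measure_union_le _ _).trans ?_
  rw [volume_strip h2 measurableSet_Ioo, volume_strip measurableSet_Ioo measurableSet_Icc,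
    Real.volume_Ioo, Real.volume_Icc]
  refine (add_le_add_left (mul_le_mul_left h3 _) _).trans ?_
  rw [← ENNReal.ofReal_mul hW.le, ← ENNReal.ofReal_mul (by norm_num),
    ← ENNReal.ofReal_add (by linarith) (by linarith)]
  exact ENNReal.ofReal_le_ofReal (by linarith)

theorem exists_graph_in_disc_of_small_variation {S : Set (Eu 2)} (hS : MeasurableSet S) {W : ℝ}
    (hW : 0 < W)
    (hh : ∀ᶠ t in 𝓝[>] (0 : ℝ), volume (diffSet S (t • (!₂[1, 0] : Eu 2)) (36 / 25)) ≤
      ENNReal.ofReal (3 * W * t))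
    (hv : ∃ᶠ t in 𝓝[>] (0 : ℝ), volume (inSet S (t • (!₂[0, 1] : Eu 2)) (36 / 25)) ≤
      ENNReal.ofReal (W * t)) :
    ∃ (bad : Set ℝ) (g : ℝ → ℝ), bad ⊆ Ioo (-1) 1 ∧ MeasurableSet bad ∧
      volume bad ≤ ENNReal.ofReal (14 * W) ∧ Measurable g ∧ (∀ y, g y ∈ Ioo (-1 : ℝ) 1) ∧
      (∀ y ∈ Ioo (-1 : ℝ) 1 \ bad, ∀ y' ∈ Ioo (-1 : ℝ) 1 \ bad, |g y - g y'| ≤ 14 * W) ∧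
      IsSubgraphOff S bad g := by
  rcases le_or_gt (1 / 2) W with hW2 | hW2
  · refine ⟨Ioo (-1) 1, fun _ => 0, Subset.rfl, measurableSet_Ioo, ?_, measurable_const,
      fun _ => by norm_num, fun y hy => (hy.2 hy.1).elim, ?_⟩
    · rw [Real.volume_Ioo]
      exact ENNReal.ofReal_le_ofReal (by linarith)
    · refine Eventually.of_forall fun x => propext ⟨fun h => ?_, fun h => ?_⟩
      · exact (h.2 (coord_mem_Ioo h.1.2 0)).elim
      · exact (h.2.1 (coord_mem_Ioo h.1 0)).elim
  obtain ⟨bad, g, h1, h2, h3, h4, h5, h6, h7⟩ := exists_graph hS hW hh hv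
  -- Truncating at ±k puts the values in the open interval. In the disc with |x₁| ≥ W one has x₂² <
  -- 1 - W² ≤ k², so off the extra strip (-W, W) the truncation changes nothing.
  set k : ℝ := 1 - W ^ 2 / 2 with hk
  have hk0 : 0 < k := by nlinarith
  have hk1 : k < 1 := by rw [hk]; nlinarith
  refine ⟨bad ∪ Ioo (-W) W, fun y => max (-k) (min k (g y)), ?_, h2.union measurableSet_Ioo, ?_,
    measurable_const.max (measurable_const.min h4), ?_, ?_, ?_⟩
  · exact union_subset h1 (Ioo_subset_Ioo (by linarith) (by linarith))
  · refine (measure_union_le _ _).trans ((add_le_add_left h3 _).trans ?_)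
    rw [Real.volume_Ioo, ← ENNReal.ofReal_add hW.le (by linarith)]
    exact ENNReal.ofReal_le_ofReal (by linarith)
  · intro y
    exact ⟨(by linarith : (-1 : ℝ) < -k).trans_le (le_max_left _ _),
      max_lt (by linarith) ((min_le_left _ _).trans_lt hk1)⟩
  · intro y hy y' hy'
    have h := h6 y ⟨hy.1, fun h => hy.2 (Or.inl h)⟩ y' ⟨hy'.1, fun h => hy'.2 (Or.inl h)⟩
    have hmax : |max (-k) (min k (g y)) - max (-k) (min k (g y'))| ≤
        |min k (g y) - min k (g y')| := by
      rw [max_comm (-k), max_comm (-k)]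
      exact abs_max_sub_max_le_abs _ _ _
    have hmin : |min k (g y) - min k (g y')| ≤ |g y - g y'| := by
      rw [min_comm k, min_comm k]
      exact abs_min_sub_min_le_max _ _ _ _ |>.trans (by simp)
    linarith
  · have hae : ∀ᵐ x : Eu 2, ¬((x 0 ∈ Ioo (-1 : ℝ) 1 \ bad ∧ x 1 ∈ Ioo (-1 : ℝ) 1) ∧
        ¬(x ∈ S ↔ x 1 ≤ g (x 0))) := measure_eq_zero_iff_ae_notMem.1 h7
    filter_upwards [hae] with x hx
    have key : x ∈ ball (0 : Eu 2) 1 → x 0 ∉ bad ∪ Ioo (-W) W →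
        (x ∈ S ↔ x 1 ≤ max (-k) (min k (g (x 0)))) := by
      intro hb hbad
      have hg := not_not.1 fun h => hx ⟨⟨⟨coord_mem_Ioo hb 0, fun h => hbad (Or.inl h)⟩,
        coord_mem_Ioo hb 1⟩, h⟩
      have hx0 : W ≤ |x 0| := by
        by_contra! h
        exact hbad (Or.inr (abs_lt.1 h))
      rw [mem_ball_zero_iff, ← sq_lt_sq₀ (norm_nonneg _) zero_le_one,
        EuclideanSpace.norm_sq_eq] at hb
      simp only [Fin.sum_univ_two, Real.norm_eq_abs] at hb
      have h1k : |x 1| < k := by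
        refine lt_of_pow_lt_pow_left₀ 2 hk0.le ?_
        nlinarith
      rw [abs_lt] at h1k
      rw [hg, le_max_iff, le_min_iff]
      constructor
      · exact fun h => Or.inr ⟨h1k.2.le, h⟩
      · rintro (h | h)
        · linarith [h1k.1]
        · exact h.2
    refine propext ⟨fun h => ⟨h.1.2, h.2, (key h.1.2 h.2).1 h.1.1⟩,
      fun h => ⟨⟨(key h.1 h.2.1).2 h.2.2, h.1⟩, h.2.1⟩⟩

/-! ### The perimeter of the vertical dilation -/

/-- The difference quotients converge, so a bound along some sequence of times suffices. This
matters because vertical smallness is known only frequently. -/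
theorem setIntegral_fderiv_le_of_frequently {n : ℕ} {S : Set (Eu n)} (hS : MeasurableSet S)
    {ψ : Eu n → ℝ} (hψ : ContDiff ℝ 1 ψ) (hc : HasCompactSupport ψ) {r : ℝ}
    (hs : tsupport ψ ⊆ ball 0 r) (h1 : ∀ x, |ψ x| ≤ 1) {v : Eu n} {M : ℝ}
    (hM : ∃ᶠ t in 𝓝[>] (0 : ℝ), volume.real (diffSet S (t • v) r) ≤ M * t) :
    ∫ x in S, fderiv ℝ ψ x v ≤ M := by
  have hlim := tendsto_setIntegral_slope S hψ hc v
  have hi : Integrable ψ := hψ.continuous.integrable_of_hasCompactSupport hc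
  have hψ0 : ∀ x ∉ ball (0 : Eu n) r, ψ x = 0 := fun x hx =>
    image_eq_zero_of_notMem_tsupport fun hx' => hx (hs hx')
  suffices -M ≤ -∫ x in S, fderiv ℝ ψ x v by linarith
  refine ge_of_tendsto_of_frequently hlim ((hM.and_eventually
    (self_mem_nhdsWithin : ∀ᶠ t in 𝓝[>] (0 : ℝ), t ∈ Ioi (0 : ℝ))).mono ?_)
  rintro t ⟨ht, ht0⟩
  have ht0' : 0 < t := ht0
  rw [setIntegral_translate_sub hS hi, le_inv_mul_iff₀ ht0']
  have a1 := setIntegral_le_volume_real_inter_ball (A := {x | x + t • v ∈ S} \ S) (r := r) hi.neg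
    (fun x => by simpa using (neg_le_abs _).trans (h1 x)) (fun x hx => by simp [hψ0 x hx])
  have a2 := setIntegral_le_volume_real_inter_ball (A := S \ {x | x + t • v ∈ S}) (r := r) hi
    (fun x => (le_abs_self _).trans (h1 x)) hψ0
  have e1 : ball 0 r ∩ ({x | x + t • v ∈ S} \ S) = inSet S (t • v) r := by
    ext x; simp only [inSet, mem_inter_iff, Set.mem_sdiff, mem_ofPred_eq]; tauto
  have e2 : ball 0 r ∩ (S \ {x | x + t • v ∈ S}) = outSet S (t • v) r := by
    ext x; simp only [outSet, mem_inter_iff, Set.mem_sdiff, mem_ofPred_eq]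
  rw [e1] at a1
  rw [e2] at a2
  simp only [Pi.neg_apply, integral_neg] at a1
  have := volume_real_diffSet hS (t • v) r
  linarith

/-- The vertical dilation as a linear automorphism. -/
noncomputable def dilation (ε : ℝ) (hε : ε ≠ 0) : Eu 2 ≃L[ℝ] Eu 2 :=
  LinearEquiv.toContinuousLinearEquiv
    { toFun := fun x => !₂[x 0, x 1 / ε]
      invFun := fun x => !₂[x 0, ε * x 1]
      map_add' := fun x y => by ext i; fin_cases i <;> simp; ring
      map_smul' := fun c x => by ext i; fin_cases i <;> simp; ring
      left_inv := fun x => by ext i; fin_cases i <;> simp; field_simp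
      right_inv := fun x => by ext i; fin_cases i <;> simp; field_simp }

theorem dilation_apply (ε : ℝ) (hε : ε ≠ 0) (x : Eu 2) : dilation ε hε x = !₂[x 0, x 1 / ε] := rfl

theorem map_dilation {ε : ℝ} (hε : 0 < ε) :
    Measure.map (dilation ε hε.ne') volume = ENNReal.ofReal ε • (volume : Measure (Eu 2)) := by
  have hdet : LinearMap.det ((dilation ε hε.ne' : Eu 2 →L[ℝ] Eu 2) : Eu 2 →ₗ[ℝ] Eu 2) = ε⁻¹ := by
    rw [← LinearMap.det_toMatrix (EuclideanSpace.basisFun (Fin 2) ℝ).toBasis, Matrix.det_fin_two]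
    simp [LinearMap.toMatrix_apply, dilation_apply]
  have := Measure.map_linearMap_addHaar_eq_smul_addHaar (volume : Measure (Eu 2))
    (f := ((dilation ε hε.ne' : Eu 2 →L[ℝ] Eu 2) : Eu 2 →ₗ[ℝ] Eu 2)) (by rw [hdet]; positivity)
  rw [hdet, inv_inv, abs_of_pos hε] at this
  exact this

theorem setIntegral_vertDilate {ε : ℝ} (hε : 0 < ε) (A : Set (Eu 2)) (f : Eu 2 → ℝ) :
    ε * ∫ y in vertDilate ε A, f y = ∫ x in A, f (dilation ε hε.ne' x) := by
  have h := setIntegral_map_equiv (μ := (volume : Measure (Eu 2)))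
    (dilation ε hε.ne').toHomeomorph.toMeasurableEquiv f (vertDilate ε A)
  have e : (dilation ε hε.ne').toHomeomorph.toMeasurableEquiv ⁻¹' vertDilate ε A = A :=
    preimage_image_eq A (dilation ε hε.ne').injective
  rw [e] at h
  refine Eq.trans ?_ h
  change _ = ∫ y in vertDilate ε A, f y ∂(Measure.map (dilation ε hε.ne') volume)
  rw [map_dilation hε, Measure.restrict_smul, integral_smul_measure, ENNReal.toReal_ofReal hε.le,
    smul_eq_mul]

/-- The perimeter of a vertical dilation is controlled by the directional variations. -/
theorem classicalPer_vertDilate_le {S S' : Set (Eu 2)} (hS : MeasurableSet S)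
    (hSS : S' =ᵐ[volume] S) {r ε M₀ M₁ : ℝ} (hr : 1 ≤ r) (hε : 0 < ε)
    (h0 : ∃ᶠ t in 𝓝[>] (0 : ℝ), volume.real (diffSet S (t • (!₂[1, 0] : Eu 2)) r) ≤ M₀ * t)
    (h1 : ∃ᶠ t in 𝓝[>] (0 : ℝ), volume.real (diffSet S (t • (!₂[0, 1] : Eu 2)) r) ≤ M₁ * t) :
    classicalPer (vertDilate ε (ball 0 1)) (vertDilate ε S') ≤
      ENNReal.ofReal (M₀ / ε + M₁) := by
  refine iSup_le ?_
  rintro ⟨φ, hφ, hφc, hφs, hφ1⟩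
  refine ENNReal.ofReal_le_ofReal ?_
  set D := dilation ε hε.ne' with hD
  have hDi : vertDilate ε S' ∩ vertDilate ε (ball 0 1) = vertDilate ε (S' ∩ ball 0 1) :=
    (image_inter D.injective).symm
  set ψ : Fin 2 → Eu 2 → ℝ := fun i x => φ (D x) i with hψ
  have hψd : ∀ i, ContDiff ℝ 1 (ψ i) := by
    intro i
    have : ContDiff ℝ 1 fun x => φ (D x) := hφ.comp D.contDiff
    exact (contDiff_euclidean.1 this) i
  have hts : ∀ i, tsupport (ψ i) ⊆ D ⁻¹' tsupport φ := by
    intro i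
    refine closure_minimal ?_ ((isClosed_tsupport φ).preimage D.continuous)
    intro x hx
    refine subset_tsupport φ fun h0 => hx ?_
    change φ (D x) i = 0
    rw [h0]; rfl
  have hcK : IsCompact (D ⁻¹' tsupport φ) := D.toHomeomorph.isCompact_preimage.2 hφc
  have hψc : ∀ i, HasCompactSupport (ψ i) := fun i =>
    hcK.of_isClosed_subset (isClosed_tsupport _) (hts i)
  have hψs : ∀ i, tsupport (ψ i) ⊆ ball 0 1 := by
    intro i x hx
    obtain ⟨y, hy, hyx⟩ := hφs (hts i hx)
    rwa [D.injective hyx] at hy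
  have hψ1 : ∀ i x, |ψ i x| ≤ 1 := fun i x =>
    (Real.norm_eq_abs _ ▸ PiLp.norm_apply_le (φ (D x)) i).trans (hφ1 _)
  have hfd : ∀ i x v, fderiv ℝ (ψ i) x v = (fderiv ℝ φ (D x) (D v)) i := by
    intro i x v
    have hd : HasFDerivAt φ (fderiv ℝ φ (D x)) (D x) :=
      (hφ.differentiable one_ne_zero (D x)).hasFDerivAt
    have h2 := hd.comp x D.hasFDerivAt
    have h3 := (EuclideanSpace.proj (𝕜 := ℝ) i : Eu 2 →L[ℝ] ℝ).hasFDerivAt.comp x h2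
    have h4 : fderiv ℝ (ψ i) x = _ := h3.fderiv
    rw [h4]
    rfl
  -- In the original coordinates only the vertical derivative acquires the factor ε, and the
  -- Jacobian contributes another ε to the integral. Hence M₀ is divided by ε and M₁ is not.
  have hdiv : ∀ x, divergence φ (D x) =
      fderiv ℝ (ψ 0) x !₂[1, 0] + ε * fderiv ℝ (ψ 1) x !₂[0, 1] := by
    intro x
    have e0 : D !₂[1, 0] = EuclideanSpace.single 0 1 := by
      ext i; fin_cases i <;> simp [hD, dilation_apply]
    have e1 : D !₂[0, 1] = ε⁻¹ • EuclideanSpace.single 1 1 := by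
      ext i; fin_cases i <;> simp [hD, dilation_apply]
    rw [hfd, hfd, e0, e1, divergence, Fin.sum_univ_two, map_smul]
    simp only [PiLp.smul_apply, smul_eq_mul]
    field_simp
  have hint : ∀ i v, Integrable fun x => fderiv ℝ (ψ i) x v := by
    intro i v
    have : Continuous fun x => fderiv ℝ (ψ i) x v :=
      ((hψd i).continuous_fderiv one_ne_zero).clm_apply continuous_const
    refine this.integrable_of_hasCompactSupport ?_
    exact ((hψc i).fderiv_apply ℝ v)
  have hball : ∀ i v, ∫ x in S' ∩ ball 0 1, fderiv ℝ (ψ i) x v = ∫ x in S, fderiv ℝ (ψ i) x v := by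
    intro i v
    rw [setIntegral_congr_set (hSS.inter (ae_eq_refl (ball (0 : Eu 2) 1)))]
    refine (setIntegral_eq_of_subset_of_forall_sdiff_eq_zero hS inter_subset_left ?_).symm
    intro x hx
    have hx' : x ∉ tsupport (ψ i) := fun h => hx.2 ⟨hx.1, hψs i h⟩
    have h0 : ψ i =ᶠ[𝓝 x] 0 := notMem_tsupport_iff_eventuallyEq.1 hx'
    rw [h0.fderiv_eq]
    simp
  have hr' : ball (0 : Eu 2) 1 ⊆ ball 0 r := ball_subset_ball hr
  have b0 := setIntegral_fderiv_le_of_frequently hS (hψd 0) (hψc 0) ((hψs 0).trans hr') (hψ1 0) h0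
  have b1 := setIntegral_fderiv_le_of_frequently hS (hψd 1) (hψc 1) ((hψs 1).trans hr') (hψ1 1) h1
  have hcv := setIntegral_vertDilate hε (S' ∩ ball 0 1) (divergence φ)
  rw [← hD] at hcv
  simp_rw [hdiv] at hcv
  rw [integral_add (hint 0 _).integrableOn ((hint 1 _).integrableOn.const_mul _),
    integral_const_mul, hball, hball] at hcv
  change ∫ x in vertDilate ε S' ∩ vertDilate ε (ball 0 1), divergence φ x ≤ _
  rw [hDi]
  have : ε * ∫ x in vertDilate ε (S' ∩ ball 0 1), divergence φ x ≤ ε * (M₀ / ε + M₁) := by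
    rw [hcv, mul_add, mul_div_cancel₀ _ hε.ne']
    exact add_le_add b0 (mul_le_mul_of_nonneg_left b1 hε.le)
  exact le_of_mul_le_mul_left this hε

theorem flatPer_of_small_variation {S S' : Set (Eu 2)} (hS : MeasurableSet S)
    (hSS : S' =ᵐ[volume] S) {W : ℝ} (hW : 0 < W)
    (hh : ∀ᶠ t in 𝓝[>] (0 : ℝ), volume (diffSet S (t • (!₂[1, 0] : Eu 2)) (36 / 25)) ≤
      ENNReal.ofReal (3 * W * t))
    (hv : ∃ᶠ t in 𝓝[>] (0 : ℝ), volume (inSet S (t • (!₂[0, 1] : Eu 2)) (36 / 25)) ≤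
      ENNReal.ofReal (W * t)) : FlatPer (20 * (1 + 14 * W)) (14 * W) S' := by
  have hsmall : ∀ᶠ t in 𝓝[>] (0 : ℝ), t ∈ Ioo (0 : ℝ) 1 := Ioo_mem_nhdsGT (by norm_num)
  have hn : ‖(!₂[0, 1] : Eu 2)‖ = 1 := by simp [EuclideanSpace.norm_eq]
  -- Vertically, entering is at most Wt and leaving exceeds it by at most 3π(36/25)t < 18t. With ε =
  -- 14W the horizontal part is 3/14, so the total is below 20(1 + 14W).
  refine (classicalPer_vertDilate_le (r := 36 / 25) (M₀ := 3 * W) (M₁ := 2 * W + 18) hS hSS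
    (by norm_num) (by positivity) ?_ ?_).trans (ENNReal.ofReal_le_ofReal ?_)
  · refine Eventually.frequently ?_
    filter_upwards [hh, hsmall] with t ht ht0
    exact ENNReal.toReal_le_of_le_ofReal (by have := ht0.1; positivity) ht
  · refine (hv.and_eventually hsmall).mono ?_
    rintro t ⟨ht, ht0⟩
    have h1 : volume.real (inSet S (t • (!₂[0, 1] : Eu 2)) (36 / 25)) ≤ W * t :=
      ENNReal.toReal_le_of_le_ofReal (by have := ht0.1; positivity) ht
    have hnt : ‖t • (!₂[0, 1] : Eu 2)‖ = t := by
      rw [norm_smul, hn, mul_one, Real.norm_eq_abs, abs_of_pos ht0.1]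
    have h2 := abs_volume_inSet_sub_outSet_le hS (w := t • (!₂[0, 1] : Eu 2)) (r := 36 / 25)
      (by norm_num) (by rw [hnt]; linarith [ht0.2])
    rw [hnt] at h2
    have h3 := (abs_le.1 h2).1
    rw [volume_real_diffSet hS]
    have hpi : 3 * Real.pi * (36 / 25) * t ≤ 18 * t :=
      mul_le_mul_of_nonneg_right (by linarith [Real.pi_le_four]) ht0.1.le
    linarith
  · have : 3 * W / (14 * W) = 3 / 14 := by field_simp
    rw [this]
    linarith

/-! ### The fractional kernel -/

theorem hasFDerivAt_norm_sq_rpow {n : ℕ} {z : Eu n} (hz : z ≠ 0) (a : ℝ) :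
    HasFDerivAt (fun w : Eu n => (‖w‖ ^ 2) ^ a)
      ((a * (‖z‖ ^ 2) ^ (a - 1)) • ((2 : ℕ) • innerSL ℝ z)) z :=
  (hasStrictFDerivAt_norm_sq z).hasFDerivAt.rpow_const
    (Or.inl (pow_ne_zero 2 (norm_ne_zero_iff.2 hz)))

theorem fderiv_norm_sq_rpow {n : ℕ} {z : Eu n} (hz : z ≠ 0) (a : ℝ) (e : Eu n) :
    fderiv ℝ (fun w : Eu n => (‖w‖ ^ 2) ^ a) z e =
      2 * a * (‖z‖ ^ 2) ^ (a - 1) * inner ℝ z e := by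
  rw [(hasFDerivAt_norm_sq_rpow hz a).fderiv]
  simp
  ring

theorem fderiv_fderiv_norm_sq_rpow {n : ℕ} {z : Eu n} (hz : z ≠ 0) (a : ℝ) (e : Eu n) :
    fderiv ℝ (fun v => fderiv ℝ (fun w : Eu n => (‖w‖ ^ 2) ^ a) v e) z e =
      2 * a * (2 * (a - 1) * (‖z‖ ^ 2) ^ (a - 1 - 1) * inner ℝ z e * inner ℝ z e +
        (‖z‖ ^ 2) ^ (a - 1) * inner ℝ e e) := by
  have he : (fun v => fderiv ℝ (fun w : Eu n => (‖w‖ ^ 2) ^ a) v e) =ᶠ[𝓝 z]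
      fun v => 2 * a * ((‖v‖ ^ 2) ^ (a - 1) * inner ℝ e v) := by
    filter_upwards [isOpen_compl_singleton.mem_nhds (show z ∈ ({0}ᶜ : Set (Eu n)) from hz)]
      with v hv
    rw [fderiv_norm_sq_rpow hv, real_inner_comm]
    ring
  rw [he.fderiv_eq]
  have h1 := ((hasFDerivAt_norm_sq_rpow hz (a - 1)).mul
    (innerSL ℝ e).hasFDerivAt).const_mul (2 * a)
  have h2 : fderiv ℝ (fun v : Eu n => 2 * a * ((‖v‖ ^ 2) ^ (a - 1) * inner ℝ e v)) z = _ :=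
    h1.fderiv
  rw [h2]
  simp
  rw [real_inner_comm z e]
  ring

theorem fracKernel_eq {s : ℝ} (z : Eu 2) :
    fracKernel 2 s z = (‖z‖ ^ 2) ^ (-((((2 : ℕ) : ℝ) + s) / 2)) := by
  rw [fracKernel, ← Real.rpow_natCast ‖z‖ 2, ← Real.rpow_mul (norm_nonneg z), one_div,
    ← Real.rpow_neg (norm_nonneg z)]
  congr 1
  push_cast
  ring

/-- The kernel of the fractional perimeter belongs to the class `𝓛₂`. -/
theorem kernelL2_fracKernel {s : ℝ} (hs : 0 < s) (hs1 : s < 1) :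
    KernelL2 s 1 18 (fracKernel 2 s) := by
  set a : ℝ := -((((2 : ℕ) : ℝ) + s) / 2) with ha
  have ha1 : a = -(1 + s / 2) := by rw [ha]; push_cast; ring
  have hfun : fracKernel 2 s = fun z : Eu 2 => (‖z‖ ^ 2) ^ a := funext fracKernel_eq
  have hpos : ∀ z : Eu 2, 0 ≤ 1 / ‖z‖ ^ (((2 : ℕ) : ℝ) + s) := fun z => by positivity
  refine ⟨fun z => by simp [fracKernel], ?_, fun z _ => le_rfl, fun z _ => ?_, ?_⟩
  · rw [hfun]
    refine ContDiffOn.rpow_const_of_ne (contDiff_norm_sq ℝ).contDiffOn fun z hz => ?_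
    exact pow_ne_zero 2 (norm_ne_zero_iff.2 hz)
  · exact div_le_div_of_nonneg_right (by norm_num) (by positivity)
  · intro z hz e he
    have hK : 1 / ‖z‖ ^ (((2 : ℕ) : ℝ) + s) = (‖z‖ ^ 2) ^ a := fracKernel_eq z
    have hz0 : 0 < ‖z‖ := norm_pos_iff.2 hz
    have hN : 0 < ‖z‖ ^ 2 := by positivity
    set k : ℝ := (‖z‖ ^ 2) ^ a with hk
    have hk0 : 0 < k := Real.rpow_pos_of_pos hN a
    have e1 : (‖z‖ ^ 2) ^ (a - 1) = k / ‖z‖ ^ 2 := by rw [Real.rpow_sub_one hN.ne']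
    have e2 : (‖z‖ ^ 2) ^ (a - 1 - 1) = k / ‖z‖ ^ 2 / ‖z‖ ^ 2 := by
      rw [Real.rpow_sub_one hN.ne', e1]
    have hi : |inner ℝ z e| ≤ ‖z‖ := by
      have := abs_real_inner_le_norm z e
      rwa [he, mul_one] at this
    have hee : inner ℝ e e = (1 : ℝ) := by rw [real_inner_self_eq_norm_sq, he]; norm_num
    rw [hfun, div_eq_mul_one_div, hK, max_le_iff, fderiv_norm_sq_rpow hz,
      fderiv_fderiv_norm_sq_rpow hz, e1, e2, hee]
    set m : ℝ := inner ℝ z e / ‖z‖ with hm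
    have hm1 : |m| ≤ 1 := by
      rw [hm, abs_div, abs_of_pos hz0]
      exact (div_le_one hz0).2 hi
    have hmm := sq_le_one_iff_abs_le_one m |>.2 hm1
    have hzm : inner ℝ z e = ‖z‖ * m := by rw [hm]; field_simp
    rw [hzm]
    have abs_z : |‖z‖| = ‖z‖ := abs_of_pos hz0
    constructor
    · have : ‖z‖ * |2 * a * (k / ‖z‖ ^ 2) * (‖z‖ * m)| = |2 * a * m| * k := by
        rw [show 2 * a * (k / ‖z‖ ^ 2) * (‖z‖ * m) = 2 * a * m * (k / ‖z‖) by field_simp,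
          abs_mul, abs_of_pos (div_pos hk0 hz0)]
        field_simp
      rw [this]
      refine mul_le_mul_of_nonneg_right ?_ hk0.le
      rw [abs_mul, ha1, abs_mul, abs_neg, abs_of_pos (by norm_num : (0 : ℝ) < 2),
        abs_of_pos (by linarith : 0 < 1 + s / 2)]
      nlinarith [abs_nonneg m]
    · have : ‖z‖ ^ 2 * |2 * a * (2 * (a - 1) * (k / ‖z‖ ^ 2 / ‖z‖ ^ 2) * (‖z‖ * m) * (‖z‖ * m) +
          k / ‖z‖ ^ 2 * 1)| = |2 * a * (2 * (a - 1) * m ^ 2 + 1)| * k := by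
        rw [show 2 * a * (2 * (a - 1) * (k / ‖z‖ ^ 2 / ‖z‖ ^ 2) * (‖z‖ * m) * (‖z‖ * m) +
          k / ‖z‖ ^ 2 * 1) = 2 * a * (2 * (a - 1) * m ^ 2 + 1) * (k / ‖z‖ ^ 2) by field_simp,
          abs_mul, abs_of_pos (div_pos hk0 hN)]
        field_simp
      rw [this]
      refine mul_le_mul_of_nonneg_right ?_ hk0.le
      rw [abs_mul, ha1, abs_mul, abs_neg, abs_of_pos (by norm_num : (0 : ℝ) < 2),
        abs_of_pos (by linarith : 0 < 1 + s / 2)]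
      -- With the prefactor 2 + s < 3 this gives at most 15, within the constant 18.
      have h5 : |2 * (-(1 + s / 2) - 1) * m ^ 2 + 1| ≤ 5 := by
        rw [abs_le]
        constructor <;> nlinarith [sq_nonneg m]
      nlinarith [abs_nonneg (2 * (-(1 + s / 2) - 1) * m ^ 2 + 1)]

/-! ### Transfer to the given set and conclusion -/

theorem image_isometry_ae_eq {n : ℕ} (U : Eu n ≃ₗᵢ[ℝ] Eu n) {E E' : Set (Eu n)}
    (h : E =ᵐ[volume] E') : (U '' E : Set (Eu n)) =ᵐ[volume] (U '' E' : Set (Eu n)) := by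
  rw [show U '' E = U.symm ⁻¹' E from U.toEquiv.image_eq_preimage_symm E,
    show U '' E' = U.symm ⁻¹' E' from U.toEquiv.image_eq_preimage_symm E']
  exact U.symm.measurePreserving.quasiMeasurePreserving.preimage_ae_eq h

theorem FlatL1.congr {ε : ℝ} {E E' : Set (Eu 2)} (h : FlatL1 ε E) (hE : E' =ᵐ[volume] E) :
    FlatL1 ε E' := by
  obtain ⟨t, ht, hb⟩ := h
  refine ⟨t, ht, le_of_eq_of_le (measure_congr ?_) hb⟩
  exact (hE.symmDiff (ae_eq_refl _)).inter (ae_eq_refl _)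

theorem IsSubgraphOff.congr {E E' : Set (Eu 2)} {bad : Set ℝ} {g : ℝ → ℝ}
    (h : IsSubgraphOff E bad g) (hE : E' =ᵐ[volume] E) : IsSubgraphOff E' bad g :=
  ((hE.inter (ae_eq_refl (ball (0 : Eu 2) 1))).diff
    (ae_eq_refl {x : Eu 2 | x 0 ∈ bad})).trans h

theorem FlatL1.nearHalfPlane {ε : ℝ} {E : Set (Eu 2)} (U : Eu 2 ≃ₗᵢ[ℝ] Eu 2)
    (h : FlatL1 ε (U '' E)) : NearHalfPlane ε E := by
  obtain ⟨t, -, hb⟩ := h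
  refine ⟨U.symm !₂[0, 1], t, by
    rw [LinearIsometryEquiv.norm_map]; simp [EuclideanSpace.norm_eq], ?_⟩
  rw [← U.measurePreserving.measure_preimage_emb U.toHomeomorph.measurableEmbedding] at hb
  convert hb using 2
  ext x
  have h1 : inner ℝ (U.symm !₂[0, 1]) x = (U x) 1 := by
    rw [← U.inner_map_map, U.apply_symm_apply]
    simp [PiLp.inner_apply, Fin.sum_univ_two]
  simp only [mem_inter_iff, Set.mem_symmDiff, mem_preimage, mem_ofPred_eq, mem_ball_zero_iff,
    LinearIsometryEquiv.norm_map, U.injective.mem_set_image, h1]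

/-- Stable sets are flat in the unit disc, after a rotation. -/
theorem exists_flatness_bound (s lam Lam : ℝ) (hs : 0 < s) (hs1 : s < 1) (hlam : 0 < lam) :
    ∃ C : ℝ, 0 < C ∧ ∀ (K : Eu 2 → ℝ) (R : ℝ) (E : Set (Eu 2)), KernelL2 s lam Lam K → 2 ≤ R →
      NullMeasurableSet E volume → IsStableSet K (ball 0 R) E →
      NearHalfPlane (C * R ^ (-s / 2)) E ∧ ∃ U : Eu 2 ≃ₗᵢ[ℝ] Eu 2, IsRotation U ∧
        FlatL1 (C * R ^ (-s / 2)) (U '' E) ∧ FlatGraph (C * R ^ (-s / 2)) (U '' E) ∧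
        FlatGraphOsc (C * R ^ (-s / 2)) (U '' E) ∧
        FlatPer (20 * (1 + C * R ^ (-s / 2))) (C * R ^ (-s / 2)) (U '' E) := by
  -- For Lam ≤ 0 the class of kernels is empty, so any constant works.
  rcases le_or_gt Lam 0 with hLam | hLam
  · refine ⟨1, one_pos, fun K R E hK => ?_⟩
    have hz : (EuclideanSpace.single 0 1 : Eu 2) ≠ 0 := by simp
    exact absurd (hK.Lam_pos hlam hz) (not_lt.2 hLam)
  obtain ⟨C, hC, hbound⟩ := exists_smallProduct_bound s lam Lam hs hs1 hlam hLam
  refine ⟨14 * C, by positivity, fun K R E' hK hR hE' hst => ?_⟩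
  have hE := measurableSet_toMeasurable volume E'
  have hEE : toMeasurable volume E' =ᵐ[volume] E' := hE'.toMeasurable_ae_eq
  set E := toMeasurable volume E'
  have hW : 0 < C * R ^ (-s / 2) := mul_pos hC (Real.rpow_pos_of_pos (by linarith) _)
  obtain ⟨U, hU, hh, hv⟩ := (hbound hK hE hEE hst hR).exists_rotation hE hW
  have hS := measurableSet_image_isometry U hE
  have hSS := image_isometry_ae_eq U hEE.symm
  rw [mul_assoc]
  have hL1 := (flatL1_of_small_variation hS hW hh hv).congr hSS
  obtain ⟨bad, g, h1, h2, h3, h4, h5, h6, h7⟩ :=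
    exists_graph_in_disc_of_small_variation hS hW hh hv
  exact ⟨hL1.nearHalfPlane U, U, hU, hL1,
    ⟨bad, g, h1.trans Ioo_subset_Icc_self, h2, h3, h4, fun y _ => Ioo_subset_Icc_self (h5 y),
      h7.congr hSS⟩,
    ⟨bad, g, h1, h2, h3, h4, fun y _ => h5 y, h6, h7.congr hSS⟩,
    flatPer_of_small_variation hS hSS hW hh hv⟩

end NonlocalPerimeter

theorem theorem1p7 :
    -- flatness for kernels in the class `𝓛₂(s, lam, Lam)`; `C₀` is a universal constant
    (∃ C₀ : ℝ, 0 < C₀ ∧ ∀ s lam Lam : ℝ, 0 < s → s < 1 → 0 < lam →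
      ∃ C : ℝ, 0 < C ∧
        ∀ (K : NonlocalPerimeter.Eu 2 → ℝ) (R : ℝ) (E : Set (NonlocalPerimeter.Eu 2)),
          NonlocalPerimeter.KernelL2 s lam Lam K → 4 ≤ R →
          NullMeasurableSet E volume →
          NonlocalPerimeter.IsStableSet K (ball 0 R) E →
          (∃ U : NonlocalPerimeter.Eu 2 ≃ₗᵢ[ℝ] NonlocalPerimeter.Eu 2,
            NonlocalPerimeter.IsRotation U ∧
            NonlocalPerimeter.FlatL1 (C * R ^ (-s / 2)) (U '' E) ∧
            NonlocalPerimeter.FlatGraph (C * R ^ (-s / 2)) (U '' E) ∧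
            NonlocalPerimeter.FlatPer (C₀ * (1 + C * R ^ (-s / 2))) (C * R ^ (-s / 2)) (U '' E)) ∧
          NonlocalPerimeter.NearHalfPlane (C * R ^ (-s / 2)) E) ∧
    -- the case of the fractional `s`-perimeter
    (∀ s : ℝ, 0 < s → s < 1 →
      ∃ C : ℝ, 0 < C ∧
        ∀ (R : ℝ) (E : Set (NonlocalPerimeter.Eu 2)), 2 ≤ R →
          NullMeasurableSet E volume →
          NonlocalPerimeter.IsStableSet (NonlocalPerimeter.fracKernel 2 s) (ball 0 R) E →
          NonlocalPerimeter.NearHalfPlane (C * R ^ (-s / 2)) E ∧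
          ∃ U : NonlocalPerimeter.Eu 2 ≃ₗᵢ[ℝ] NonlocalPerimeter.Eu 2,
            NonlocalPerimeter.IsRotation U ∧
            NonlocalPerimeter.FlatGraphOsc (C * R ^ (-s / 2)) (U '' E)) := by
  refine ⟨⟨20, by norm_num, fun s lam Lam hs hs1 hlam => ?_⟩, fun s hs hs1 => ?_⟩
  · obtain ⟨C, hC, h⟩ := NonlocalPerimeter.exists_flatness_bound s lam Lam hs hs1 hlam
    refine ⟨C, hC, fun K R E hK hR hE hst => ?_⟩
    obtain ⟨hN, U, hU, h1, h2, -, h3⟩ := h K R E hK (by linarith) hE hst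
    exact ⟨⟨U, hU, h1, h2, h3⟩, hN⟩
  · obtain ⟨C, hC, h⟩ := NonlocalPerimeter.exists_flatness_bound s 1 18 hs hs1 one_pos
    refine ⟨C, hC, fun R E hR hE hst => ?_⟩
    obtain ⟨hN, U, hU, -, -, h4, -⟩ :=
      h _ R E (NonlocalPerimeter.kernelL2_fracKernel hs hs1) hR hE hst
    exact ⟨hN, U, hU, h4⟩
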